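/- Let $k$ be a field. A toric variety over a field $K$ means a normal toric variety with split dense torus, i.e. a separated $K$-scheme that is the toric variety of a finite fan $\Sigma$ of strongly convex rational polyhedral cones in $N_{\mathbb R}$, $N\cong\mathbb Z^n$: it is glued from the affine schemes $U_\sigma=\operatorname{Spec} K[\sigma^\vee\cap M]$, $\sigma\in\Sigma$, with $U_\sigma\cap U_\tau=U_{\sigma\cap\tau}$. A torus-equivariant morphism of toric varieties over $K$ means a toric morphism, i.e. a $K$-morphism mapping the dense torus of the source to the dense torus of the target by a homomorphism of tori. Let $X\to B$ and $Y\to B$ be torus-equivariant morphisms of toric varieties over $k$, let $F=X\times_B Y$ be the fiber product in the category of schemes, let $C$ be an irreducible component of $F$ with its reduced scheme structure, and let $\widetilde C$ be its normalization. Then: 1. There is an integer $n\ge 1$, invertible in $k$, such that $\widetilde C$ is a toric variety over the cyclotomic extension $k(\zeta_n)$ of $k$; that is, there is a morphism of $k$-schemes $\widetilde C\to\operatorname{Spec} k(\zeta_n)$ that makes $\widetilde C$ a toric variety over $k(\zeta_n)$. 2. If for every $n\ge 1$ invertible in $k$ the polynomial $x^n-1$ splits into linear factors over $k$ (for example, if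 $k$ is algebraically closed), then $\widetilde C$ is a toric variety over $k$. -/

import Mathlib

open CategoryTheory CategoryTheory.Limits AlgebraicGeometry

universe u

noncomputable section

namespace Toric

/-! ### Fans -/

/-- The integral points `σ^∨ ∩ M` of the dual of a cone `σ ⊆ N_ℝ = ℝⁿ`, where `N = M = ℤⁿ` with
the standard pairing. -/
def dualMonoid {n : ℕ} (σ : PointedCone ℝ (Fin n → ℝ)) : AddSubmonoid (Fin n → ℤ) where
  carrier := {m | ∀ v ∈ σ, 0 ≤ ∑ i, (m i : ℝ) * v i}
  zero_mem' := by
    intro v _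
    simp
  add_mem' := by
    intro a b ha hb v hv
    have h : ∑ i, (((a + b) i : ℤ) : ℝ) * v i
        = ∑ i, (a i : ℝ) * v i + ∑ i, (b i : ℝ) * v i := by
      rw [← Finset.sum_add_distrib]
      refine Finset.sum_congr rfl fun i _ => ?_
      simp [add_mul]
    rw [h]
    exact add_nonneg (ha v hv) (hb v hv)

theorem dualMonoid_anti {n : ℕ} {τ σ : PointedCone ℝ (Fin n → ℝ)} (h : τ ≤ σ) :
    dualMonoid σ ≤ dualMonoid τ :=
  fun _ hm v hv => hm v (h hv)

/-- A (finite) fan in `ℝⁿ` with respect to the lattice `ℤⁿ`: a non-empty finite set of strongly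
convex rational polyhedral cones, closed under taking faces, any two of which intersect in a
common face. -/
structure Fan (n : ℕ) where
  cones : Set (PointedCone ℝ (Fin n → ℝ))
  finite : cones.Finite
  nonempty : cones.Nonempty
  rational : ∀ σ ∈ cones, ∃ s : Finset (Fin n → ℤ),
    σ = PointedCone.hull ℝ ((fun (v : Fin n → ℤ) (i : Fin n) => (v i : ℝ)) '' (s : Set _))
  stronglyConvex : ∀ σ ∈ cones, ∀ v ∈ σ, -v ∈ σ → v = 0
  face_mem : ∀ σ ∈ cones, ∀ τ : PointedCone ℝ (Fin n → ℝ), τ.IsFaceOf σ → τ ∈ cones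
  inf_isFaceOf : ∀ σ ∈ cones, ∀ τ ∈ cones, (σ ⊓ τ).IsFaceOf σ

theorem Fan.inf_mem {n : ℕ} (Δ : Fan n) (σ τ : Δ.cones) : σ.1 ⊓ τ.1 ∈ Δ.cones :=
  Δ.face_mem _ σ.2 _ (Δ.inf_isFaceOf _ σ.2 _ τ.2)

theorem Fan.bot_mem {n : ℕ} (Δ : Fan n) : (⊥ : PointedCone ℝ (Fin n → ℝ)) ∈ Δ.cones := by
  obtain ⟨σ, hσ⟩ := Δ.nonempty
  refine Δ.face_mem σ hσ ⊥ ⟨bot_le, ?_⟩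
  intro x y a hx hy ha h
  have h0 : a • x + y = 0 := by simpa using h
  have hax : a • x ∈ σ := σ.smul_mem ha.le hx
  have hneg : -(a • x) ∈ σ := by
    rw [neg_eq_of_add_eq_zero_right h0]
    exact hy
  have h1 := Δ.stronglyConvex σ hσ _ hax hneg
  have : x = 0 := (smul_eq_zero.mp h1).resolve_left ha.ne'
  simp [this]

/-! ### Affine toric varieties and tori -/

/-- `Spec k[P]` for a commutative (additive) monoid `P`. -/
abbrev specMonoid (k : Type u) [Field k] (P : Type) [AddCommMonoid P] : Scheme.{u} :=
  Spec (.of (AddMonoidAlgebra k P))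

/-- The morphism `Spec k[Q] ⟶ Spec k[P]` induced by a homomorphism `P → Q`. -/
def specMonoidMap (k : Type u) [Field k] {P Q : Type} [AddCommMonoid P] [AddCommMonoid Q]
    (φ : P →+ Q) : specMonoid k Q ⟶ specMonoid k P :=
  Spec.map (CommRingCat.ofHom (AddMonoidAlgebra.mapDomainRingHom k φ))

/-- The structure morphism `Spec k[P] ⟶ Spec k`. -/
def specMonoidStr (k : Type u) [Field k] (P : Type) [AddCommMonoid P] :
    specMonoid k P ⟶ Spec (.of k) :=
  Spec.map (CommRingCat.ofHom (algebraMap k (AddMonoidAlgebra k P)))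

/-! ### Toric varieties -/

/-- A (normal) toric variety over `k`: a separated `k`-scheme `X` together with a fan and an
identification of `X` with the toric variety of that fan, that is, with the scheme obtained by
gluing the affine toric varieties `U_σ = Spec k[σ^∨ ∩ M]`, for `σ` in the fan, such that `U_σ` and
`U_τ` are glued along `U_{σ ∩ τ}`. -/
structure ToricVariety (k : Type u) [Field k] where
  X : Scheme.{u}
  str : X ⟶ Spec (.of k)
  isSeparated : IsSeparated str
  /-- the dimension, which is the rank of the lattices `M = N = ℤⁿ` -/
  rank : ℕ
  fan : Fan rank
  chart (σ : fan.cones) : specMonoid k (dualMonoid σ.1) ⟶ X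
  chart_isOpenImmersion : ∀ σ, IsOpenImmersion (chart σ)
  chart_str : ∀ σ, chart σ ≫ str = specMonoidStr k (dualMonoid σ.1)
  chart_face : ∀ (σ τ : fan.cones) (h : τ.1 ≤ σ.1),
    specMonoidMap k (AddSubmonoid.inclusion (dualMonoid_anti h)) ≫ chart σ = chart τ
  chart_inter : ∀ σ τ : fan.cones,
    Set.range (chart σ) ∩ Set.range (chart τ) = Set.range (chart ⟨σ.1 ⊓ τ.1, fan.inf_mem σ τ⟩)
  chart_cover : ⋃ σ, Set.range (chart σ) = Set.univ

namespace ToricVariety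

variable {k : Type u} [Field k]

/-- The inclusion `T_X = Spec k[M] ⟶ X` of the dense torus, which is the chart of the zero cone
(note that `dualMonoid ⊥` is all of `M = ℤⁿ`). -/
def torusIncl (V : ToricVariety k) : specMonoid k (Fin V.rank → ℤ) ⟶ V.X :=
  specMonoidMap k (dualMonoid ⊥).subtype ≫ V.chart ⟨⊥, V.fan.bot_mem⟩

/-- A torus-equivariant morphism (toric morphism) of toric varieties: a morphism of `k`-schemes
that maps the dense torus of the source to the dense torus of the target by a homomorphism of
tori. A homomorphism of split tori is given by a homomorphism of character lattices in the other
direction. -/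
structure Hom (V W : ToricVariety k) where
  hom : V.X ⟶ W.X
  hom_str : hom ≫ W.str = V.str
  exists_torusHom : ∃ φ : (Fin W.rank → ℤ) →+ (Fin V.rank → ℤ),
    V.torusIncl ≫ hom = specMonoidMap k φ ≫ W.torusIncl

end ToricVariety

/-- A scheme `Z` over `k` is a toric variety over the field extension `K` of `k`: there is a
morphism `Z ⟶ Spec K` of schemes over `k` which makes `Z` a toric variety over `K`. -/
def IsToricOver {k : Type u} [Field k] (K : Type u) [Field K] [Algebra k K] {Z : Scheme.{u}}
    (s : Z ⟶ Spec (.of k)) : Prop :=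
  ∃ (V : ToricVariety K) (e : V.X ≅ Z),
    e.hom ≫ s = V.str ≫ Spec.map (CommRingCat.ofHom (algebraMap k K))

/-! ### Irreducible components and normalization -/

section Component

variable (F : Scheme.{u}) (C : irreducibleComponents F)

/-- An irreducible component as a closed subset. -/
def componentClosed : TopologicalSpace.Closeds F :=
  ⟨C.1, isClosed_of_mem_irreducibleComponents C.1 C.2⟩

/-- An irreducible component of `F`, equipped with its reduced scheme structure. -/
def component : Scheme.{u} :=
  (Scheme.IdealSheafData.vanishingIdeal (componentClosed F C)).subscheme

/-- The inclusion of an irreducible component with its reduced structure. -/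
def componentι : component F C ⟶ F :=
  (Scheme.IdealSheafData.vanishingIdeal (componentClosed F C)).subschemeι

instance : IsClosedImmersion (componentι F C) :=
  inferInstanceAs (IsClosedImmersion
    (Scheme.IdealSheafData.vanishingIdeal (componentClosed F C)).subschemeι)

theorem range_componentι : Set.range (componentι F C) = C.1 := by
  change Set.range (Scheme.IdealSheafData.vanishingIdeal (componentClosed F C)).subschemeι = C.1
  rw [Scheme.IdealSheafData.range_subschemeι, Scheme.IdealSheafData.coe_support_vanishingIdeal]
  rfl

instance : IrreducibleSpace (component F C) :=
  Subtype.irreducibleSpace (show IsIrreducible C.1 from C.2.1)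

instance : IsReduced (component F C) := by
  let I := Scheme.IdealSheafData.vanishingIdeal (componentClosed F C)
  have (U : I.subschemeCover.openCover.I₀) : IsReduced (I.subschemeCover.openCover.X U) := by
    let U : F.affineOpens := U
    have hr : (I.ideal U).IsRadical := by
      simp only [I, Scheme.IdealSheafData.vanishingIdeal_ideal]
      exact PrimeSpectrum.isRadical_vanishingIdeal _
    have : _root_.IsReduced (Γ(F, U.1) ⧸ I.ideal U) :=
      (Ideal.isRadical_iff_quotient_reduced _).mp hr
    exact inferInstanceAs (IsReduced (Spec (.of (Γ(F, U.1) ⧸ I.ideal U))))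
  exact IsReduced.of_openCover I.subscheme I.subschemeCover.openCover

instance : IsIntegral (component F C) :=
  isIntegral_of_irreducibleSpace_of_isReduced _

instance [QuasiSeparatedSpace F] : QuasiSeparatedSpace (component F C) := by
  exact quasiSeparatedSpace_of_quasiSeparated (componentι F C)

end Component

section Normalization

variable (Z : Scheme.{u}) [IsIntegral Z]

/-- The inclusion `Spec K(Z) ⟶ Z` of the generic point of an integral scheme. -/
def genericPointIncl : Spec Z.functionField ⟶ Z :=
  Z.fromSpecStalk (genericPoint Z)

variable [QuasiSeparatedSpace Z]

instance : QuasiCompact (genericPointIncl Z) := by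
  unfold genericPointIncl; infer_instance

instance : QuasiSeparated (genericPointIncl Z) := by
  unfold genericPointIncl; infer_instance

/-- The normalization of an integral scheme: its relative normalization in the spectrum of its
function field. -/
def normalization : Scheme.{u} :=
  (genericPointIncl Z).normalization

/-- The normalization morphism. -/
def normalizationMap : normalization Z ⟶ Z :=
  (genericPointIncl Z).fromNormalization

end Normalization

/-! ### The fiber product -/

section FiberProduct

variable {k : Type u} [Field k] {X Y B : ToricVariety k} (f : X.Hom B) (g : Y.Hom B)

/-- The scheme-theoretic fiber product. -/
def fiberProduct : Scheme.{u} := pullback f.hom g.hom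

/-- The structure morphism of the fiber product to `Spec k`. -/
def fiberProductStr : fiberProduct f g ⟶ Spec (.of k) :=
  pullback.fst f.hom g.hom ≫ X.str

instance : IsSeparated (fiberProductStr f g) := by
  have := X.isSeparated
  have hY : IsSeparated (g.hom ≫ B.str) := by
    rw [g.hom_str]
    exact Y.isSeparated
  have : IsSeparated g.hom := IsSeparated.of_comp g.hom B.str
  exact inferInstanceAs (IsSeparated (pullback.fst f.hom g.hom ≫ X.str))

instance : QuasiSeparatedSpace (fiberProduct f g) := by
  exact quasiSeparatedSpace_of_quasiSeparated (fiberProductStr f g)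

/-- The normalization of the irreducible component `C` (with its reduced structure) of the fiber
product, as a scheme over `k`. -/
def normalizedComponentStr (C : irreducibleComponents (fiberProduct f g)) :
    normalization (component (fiberProduct f g) C) ⟶ Spec (.of k) :=
  normalizationMap (component (fiberProduct f g) C) ≫ componentι (fiberProduct f g) C ≫
    fiberProductStr f g

end FiberProduct

end Toric

end

/-! Let `L` be the function field of the component `C`, and consider its generic point as a morphism
`Spec L ⟶ F`. Its images in `X` and `Y` are field-valued points of toric varieties. At such a point
the characters that are regular and non-zero form a group, and evaluation is a multiplicative
character of that group with values in `L` (`nonempty_pointChar`). Let `G`, `G'` be the groups for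
`X` and `Y`. The two evaluations agree on functions from the base, so their product factors through
the quotient `A` of `G × G'` by the relations `(φ b, -ψ b)`, giving a character `η` of `A`.

Near the generic point of `C` the coordinate ring of `F` maps onto `k[A]`, compatibly with the maps
to `L` (`exists_surjective_groupAlgebra`). Since `C` is a component, the kernel of the map to `L` is
a minimal prime (`ker_le_of_le_ker`), so the kernel of `k[A] → L` is minimal too. Write `A` as `ℤ^r`
plus a finite group. The values of `η` on the finite group form a cyclic group of roots of unity, of
order invertible in `k`, and generate a field `K = k(ζ_n)` (`exists_primitiveRoot_adjoin_eq`).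
Minimality makes `K[ℤ^r] → L` injective (`laurentHom_injective`), and `L` is the fraction field of
`K[ℤ^r]`.

On a chart of `F` that meets `C` in its generic point, the image of the coordinate ring in `L` is
generated over `k` by the values of `η` on a finitely generated submonoid `D` of `A`. Its integral
closure in `L` is `K[S]`, where `S` is the saturation of the image of `D` in `ℤ^r`
(`isIntegral_iff_mem_range_laurentHom`). By Farkas' lemma `S` consists of the lattice points dual to
a rational cone. The cones obtained in this way form a fan, because separation of cones in the fans
of `X` and `Y` survives products and quotients. So the normalization of `C` is covered by the charts
of a toric variety over `K`, and these glue correctly because all maps are determined at the generic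
point (`isToricOver_of_charts`). If the roots of unity already lie in `k`, then `K` can be taken to
be `k`. -/

noncomputable section

namespace Toric

/-! ### Rational cones and lattice points -/

/-- An integral vector regarded as a real vector. -/
def castVec {n : ℕ} (v : Fin n → ℤ) (i : Fin n) : ℝ := (v i : ℝ)

theorem castVec_add {n : ℕ} (v w : Fin n → ℤ) : castVec (v + w) = castVec v + castVec w := by
  ext i; simp [castVec]

theorem castVec_neg {n : ℕ} (v : Fin n → ℤ) : castVec (-v) = -castVec v := by
  ext i; simp [castVec]

theorem castVec_zero {n : ℕ} : castVec (0 : Fin n → ℤ) = 0 := by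
  ext i; simp [castVec]

theorem castVec_sub {n : ℕ} (v w : Fin n → ℤ) : castVec (v - w) = castVec v - castVec w := by
  ext i; simp [castVec]

theorem castVec_zsmul {n : ℕ} (a : ℤ) (v : Fin n → ℤ) :
    castVec (a • v) = (a : ℝ) • castVec v := by
  ext i; simp [castVec]

theorem castVec_nsmul {n : ℕ} (a : ℕ) (v : Fin n → ℤ) :
    castVec (a • v) = (a : ℝ) • castVec v := by
  ext i; simp [castVec]

theorem castVec_dotProduct {n : ℕ} (v w : Fin n → ℤ) :
    castVec v ⬝ᵥ castVec w = ((v ⬝ᵥ w : ℤ) : ℝ) := by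
  simp [castVec, dotProduct]

theorem mem_dualMonoid {n : ℕ} {σ : PointedCone ℝ (Fin n → ℝ)} {m : Fin n → ℤ} :
    m ∈ dualMonoid σ ↔ ∀ v ∈ σ, 0 ≤ castVec m ⬝ᵥ v := Iff.rfl

theorem dotProduct_nonneg_of_mem_hull {n : ℕ} {s : Set (Fin n → ℝ)} {g : Fin n → ℝ}
    (h : ∀ v ∈ s, 0 ≤ g ⬝ᵥ v) {v : Fin n → ℝ} (hv : v ∈ PointedCone.hull ℝ s) : 0 ≤ g ⬝ᵥ v := by
  induction hv using Submodule.span_induction with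
  | mem x hx => exact h x hx
  | zero => simp
  | add x y _ _ hx hy => rw [dotProduct_add]; exact add_nonneg hx hy
  | smul a x _ hx =>
    change 0 ≤ g ⬝ᵥ ((a : ℝ) • x)
    rw [dotProduct_smul]
    exact mul_nonneg a.2 hx

theorem mem_dualMonoid_hull {n : ℕ} {s : Set (Fin n → ℤ)} {m : Fin n → ℤ} :
    m ∈ dualMonoid (PointedCone.hull ℝ (castVec '' s)) ↔ ∀ v ∈ s, 0 ≤ m ⬝ᵥ v := by
  rw [mem_dualMonoid]
  constructor
  · intro h v hv
    have := h _ (Submodule.subset_span (Set.mem_image_of_mem _ hv))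
    rw [castVec_dotProduct] at this
    exact_mod_cast this
  · intro h v hv
    refine dotProduct_nonneg_of_mem_hull ?_ hv
    rintro _ ⟨w, hw, rfl⟩
    rw [castVec_dotProduct]
    exact_mod_cast h w hw

/-- Gordan's lemma. -/
theorem fg_dualMonoid_hull {n : ℕ} (s : Finset (Fin n → ℤ)) :
    (dualMonoid (PointedCone.hull ℝ (castVec '' (s : Set (Fin n → ℤ))))).FG := by
  let f : (Fin n → ℕ) × (Fin n → ℕ) × (s → ℕ) →+ (s → ℤ) :=
    { toFun := fun x v => (fun i => (x.1 i : ℤ)) ⬝ᵥ v.1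
      map_zero' := by ext; simp [dotProduct]
      map_add' := fun x y => by ext; simp [dotProduct, add_mul, Finset.sum_add_distrib] }
  let g : (Fin n → ℕ) × (Fin n → ℕ) × (s → ℕ) →+ (s → ℤ) :=
    { toFun := fun x v => (fun i => (x.2.1 i : ℤ)) ⬝ᵥ v.1 + x.2.2 v
      map_zero' := by ext; simp [dotProduct]
      map_add' := fun x y => by
        ext; simp [dotProduct, add_mul, Finset.sum_add_distrib]; ring }
  let h : (Fin n → ℕ) × (Fin n → ℕ) × (s → ℕ) →+ (Fin n → ℤ) :=
    { toFun := fun x i => (x.1 i : ℤ) - x.2.1 i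
      map_zero' := by ext; simp
      map_add' := fun x y => by ext; simp; ring }
  have key : dualMonoid (PointedCone.hull ℝ (castVec '' (s : Set (Fin n → ℤ)))) =
      (f.eqLocusM g).map h := by
    ext m
    rw [mem_dualMonoid_hull]
    constructor
    · intro hm
      -- The monoid is the image of an equalizer of maps between free monoids: write `m` as a
      -- difference of natural vectors and record the pairings with the generators as slack
      -- variables.
      refine ⟨(fun i => (m i).toNat, fun i => (-m i).toNat, fun v => (m ⬝ᵥ v.1).toNat), ?_, ?_⟩
      · change f _ = g _
        ext v
        have hv : ((m ⬝ᵥ v.1).toNat : ℤ) = m ⬝ᵥ v.1 := Int.toNat_of_nonneg (hm v.1 v.2)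
        change (fun i => (((m i).toNat : ℕ) : ℤ)) ⬝ᵥ v.1 =
          (fun i => (((-m i).toNat : ℕ) : ℤ)) ⬝ᵥ v.1 + ((m ⬝ᵥ v.1).toNat : ℤ)
        rw [hv, ← add_dotProduct]
        congr 1
        ext i
        simp only [Pi.add_apply]
        omega
      · ext i
        change ((m i).toNat : ℤ) - ((-m i).toNat : ℤ) = m i
        omega
    · rintro ⟨x, hx, rfl⟩ v hv
      have h1 : (fun i => (x.1 i : ℤ)) ⬝ᵥ v = (fun i => (x.2.1 i : ℤ)) ⬝ᵥ v + x.2.2 ⟨v, hv⟩ :=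
        congrFun (show f x = g x from hx) ⟨v, hv⟩
      have h2 : h x = (fun i => (x.1 i : ℤ)) - fun i => (x.2.1 i : ℤ) := rfl
      rw [h2, sub_dotProduct, h1]
      simp
  rw [key]
  exact (AddSubmonoid.fg_eqLocusM f g).map h

/-! ### The double description method: Minkowski–Weyl and Farkas over the integers. -/

/-- One step of the double description method: generators of the intersection of the cone
generated by `s` with the half space defined by `g`. -/
def halfSpaceGenerators {n : ℕ} (s : Finset (Fin n → ℤ)) (g : Fin n → ℤ) : Finset (Fin n → ℤ) :=
  s.filter (fun v => 0 ≤ g ⬝ᵥ v) ∪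
    Finset.image₂ (fun v w => (g ⬝ᵥ v) • w - (g ⬝ᵥ w) • v)
      (s.filter fun v => 0 < g ⬝ᵥ v) (s.filter fun v => g ⬝ᵥ v < 0)

theorem mem_halfSpaceGenerators_of_nonneg {n : ℕ} {s : Finset (Fin n → ℤ)} {g v : Fin n → ℤ}
    (hv : v ∈ s) (h : 0 ≤ g ⬝ᵥ v) : v ∈ halfSpaceGenerators s g :=
  Finset.mem_union_left _ (Finset.mem_filter.mpr ⟨hv, h⟩)

theorem mem_halfSpaceGenerators_of_pos_neg {n : ℕ} {s : Finset (Fin n → ℤ)} {g v w : Fin n → ℤ}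
    (hv : v ∈ s) (h : 0 < g ⬝ᵥ v) (hw : w ∈ s) (h' : g ⬝ᵥ w < 0) :
    (g ⬝ᵥ v) • w - (g ⬝ᵥ w) • v ∈ halfSpaceGenerators s g :=
  Finset.mem_union_right _ (Finset.mem_image₂_of_mem (Finset.mem_filter.mpr ⟨hv, h⟩)
    (Finset.mem_filter.mpr ⟨hw, h'⟩))

/-- Split a vector of the cone as `p + q`, with `p` from generators where `g ≥ 0` and `q` from
generators where `g < 0`. The combination `(g·p) q - (g·q) p` is bilinear in `p` and `q`, so it lies
in the new cone because it does so on generators. If `g·p > 0`, then `p + q` is a positive multiple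
of it plus a non-negative multiple of `p`. -/
theorem hull_halfSpaceGenerators {n : ℕ} (s : Finset (Fin n → ℤ)) (g : Fin n → ℤ)
    (v : Fin n → ℝ) :
    v ∈ PointedCone.hull ℝ (castVec '' (halfSpaceGenerators s g : Set (Fin n → ℤ))) ↔
      v ∈ PointedCone.hull ℝ (castVec '' (s : Set (Fin n → ℤ))) ∧ 0 ≤ castVec g ⬝ᵥ v := by
  set H := PointedCone.hull ℝ (castVec '' (halfSpaceGenerators s g : Set (Fin n → ℤ))) with hH
  constructor
  · intro hv
    refine ⟨Submodule.span_le.mpr ?_ hv, dotProduct_nonneg_of_mem_hull ?_ hv⟩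
    · rintro _ ⟨w, hw, rfl⟩
      rcases Finset.mem_union.mp hw with hw | hw
      · exact Submodule.subset_span ⟨w, (Finset.mem_filter.mp hw).1, rfl⟩
      · obtain ⟨a, ha, b, hb, rfl⟩ := Finset.mem_image₂.mp hw
        rw [Finset.mem_filter] at ha hb
        rw [sub_eq_add_neg, ← neg_smul, castVec_add, castVec_zsmul, castVec_zsmul]
        refine add_mem (PointedCone.smul_mem _ ?_ (Submodule.subset_span ⟨b, hb.1, rfl⟩))
          (PointedCone.smul_mem _ ?_ (Submodule.subset_span ⟨a, ha.1, rfl⟩))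
        · exact_mod_cast ha.2.le
        · exact_mod_cast (neg_pos.mpr hb.2).le
    · rintro _ ⟨w, hw, rfl⟩
      rw [castVec_dotProduct]
      norm_cast
      rcases Finset.mem_union.mp hw with hw | hw
      · exact (Finset.mem_filter.mp hw).2
      · obtain ⟨a, ha, b, hb, rfl⟩ := Finset.mem_image₂.mp hw
        rw [dotProduct_sub, dotProduct_smul, dotProduct_smul]
        simp only [smul_eq_mul]
        rw [mul_comm, sub_self]
  · rintro ⟨hv, hg⟩
    let Sp : Set (Fin n → ℝ) := castVec '' {v | v ∈ s ∧ 0 ≤ g ⬝ᵥ v}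
    let Sn : Set (Fin n → ℝ) := castVec '' {v | v ∈ s ∧ g ⬝ᵥ v < 0}
    have hS : castVec '' (s : Set (Fin n → ℤ)) = Sp ∪ Sn := by
      rw [← Set.image_union]
      congr 1
      ext x
      have := le_or_gt 0 (g ⬝ᵥ x)
      simp only [Finset.mem_coe, Set.mem_union, Set.mem_ofPred_eq]
      tauto
    have hpH : PointedCone.hull ℝ Sp ≤ H := by
      refine Submodule.span_le.mpr ?_
      rintro _ ⟨w, hw, rfl⟩
      exact Submodule.subset_span ⟨w, mem_halfSpaceGenerators_of_nonneg hw.1 hw.2, rfl⟩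
    have hSpg : ∀ p ∈ PointedCone.hull ℝ Sp, 0 ≤ castVec g ⬝ᵥ p := by
      intro p hp
      refine dotProduct_nonneg_of_mem_hull ?_ hp
      rintro _ ⟨w, hw, rfl⟩
      rw [castVec_dotProduct]
      exact_mod_cast hw.2
    have hbil : ∀ p ∈ PointedCone.hull ℝ Sp, ∀ q ∈ PointedCone.hull ℝ Sn,
        (castVec g ⬝ᵥ p) • q - (castVec g ⬝ᵥ q) • p ∈ H := by
      intro p hp q hq
      induction hq using Submodule.span_induction with
      | zero => simp
      | add x y _ _ hx hy =>
        have : (castVec g ⬝ᵥ p) • (x + y) - (castVec g ⬝ᵥ (x + y)) • p =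
          ((castVec g ⬝ᵥ p) • x - (castVec g ⬝ᵥ x) • p) +
          ((castVec g ⬝ᵥ p) • y - (castVec g ⬝ᵥ y) • p) := by
          rw [dotProduct_add]; module
        rw [this]; exact add_mem hx hy
      | smul a x _ hx =>
        have : (castVec g ⬝ᵥ p) • (a • x) - (castVec g ⬝ᵥ (a • x)) • p =
          (a : ℝ) • ((castVec g ⬝ᵥ p) • x - (castVec g ⬝ᵥ x) • p) := by
          change (castVec g ⬝ᵥ p) • ((a : ℝ) • x) - (castVec g ⬝ᵥ ((a : ℝ) • x)) • p = _
          rw [dotProduct_smul, smul_eq_mul]; module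
        rw [this]; exact PointedCone.smul_mem _ a.2 hx
      | mem q hq =>
        obtain ⟨w, hw, rfl⟩ := hq
        induction hp using Submodule.span_induction with
        | zero => simp
        | add x y _ _ hx hy =>
          have : (castVec g ⬝ᵥ (x + y)) • castVec w - (castVec g ⬝ᵥ castVec w) • (x + y) =
            ((castVec g ⬝ᵥ x) • castVec w - (castVec g ⬝ᵥ castVec w) • x) +
            ((castVec g ⬝ᵥ y) • castVec w - (castVec g ⬝ᵥ castVec w) • y) := by
            rw [dotProduct_add]; module
          rw [this]; exact add_mem hx hy
        | smul a x _ hx =>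
          have : (castVec g ⬝ᵥ (a • x)) • castVec w - (castVec g ⬝ᵥ castVec w) • (a • x) =
            (a : ℝ) • ((castVec g ⬝ᵥ x) • castVec w - (castVec g ⬝ᵥ castVec w) • x) := by
            change (castVec g ⬝ᵥ ((a : ℝ) • x)) • castVec w -
              (castVec g ⬝ᵥ castVec w) • ((a : ℝ) • x) = _
            rw [dotProduct_smul, smul_eq_mul]; module
          rw [this]; exact PointedCone.smul_mem _ a.2 hx
        | mem p hp =>
          obtain ⟨v, hv, rfl⟩ := hp
          rcases hv.2.lt_or_eq with h | h
          · rw [castVec_dotProduct, castVec_dotProduct, ← castVec_zsmul, ← castVec_zsmul,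
              ← castVec_sub]
            exact Submodule.subset_span
              ⟨_, mem_halfSpaceGenerators_of_pos_neg hv.1 h hw.1 hw.2, rfl⟩
          -- A generator `v` with `g·v = 0` is kept as it stands; the combination is then just a
          -- positive multiple of `v`.
          · rw [castVec_dotProduct, castVec_dotProduct, ← h, Int.cast_zero, zero_smul, zero_sub,
              ← neg_smul]
            refine PointedCone.smul_mem _ ?_ (Submodule.subset_span
              ⟨_, mem_halfSpaceGenerators_of_nonneg hv.1 hv.2, rfl⟩)
            have := hw.2
            exact_mod_cast (neg_pos.mpr this).le
    have hneg : ∀ q ∈ PointedCone.hull ℝ Sn, q = 0 ∨ castVec g ⬝ᵥ q < 0 := by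
      intro q hq
      induction hq using Submodule.span_induction with
      | mem q hq =>
        obtain ⟨w, hw, rfl⟩ := hq
        right
        rw [castVec_dotProduct]
        exact_mod_cast hw.2
      | zero => exact Or.inl rfl
      | add x y _ _ hx hy =>
        rcases hx with rfl | hx
        · simpa using hy
        · rcases hy with rfl | hy
          · right; simpa using hx
          · right; rw [dotProduct_add]; exact add_neg hx hy
      | smul a x _ hx =>
        rcases hx with rfl | hx
        · simp
        · rcases a.2.lt_or_eq with ha | ha
          · right
            change castVec g ⬝ᵥ ((a : ℝ) • x) < 0
            rw [dotProduct_smul, smul_eq_mul]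
            exact mul_neg_of_pos_of_neg ha hx
          · left
            change (a : ℝ) • x = 0
            rw [← ha, zero_smul]
    rw [hS, PointedCone.hull, Submodule.span_union, Submodule.mem_sup] at hv
    obtain ⟨p, hp, q, hq, rfl⟩ := hv
    rw [dotProduct_add] at hg
    rcases (hSpg p hp).lt_or_eq with h | h
    · have e : p + q = (castVec g ⬝ᵥ p)⁻¹ • ((castVec g ⬝ᵥ p) • q - (castVec g ⬝ᵥ q) • p) +
          ((castVec g ⬝ᵥ p)⁻¹ * (castVec g ⬝ᵥ p + castVec g ⬝ᵥ q)) • p := by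
        rw [smul_sub, smul_smul, smul_smul, inv_mul_cancel₀ h.ne', mul_add,
          inv_mul_cancel₀ h.ne']
        module
      rw [e]
      exact add_mem (PointedCone.smul_mem _ (inv_nonneg.mpr h.le) (hbil p hp q hq))
        (PointedCone.smul_mem _ (mul_nonneg (inv_nonneg.mpr h.le) hg) (hpH hp))
    · rcases hneg q hq with rfl | hq'
      · rw [add_zero]; exact hpH hp
      · rw [← h, zero_add] at hg
        exact absurd hg (not_le.mpr hq')

/-- The inductive step of Farkas' lemma. The slope `c / N` must be at least `(m·w)/(g·w)` for every
generator `w` with `g·w < 0`, and at most this ratio for every generator where `g` is positive. The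
maximum over the negative side works, since the mixed generators express exactly that each lower
bound is below each upper bound. -/
theorem exists_smul_sub_nonneg_of_halfSpaceGenerators {n : ℕ} (s : Finset (Fin n → ℤ))
    (g m : Fin n → ℤ) (h : ∀ v ∈ halfSpaceGenerators s g, 0 ≤ m ⬝ᵥ v) :
    ∃ N c : ℕ, 0 < N ∧ ∀ v ∈ s, 0 ≤ ((N : ℤ) • m - (c : ℤ) • g) ⬝ᵥ v := by
  by_cases hw : ∀ w ∈ s.filter (fun v => g ⬝ᵥ v < 0), 0 ≤ m ⬝ᵥ w
  · refine ⟨1, 0, one_pos, fun v hv => ?_⟩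
    simp only [Nat.cast_one, one_smul, Nat.cast_zero, zero_smul, sub_zero]
    rcases le_or_gt 0 (g ⬝ᵥ v) with hg | hg
    · exact h v (mem_halfSpaceGenerators_of_nonneg hv hg)
    · exact hw v (Finset.mem_filter.mpr ⟨hv, hg⟩)
  · push Not at hw
    obtain ⟨w1, hw1, hm1⟩ := hw
    obtain ⟨w, hw, hmax⟩ := Finset.exists_max_image (s.filter (fun v => g ⬝ᵥ v < 0))
      (fun w => ((m ⬝ᵥ w : ℤ) : ℚ) / ((g ⬝ᵥ w : ℤ) : ℚ)) ⟨w1, hw1⟩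
    rw [Finset.mem_filter] at hw hw1
    have cross : ∀ u ∈ s, g ⬝ᵥ u < 0 → (m ⬝ᵥ u) * (g ⬝ᵥ w) ≤ (m ⬝ᵥ w) * (g ⬝ᵥ u) := by
      intro u hu hgu
      have := hmax u (Finset.mem_filter.mpr ⟨hu, hgu⟩)
      have h1 : ((g ⬝ᵥ u : ℤ) : ℚ) < 0 := by exact_mod_cast hgu
      have h2 : ((g ⬝ᵥ w : ℤ) : ℚ) < 0 := by exact_mod_cast hw.2
      rw [← neg_div_neg_eq, ← neg_div_neg_eq ((m ⬝ᵥ w : ℤ) : ℚ),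
        div_le_div_iff₀ (neg_pos.mpr h1) (neg_pos.mpr h2)] at this
      simp only [neg_mul_neg] at this
      exact_mod_cast this
    have hmw : m ⬝ᵥ w ≤ 0 := by
      have := cross w1 hw1.1 hw1.2
      by_contra hc
      push Not at hc
      nlinarith [mul_pos_of_neg_of_neg hm1 hw.2, mul_neg_of_pos_of_neg hc hw1.2]
    -- Numerator and denominator of the maximal ratio, with signs changed; both are non-negative, so
    -- `toNat` loses nothing.
    refine ⟨(-(g ⬝ᵥ w)).toNat, (-(m ⬝ᵥ w)).toNat, by have := hw.2; omega, fun u hu => ?_⟩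
    rw [Int.toNat_of_nonneg (by have := hw.2; omega), Int.toNat_of_nonneg (by omega),
      sub_dotProduct, smul_dotProduct, smul_dotProduct, smul_eq_mul, smul_eq_mul]
    rcases lt_trichotomy 0 (g ⬝ᵥ u) with hg | hg | hg
    · have := h _ (mem_halfSpaceGenerators_of_pos_neg hu hg hw.1 hw.2)
      rw [dotProduct_sub, dotProduct_smul, dotProduct_smul, smul_eq_mul, smul_eq_mul] at this
      linarith [mul_comm (g ⬝ᵥ u) (m ⬝ᵥ w)]
    · have := h _ (mem_halfSpaceGenerators_of_nonneg hu hg.le)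
      rw [← hg, mul_zero, sub_zero]
      exact mul_nonneg (by have := hw.2; omega) this
    · have := cross u hu hg
      linarith [mul_comm (m ⬝ᵥ u) (g ⬝ᵥ w)]

theorem mem_hull_castVec_basis {n : ℕ} (s : Finset (Fin n → ℤ))
    (hs : ∀ i, Pi.single i 1 ∈ s ∧ Pi.single i (-1) ∈ s) (v : Fin n → ℝ) :
    v ∈ PointedCone.hull ℝ (castVec '' (s : Set (Fin n → ℤ))) := by
  have hv : v = ∑ i, v i • castVec (Pi.single i 1) := by
    ext j
    simp [Finset.sum_apply, castVec, Pi.single_apply, apply_ite]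
  rw [hv]
  refine sum_mem fun i _ => ?_
  rcases le_total 0 (v i) with h | h
  · exact PointedCone.smul_mem _ h (Submodule.subset_span ⟨_, (hs i).1, rfl⟩)
  · have : v i • castVec (Pi.single i 1) = (-v i) • castVec (Pi.single i (-1)) := by
      rw [Pi.single_neg, castVec_neg, smul_neg, neg_smul, neg_neg]
    rw [this]
    exact PointedCone.smul_mem _ (neg_nonneg.mpr h) (Submodule.subset_span ⟨_, (hs i).2, rfl⟩)

/-- Integral versions of the Minkowski–Weyl theorem and of Farkas' lemma: the cone
`{v | ∀ g ∈ G, 0 ≤ g · v}` is generated by finitely many integral vectors, and every integral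
functional that is nonnegative on these generators has a positive multiple in the monoid generated
by `G`. -/
theorem exists_dual_generators {n : ℕ} (G : Finset (Fin n → ℤ)) : ∃ s : Finset (Fin n → ℤ),
    (∀ v : Fin n → ℝ, v ∈ PointedCone.hull ℝ (castVec '' (s : Set (Fin n → ℤ))) ↔
      ∀ g ∈ G, 0 ≤ castVec g ⬝ᵥ v) ∧
    ∀ m : Fin n → ℤ, (∀ v ∈ s, 0 ≤ m ⬝ᵥ v) →
      ∃ N : ℕ, 0 < N ∧ N • m ∈ AddSubmonoid.closure (G : Set (Fin n → ℤ)) := by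
  classical
  induction G using Finset.induction_on with
  | empty =>
    -- With no inequalities the cone is the whole space, generated by the vectors `± e_i`; only the
    -- zero functional is non-negative on them.
    let s : Finset (Fin n → ℤ) := Finset.univ.image (fun i => Pi.single i 1) ∪
      Finset.univ.image (fun i => Pi.single i (-1))
    have hs : ∀ i, (Pi.single i 1 : Fin n → ℤ) ∈ s ∧ (Pi.single i (-1) : Fin n → ℤ) ∈ s :=
      fun i => ⟨Finset.mem_union_left _ (Finset.mem_image_of_mem _ (Finset.mem_univ i)),
        Finset.mem_union_right _ (Finset.mem_image_of_mem _ (Finset.mem_univ i))⟩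
    refine ⟨s, fun v => ?_, fun m hm => ⟨1, one_pos, ?_⟩⟩
    · simp only [Finset.notMem_empty, false_imp_iff, implies_true, iff_true]
      exact mem_hull_castVec_basis s hs v
    · have : m = 0 := by
        ext i
        have h1 := hm _ (hs i).1
        have h2 := hm _ (hs i).2
        rw [dotProduct_single] at h1 h2
        simp only [Pi.zero_apply]
        omega
      simp [this]
  | insert g G _ ih =>
    obtain ⟨s, hs1, hs2⟩ := ih
    refine ⟨halfSpaceGenerators s g, fun v => ?_, fun m hm => ?_⟩
    · rw [hull_halfSpaceGenerators, hs1, Finset.forall_mem_insert, and_comm]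
    · obtain ⟨N, c, hN, h⟩ := exists_smul_sub_nonneg_of_halfSpaceGenerators s g m hm
      obtain ⟨N', hN', h'⟩ := hs2 _ h
      refine ⟨N' * N, mul_pos hN' hN, ?_⟩
      have e : (N' * N) • m = N' • ((N : ℤ) • m - (c : ℤ) • g) + (N' * c) • g := by
        rw [mul_smul, mul_smul, natCast_zsmul, natCast_zsmul, smul_sub]
        abel
      rw [e]
      refine add_mem (AddSubmonoid.closure_mono (by simp) h') (AddSubmonoid.nsmul_mem _
        (AddSubmonoid.subset_closure (by simp)) _)

/-! ### Duality between finitely generated monoids and rational cones. -/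

/-- The cone dual to a monoid of integral functionals. -/
def dualCone {n : ℕ} (Q : AddSubmonoid (Fin n → ℤ)) : PointedCone ℝ (Fin n → ℝ) where
  carrier := {v | ∀ q ∈ Q, 0 ≤ castVec q ⬝ᵥ v}
  zero_mem' := fun q _ => by simp
  add_mem' := fun ha hb q hq => by
    rw [dotProduct_add]; exact add_nonneg (ha q hq) (hb q hq)
  smul_mem' := fun c v hv q hq => by
    change 0 ≤ castVec q ⬝ᵥ ((c : ℝ) • v)
    rw [dotProduct_smul]; exact mul_nonneg c.2 (hv q hq)

theorem mem_dualCone_closure {n : ℕ} {G : Set (Fin n → ℤ)} {v : Fin n → ℝ} :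
    v ∈ dualCone (AddSubmonoid.closure G) ↔ ∀ g ∈ G, 0 ≤ castVec g ⬝ᵥ v := by
  refine ⟨fun h g hg => h g (AddSubmonoid.subset_closure hg), fun h q hq => ?_⟩
  induction hq using AddSubmonoid.closure_induction with
  | mem x hx => exact h x hx
  | zero => simp [castVec_zero]
  | add x y _ _ hx hy => rw [castVec_add, add_dotProduct]; exact add_nonneg hx hy

theorem dualCone_sup {n : ℕ} (P Q : AddSubmonoid (Fin n → ℤ)) :
    dualCone (P ⊔ Q) = dualCone P ⊓ dualCone Q := by
  ext v
  rw [Submodule.mem_inf]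
  constructor
  · intro h
    exact ⟨fun q hq => h q (AddSubmonoid.mem_sup_left hq),
      fun q hq => h q (AddSubmonoid.mem_sup_right hq)⟩
  · rintro ⟨h1, h2⟩ q hq
    obtain ⟨x, hx, y, hy, rfl⟩ := AddSubmonoid.mem_sup.mp hq
    rw [castVec_add, add_dotProduct]
    exact add_nonneg (h1 x hx) (h2 y hy)

theorem mem_dualCone_sup_neg {n : ℕ} {Q : AddSubmonoid (Fin n → ℤ)} {a : Fin n → ℤ} (ha : a ∈ Q)
    {v : Fin n → ℝ} :
    v ∈ dualCone (Q ⊔ AddSubmonoid.closure {-a}) ↔ v ∈ dualCone Q ∧ castVec a ⬝ᵥ v = 0 := by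
  rw [dualCone_sup, Submodule.mem_inf, mem_dualCone_closure]
  refine and_congr_right fun h => ?_
  simp only [Set.mem_singleton_iff, forall_eq]
  rw [castVec_neg, neg_dotProduct, neg_nonneg]
  exact ⟨fun h' => le_antisymm h' (h a ha), fun h' => h'.le⟩

/-- Inverting `a` cuts out the locus `a = 0`, and `a` is non-negative on the cone. -/
theorem dualCone_sup_neg_isFaceOf {n : ℕ} {Q : AddSubmonoid (Fin n → ℤ)} {a : Fin n → ℤ}
    (ha : a ∈ Q) : (dualCone (Q ⊔ AddSubmonoid.closure {-a})).IsFaceOf (dualCone Q) := by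
  refine PointedCone.IsFaceOf.of_mem_of_add_mem_left
    (fun v hv => ((mem_dualCone_sup_neg ha).mp hv).1) fun {x y} hx hy hxy => ?_
  rw [mem_dualCone_sup_neg ha] at hxy ⊢
  refine ⟨hx, ?_⟩
  have h := hxy.2
  rw [dotProduct_add] at h
  linarith [hx a ha, hy a ha]

/-- Every face is exposed. Choose `v` in the face at which as few generators of `Q` as possible
vanish, a relative interior point, and let `a` be the sum of those vanishing at `v`. All of these
vanish on the whole face, by minimality applied to `v + x`. Conversely, if `a` kills `x`, then `N v
- x` lies in the cone for large `N`, and the face property puts `x` in the face. -/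
theorem exists_eq_dualCone_of_isFaceOf {n : ℕ} {Q : AddSubmonoid (Fin n → ℤ)} (hQ : Q.FG)
    {τ : PointedCone ℝ (Fin n → ℝ)} (hτ : τ.IsFaceOf (dualCone Q)) :
    ∃ a ∈ Q, τ = dualCone (Q ⊔ AddSubmonoid.closure {-a}) := by
  obtain ⟨G, rfl⟩ := hQ
  let I (v : Fin n → ℝ) : Finset (Fin n → ℤ) := G.filter fun g => castVec g ⬝ᵥ v = 0
  obtain ⟨v, hv, hmin⟩ := WellFounded.has_min (measure fun v => (I v).card).wf (τ : Set (Fin n → ℝ))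
    ⟨0, τ.zero_mem⟩
  have hnn : ∀ x ∈ τ, ∀ g ∈ G, 0 ≤ castVec g ⬝ᵥ x := fun x hx g hg =>
    hτ.le hx g (AddSubmonoid.subset_closure hg)
  have ha : ∑ g ∈ I v, g ∈ AddSubmonoid.closure (G : Set (Fin n → ℤ)) :=
    sum_mem fun g hg => AddSubmonoid.subset_closure (Finset.mem_filter.mp hg).1
  have hsum : ∀ x, castVec (∑ g ∈ I v, g) ⬝ᵥ x = ∑ g ∈ I v, castVec g ⬝ᵥ x := by
    intro x
    have : castVec (∑ g ∈ I v, g) = ∑ g ∈ I v, castVec g := by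
      ext i; simp [castVec, Finset.sum_apply]
    rw [this, sum_dotProduct]
  refine ⟨_, ha, ?_⟩
  ext x
  rw [mem_dualCone_sup_neg ha, hsum]
  constructor
  · intro hx
    refine ⟨hτ.le hx, Finset.sum_eq_zero fun g hg => ?_⟩
    have hsub : I (v + x) ⊆ I v := by
      intro g hg
      rw [Finset.mem_filter] at hg ⊢
      refine ⟨hg.1, ?_⟩
      have := hg.2
      rw [dotProduct_add] at this
      linarith [hnn v hv g hg.1, hnn x hx g hg.1]
    have heq : I (v + x) = I v := by
      refine Finset.eq_of_subset_of_card_le hsub ?_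
      have := hmin (v + x) (τ.add_mem hv hx)
      exact not_lt.mp this
    have hg' := hg
    rw [← heq] at hg'
    rw [Finset.mem_filter] at hg hg'
    have := hg'.2
    rw [dotProduct_add] at this
    linarith [hg.2]
  · rintro ⟨hx, hx0⟩
    have hx' : ∀ g ∈ G, 0 ≤ castVec g ⬝ᵥ x := fun g hg => hx g (AddSubmonoid.subset_closure hg)
    have hx0' := (Finset.sum_eq_zero_iff_of_nonneg
      fun g hg => hx' g (Finset.mem_filter.mp hg).1).mp hx0
    have hev : ∀ᶠ N : ℕ in Filter.atTop, ∀ g ∈ G, castVec g ⬝ᵥ x ≤ N * (castVec g ⬝ᵥ v) := by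
      rw [Filter.eventually_all_finset]
      intro g hg
      by_cases h : castVec g ⬝ᵥ v = 0
      · rw [hx0' g (Finset.mem_filter.mpr ⟨hg, h⟩), h]; simp
      · have hpos : 0 < castVec g ⬝ᵥ v := lt_of_le_of_ne (hnn v hv g hg) (Ne.symm h)
        exact (tendsto_natCast_atTop_atTop.atTop_mul_const hpos).eventually_ge_atTop _
    obtain ⟨N, hN⟩ := hev.exists
    refine hτ.mem_of_add_mem_left (y := (N : ℝ) • v - x) hx ?_ ?_
    · rw [mem_dualCone_closure]
      intro g hg
      rw [dotProduct_sub, dotProduct_smul, smul_eq_mul]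
      linarith [hN g hg]
    · rw [add_sub_cancel]
      exact PointedCone.smul_mem _ (Nat.cast_nonneg N) hv

/-- All functionals in `Q` vanish at `v`, hence so do the coordinate functionals, which are integral
combinations of them. -/
theorem eq_zero_of_mem_dualCone_of_neg_mem {n : ℕ} {Q : AddSubmonoid (Fin n → ℤ)}
    (hQ : AddSubgroup.closure (Q : Set (Fin n → ℤ)) = ⊤) {v : Fin n → ℝ} (h : v ∈ dualCone Q)
    (h' : -v ∈ dualCone Q) : v = 0 := by
  have key : ∀ m ∈ AddSubgroup.closure (Q : Set (Fin n → ℤ)), castVec m ⬝ᵥ v = 0 := by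
    intro m hm
    induction hm using AddSubgroup.closure_induction with
    | mem x hx =>
      have h1 := h x hx
      have h2 := h' x hx
      rw [dotProduct_neg] at h2
      linarith
    | zero => simp [castVec_zero]
    | add x y _ _ hx hy => rw [castVec_add, add_dotProduct, hx, hy, add_zero]
    | neg x _ hx => rw [castVec_neg, neg_dotProduct, hx, neg_zero]
  ext i
  have := key (Pi.single i 1) (by rw [hQ]; trivial)
  have e : castVec (Pi.single i 1 : Fin n → ℤ) = Pi.single i 1 := by
    ext j; simp [castVec, Pi.single_apply, apply_ite]
  rwa [e, single_dotProduct, one_mul] at this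

theorem exists_dualCone_eq_hull {n : ℕ} {Q : AddSubmonoid (Fin n → ℤ)} (hQ : Q.FG) :
    ∃ s : Finset (Fin n → ℤ),
      dualCone Q = PointedCone.hull ℝ (castVec '' (s : Set (Fin n → ℤ))) ∧
      ∀ m : Fin n → ℤ, (∀ v ∈ s, 0 ≤ m ⬝ᵥ v) → ∃ N : ℕ, 0 < N ∧ N • m ∈ Q := by
  obtain ⟨G, rfl⟩ := hQ
  obtain ⟨s, hs, hs'⟩ := exists_dual_generators G
  refine ⟨s, ?_, hs'⟩
  ext v
  rw [hs, mem_dualCone_closure]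
  rfl

/-- Farkas' lemma: the double dual of a finitely generated monoid is its saturation. This is what
turns integral closures into dual monoids of cones. -/
theorem mem_dualMonoid_dualCone {n : ℕ} {Q : AddSubmonoid (Fin n → ℤ)} (hQ : Q.FG)
    {m : Fin n → ℤ} : m ∈ dualMonoid (dualCone Q) ↔ ∃ N : ℕ, 0 < N ∧ N • m ∈ Q := by
  constructor
  · intro hm
    obtain ⟨s, hs, hs'⟩ := exists_dualCone_eq_hull hQ
    rw [hs, mem_dualMonoid_hull] at hm
    exact hs' m hm
  · rintro ⟨N, hN, h⟩ v hv
    have := hv _ h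
    rw [castVec_nsmul, smul_dotProduct, smul_eq_mul] at this
    exact nonneg_of_mul_nonneg_right this (by exact_mod_cast hN)

theorem le_dualMonoid_dualCone {n : ℕ} (Q : AddSubmonoid (Fin n → ℤ)) :
    Q ≤ dualMonoid (dualCone Q) := fun q hq _ hv => hv q hq

/-- The fan of the cones dual to a family of monoids. -/
def fanOfMonoids {n : ℕ} (𝒬 : Set (AddSubmonoid (Fin n → ℤ))) (hfin : 𝒬.Finite)
    (hne : 𝒬.Nonempty) (hfg : ∀ Q ∈ 𝒬, Q.FG)
    (hgen : ∀ Q ∈ 𝒬, AddSubgroup.closure (Q : Set (Fin n → ℤ)) = ⊤)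
    (hface : ∀ Q ∈ 𝒬, ∀ a ∈ Q, Q ⊔ AddSubmonoid.closure {-a} ∈ 𝒬)
    (hsep : ∀ Q ∈ 𝒬, ∀ Q' ∈ 𝒬, ∃ a ∈ Q, Q ⊔ Q' = Q ⊔ AddSubmonoid.closure {-a}) : Fan n where
  cones := dualCone '' 𝒬
  finite := hfin.image _
  nonempty := hne.image _
  rational := by
    rintro _ ⟨Q, hQ, rfl⟩
    obtain ⟨s, hs, -⟩ := exists_dualCone_eq_hull (hfg Q hQ)
    exact ⟨s, hs⟩
  stronglyConvex := by
    rintro _ ⟨Q, hQ, rfl⟩ v hv hv'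
    exact eq_zero_of_mem_dualCone_of_neg_mem (hgen Q hQ) hv hv'
  face_mem := by
    rintro _ ⟨Q, hQ, rfl⟩ τ hτ
    obtain ⟨a, ha, rfl⟩ := exists_eq_dualCone_of_isFaceOf (hfg Q hQ) hτ
    exact ⟨_, hface Q hQ a ha, rfl⟩
  inf_isFaceOf := by
    rintro _ ⟨Q, hQ, rfl⟩ _ ⟨Q', hQ', rfl⟩
    obtain ⟨a, ha, h⟩ := hsep Q hQ Q' hQ'
    rw [← dualCone_sup, h]
    exact dualCone_sup_neg_isFaceOf ha

/-! ### Lattice points of cones of a fan -/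

/-- A functional that is non-negative on the face where `a` vanishes becomes non-negative on the
whole cone after adding a large multiple of `a`. Thus passing to the face localizes the dual monoid
at `a`. -/
theorem dualMonoid_eq_sup_neg {n : ℕ} {s : Finset (Fin n → ℤ)} {σ : PointedCone ℝ (Fin n → ℝ)}
    {a : Fin n → ℤ}
    (ha : a ∈ dualMonoid (PointedCone.hull ℝ (castVec '' (s : Set (Fin n → ℤ)))))
    (hσ : σ ≤ PointedCone.hull ℝ (castVec '' (s : Set (Fin n → ℤ))))
    (h0 : ∀ v ∈ σ, castVec a ⬝ᵥ v = 0) (h : ∀ v ∈ s, a ⬝ᵥ v = 0 → castVec v ∈ σ) :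
    dualMonoid σ = dualMonoid (PointedCone.hull ℝ (castVec '' (s : Set (Fin n → ℤ)))) ⊔
      AddSubmonoid.closure {-a} := by
  apply le_antisymm
  · intro m hm
    -- This `N` bounds `|m·v|` for all generators at once, and it suffices because a positive
    -- integer `a·v` is at least 1.
    obtain ⟨N, hN⟩ : ∃ N : ℕ, N = ∑ v ∈ s, (m ⬝ᵥ v).natAbs := ⟨_, rfl⟩
    have e : m + N • a + N • (-a) = m := by simp
    refine AddSubmonoid.mem_sup.mpr ⟨m + N • a, ?_, N • (-a),
      AddSubmonoid.nsmul_mem _ (AddSubmonoid.subset_closure (Set.mem_singleton _)) N, e⟩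
    rw [mem_dualMonoid_hull]
    intro v hv
    rw [add_dotProduct, smul_dotProduct, nsmul_eq_mul]
    have hav : 0 ≤ a ⬝ᵥ v := mem_dualMonoid_hull.mp ha v hv
    rcases hav.lt_or_eq with h1 | h1
    · have hN : (m ⬝ᵥ v).natAbs ≤ N := hN ▸
        Finset.single_le_sum (f := fun v => (m ⬝ᵥ v).natAbs) (fun _ _ => Nat.zero_le _) hv
      have h2 : (N : ℤ) ≤ N * (a ⬝ᵥ v) := le_mul_of_one_le_right (by positivity) h1
      omega
    · rw [← h1, mul_zero, add_zero]
      have := mem_dualMonoid.mp hm _ (h v hv h1.symm)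
      rw [castVec_dotProduct] at this
      exact_mod_cast this
  · refine sup_le (dualMonoid_anti hσ) ((AddSubmonoid.closure_le).mpr ?_)
    rintro _ rfl
    rw [SetLike.mem_coe, mem_dualMonoid]
    intro v hv
    rw [castVec_neg, neg_dotProduct, h0 v hv, neg_zero]

theorem Fan.exists_eq_hull {n : ℕ} (Δ : Fan n) {σ : PointedCone ℝ (Fin n → ℝ)} (hσ : σ ∈ Δ.cones) :
    ∃ s : Finset (Fin n → ℤ), σ = PointedCone.hull ℝ (castVec '' (s : Set (Fin n → ℤ))) :=
  Δ.rational σ hσ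

theorem Fan.fg_dualMonoid {n : ℕ} (Δ : Fan n) {σ : PointedCone ℝ (Fin n → ℝ)}
    (hσ : σ ∈ Δ.cones) : (dualMonoid σ).FG := by
  obtain ⟨s, rfl⟩ := Δ.exists_eq_hull hσ
  exact fg_dualMonoid_hull s

theorem Fan.exists_face {n : ℕ} (Δ : Fan n) {σ : PointedCone ℝ (Fin n → ℝ)} (hσ : σ ∈ Δ.cones)
    {a : Fin n → ℤ} (ha : a ∈ dualMonoid σ) :
    ∃ τ ∈ Δ.cones, τ ≤ σ ∧ dualMonoid τ = dualMonoid σ ⊔ AddSubmonoid.closure {-a} := by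
  obtain ⟨s, rfl⟩ := Δ.exists_eq_hull hσ
  set σ := PointedCone.hull ℝ (castVec '' (s : Set (Fin n → ℤ))) with hσ'
  let τ : PointedCone ℝ (Fin n → ℝ) :=
    { carrier := {v | v ∈ σ ∧ castVec a ⬝ᵥ v = 0}
      zero_mem' := ⟨zero_mem _, dotProduct_zero _⟩
      add_mem' := fun hx hy => ⟨add_mem hx.1 hy.1, by rw [dotProduct_add, hx.2, hy.2, add_zero]⟩
      smul_mem' := fun c x hx => ⟨Submodule.smul_mem _ c hx.1, by
        change castVec a ⬝ᵥ ((c : ℝ) • x) = 0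
        rw [dotProduct_smul, hx.2, smul_zero]⟩ }
  have hτσ : τ ≤ σ := fun v hv => hv.1
  refine ⟨τ, Δ.face_mem σ hσ τ (PointedCone.IsFaceOf.of_mem_of_add_mem_left hτσ ?_), hτσ,
    dualMonoid_eq_sup_neg ha hτσ (fun v hv => hv.2) fun v hv hav => ⟨Submodule.subset_span
      ⟨v, hv, rfl⟩, by rw [castVec_dotProduct, hav, Int.cast_zero]⟩⟩
  intro x y hx hy hxy
  refine ⟨hx, ?_⟩
  have h := hxy.2
  rw [dotProduct_add] at h
  linarith [mem_dualMonoid.mp ha x hx, mem_dualMonoid.mp ha y hy]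

theorem mem_hull_of_mem_closure {n : ℕ} {s : Set (Fin n → ℤ)} {v : Fin n → ℤ}
    (hv : v ∈ AddSubmonoid.closure s) : castVec v ∈ PointedCone.hull ℝ (castVec '' s) := by
  induction hv using AddSubmonoid.closure_induction with
  | mem x hx => exact Submodule.subset_span ⟨x, hx, rfl⟩
  | zero => rw [castVec_zero]; exact zero_mem _
  | add x y _ _ hx hy => rw [castVec_add]; exact add_mem hx hy

/-- The separation lemma. -/
theorem Fan.exists_separating {n : ℕ} (Δ : Fan n) {σ τ : PointedCone ℝ (Fin n → ℝ)}
    (hσ : σ ∈ Δ.cones) (hτ : τ ∈ Δ.cones) :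
    ∃ a ∈ dualMonoid σ, -a ∈ dualMonoid τ ∧
      dualMonoid (σ ⊓ τ) = dualMonoid σ ⊔ AddSubmonoid.closure {-a} := by
  classical
  obtain ⟨s, hs⟩ := Δ.exists_eq_hull hσ
  obtain ⟨t, ht⟩ := Δ.exists_eq_hull hτ
  -- The roles of functionals and vectors are exchanged here: `u` generates the cone of functionals
  -- that are `≥ 0` on `σ` and `≤ 0` on `τ`.
  obtain ⟨u, hu, hu'⟩ := exists_dual_generators (s ∪ t.image (fun v => -v))
  have hu1 : ∀ m ∈ u, ∀ v ∈ s, 0 ≤ m ⬝ᵥ v := by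
    intro m hm v hv
    have := (hu _).mp (Submodule.subset_span ⟨m, hm, rfl⟩) v (Finset.mem_union_left _ hv)
    rw [castVec_dotProduct, dotProduct_comm] at this
    exact_mod_cast this
  have hu2 : ∀ m ∈ u, ∀ v ∈ t, m ⬝ᵥ v ≤ 0 := by
    intro m hm v hv
    have := (hu _).mp (Submodule.subset_span ⟨m, hm, rfl⟩) (-v)
      (Finset.mem_union_right _ (Finset.mem_image_of_mem _ hv))
    rw [castVec_dotProduct, dotProduct_comm, dotProduct_neg] at this
    have : 0 ≤ -(m ⬝ᵥ v) := by exact_mod_cast this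
    omega
  -- The sum of the generators is a relative interior point: it vanishes at a generator of `σ` only
  -- if every `m ∈ u` does.
  let a := ∑ m ∈ u, m
  have haσ : a ∈ dualMonoid σ := by
    rw [hs, mem_dualMonoid_hull]
    intro v hv
    rw [sum_dotProduct]
    exact Finset.sum_nonneg fun m hm => hu1 m hm v hv
  have haτ : -a ∈ dualMonoid τ := by
    rw [ht, mem_dualMonoid_hull]
    intro v hv
    rw [neg_dotProduct, sum_dotProduct, neg_nonneg]
    exact Finset.sum_nonpos fun m hm => hu2 m hm v hv
  refine ⟨a, haσ, haτ, ?_⟩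
  have key := dualMonoid_eq_sup_neg (s := s) (σ := σ ⊓ τ) (a := a) (hs ▸ haσ) (hs ▸ inf_le_left)
    ?_ ?_
  · rwa [← hs] at key
  · intro v hv
    have h1 := mem_dualMonoid.mp haσ v hv.1
    have h2 := mem_dualMonoid.mp haτ v hv.2
    rw [castVec_neg, neg_dotProduct] at h2
    linarith
  · intro v hv hav
    have hvσ : castVec v ∈ σ := by rw [hs]; exact Submodule.subset_span ⟨v, hv, rfl⟩
    have hz : ∀ m ∈ u, m ⬝ᵥ v = 0 := by
      rw [sum_dotProduct] at hav
      exact (Finset.sum_eq_zero_iff_of_nonneg fun m hm => hu1 m hm v hv).mp hav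
    -- All of `u` kills `v`, so Farkas applied to `-v` gives `N v + p = -q` with `p ∈ σ` and `-q ∈
    -- τ`. This vector lies in `σ ⊓ τ`, which is a face of `σ`, so `v` lies there too.
    obtain ⟨N, hN, hmem⟩ := hu' (-v) fun m hm => by
      rw [neg_dotProduct, dotProduct_comm, hz m hm, neg_zero]
    rw [Finset.coe_union, AddSubmonoid.closure_union, AddSubmonoid.mem_sup] at hmem
    obtain ⟨p, hp, q, hq, hpq⟩ := hmem
    have hpσ : castVec p ∈ σ := by rw [hs]; exact mem_hull_of_mem_closure hp
    have hqτ : castVec (-q) ∈ τ := by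
      rw [ht]
      apply mem_hull_of_mem_closure
      have : ∀ x ∈ AddSubmonoid.closure ((t.image fun v => -v : Finset _) : Set (Fin n → ℤ)),
          -x ∈ AddSubmonoid.closure (t : Set (Fin n → ℤ)) := by
        intro x hx
        induction hx using AddSubmonoid.closure_induction with
        | mem x hx =>
          obtain ⟨y, hy, rfl⟩ := Finset.mem_image.mp hx
          rw [neg_neg]
          exact AddSubmonoid.subset_closure hy
        | zero => rw [neg_zero]; exact zero_mem _
        | add x y _ _ hx hy => rw [neg_add]; exact add_mem hx hy
      exact this q hq
    have e : -q = N • v + p := by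
      have : q = -(N • v) - p := by rw [← smul_neg, ← hpq]; abel
      rw [this]; abel
    have e' : (N : ℝ) • castVec v + castVec p = castVec (-q) := by
      rw [e, castVec_add, castVec_nsmul]
    refine (Δ.inf_isFaceOf σ hσ τ hτ).mem_of_smul_add_mem (y := castVec p) (a := (N : ℝ)) hvσ hpσ
      (by exact_mod_cast hN) ⟨?_, ?_⟩
    · exact add_mem (PointedCone.smul_mem _ (Nat.cast_nonneg N) hvσ) hpσ
    · rw [e']; exact hqτ

/-! ### Monoid algebras -/

section MonoidAlgebra

open AddMonoidAlgebra (single mapDomainRingHom)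

theorem mapDomainRingHom_injective {K P G : Type*} [Semiring K] [AddMonoid P]
    [AddMonoid G] {ι : P →+ G} (hι : Function.Injective ι) :
    Function.Injective (mapDomainRingHom K ι) :=
  AddMonoidAlgebra.mapDomain_injective hι

theorem mapDomainRingHom_single {K P G : Type*} [Semiring K] [AddMonoid P]
    [AddMonoid G] (ι : P →+ G) (p : P) (c : K) :
    mapDomainRingHom K ι (single p c) = single (ι p) c :=
  AddMonoidAlgebra.mapDomain_single

theorem mem_range_mapDomainRingHom {K P G : Type*} [Semiring K] [AddMonoid P]
    [AddMonoid G] {ι : P →+ G} {f : AddMonoidAlgebra K G}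
    (h : ∀ g ∈ f.coeff.support, g ∈ Set.range ι) : f ∈ (mapDomainRingHom K ι).rangeS := by
  rw [← AddMonoidAlgebra.sum_coeff_single f]
  refine sum_mem fun g hg => ?_
  obtain ⟨p, rfl⟩ := h g hg
  exact ⟨single p _, mapDomainRingHom_single ι p _⟩

/-- Denominators are monomials, so it suffices to clear them one monomial at a time. -/
theorem isLocalization_mapDomainRingHom {K P G : Type*} [CommRing K] [AddCommMonoid P]
    [AddCommMonoid G] {ι : P →+ G} (hι : Function.Injective ι)
    (N : Submonoid (AddMonoidAlgebra K P))
    (hN : ∀ x ∈ N, ∃ p, x = single p 1 ∧ IsAddUnit (ι p))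
    (hden : ∀ g, ∃ p q, single p 1 ∈ N ∧ g + ι p = ι q) :
    letI := (mapDomainRingHom K ι).toAlgebra
    IsLocalization N (AddMonoidAlgebra K G) := by
  let := (mapDomainRingHom K ι).toAlgebra
  rw [isLocalization_iff]
  refine ⟨?_, ?_, ?_⟩
  · rintro ⟨x, hx⟩
    obtain ⟨p, rfl, hp⟩ := hN x hx
    obtain ⟨q, hq⟩ := isAddUnit_iff_exists_neg.mp hp
    refine IsUnit.of_mul_eq_one (single q 1) ?_
    change mapDomainRingHom K ι (single p 1) * _ = 1
    rw [mapDomainRingHom_single, AddMonoidAlgebra.single_mul_single, hq, mul_one]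
    rfl
  · intro z
    induction z using AddMonoidAlgebra.induction_linear with
    | zero => exact ⟨(0, 1), by simp⟩
    | add z₁ z₂ h₁ h₂ =>
      obtain ⟨⟨x₁, y₁⟩, h₁⟩ := h₁
      obtain ⟨⟨x₂, y₂⟩, h₂⟩ := h₂
      refine ⟨(x₁ * y₂ + x₂ * y₁, y₁ * y₂), ?_⟩
      simp only [Submonoid.coe_mul, map_mul, map_add] at h₁ h₂ ⊢
      rw [← h₁, ← h₂]
      ring
    | single m c =>
      obtain ⟨p, q, hp, hq⟩ := hden m
      refine ⟨(single q c, ⟨_, hp⟩), ?_⟩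
      change _ * mapDomainRingHom K ι (single p 1) = mapDomainRingHom K ι (single q c)
      rw [mapDomainRingHom_single, mapDomainRingHom_single, AddMonoidAlgebra.single_mul_single, hq,
        mul_one]
  · intro x y h
    exact ⟨1, by rw [mapDomainRingHom_injective hι h]⟩

/-- The Laurent polynomial ring is the localization at the monomials of a polynomial ring, which is
factorial. -/
theorem isIntegrallyClosed_addMonoidAlgebra (K : Type*) [Field K] (n : ℕ) :
    IsIntegrallyClosed (AddMonoidAlgebra K (Fin n → ℤ)) := by
  let ι : (Fin n →₀ ℕ) →+ (Fin n → ℤ) :=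
    { toFun := fun p i => (p i : ℤ)
      map_zero' := by ext; simp
      map_add' := fun x y => by ext; simp }
  have hι : Function.Injective ι := by
    intro p q h
    ext i
    have : (p i : ℤ) = q i := congrFun h i
    exact_mod_cast this
  let N : Submonoid (AddMonoidAlgebra K (Fin n →₀ ℕ)) :=
    MonoidHom.mrange (AddMonoidAlgebra.of K (Fin n →₀ ℕ))
  let := (mapDomainRingHom K ι).toAlgebra
  have hloc : IsLocalization N (AddMonoidAlgebra K (Fin n → ℤ)) := by
    refine isLocalization_mapDomainRingHom hι N ?_ ?_
    · rintro _ ⟨p, rfl⟩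
      exact ⟨p.toAdd, rfl, isAddUnit_iff_exists_neg.mpr ⟨-ι p.toAdd, add_neg_cancel _⟩⟩
    · intro g
      refine ⟨Finsupp.equivFunOnFinite.symm fun i => (-g i).toNat,
        Finsupp.equivFunOnFinite.symm fun i => (g i).toNat, ⟨.ofAdd _, rfl⟩, ?_⟩
      ext i
      change g i + ((-g i).toNat : ℤ) = ((g i).toNat : ℤ)
      omega
  have : IsIntegrallyClosed (AddMonoidAlgebra K (Fin n →₀ ℕ)) :=
    UniqueFactorizationMonoid.instIsIntegrallyClosed (A := MvPolynomial (Fin n) K)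
  have : IsDomain (AddMonoidAlgebra K (Fin n →₀ ℕ)) :=
    inferInstanceAs (IsDomain (MvPolynomial (Fin n) K))
  refine isIntegrallyClosed_of_isLocalization _ N fun x hx => ?_
  obtain ⟨p, rfl⟩ := hx
  refine mem_nonZeroDivisors_of_ne_zero ?_
  exact AddMonoidAlgebra.single_ne_zero.mpr one_ne_zero

theorem isIntegralElem_map {A B C D : Type*} [CommRing A] [CommRing B] [CommRing C] [CommRing D]
    {f : A →+* B} {g : C →+* D} {a : A →+* C} {b : B →+* D} (h : b.comp f = g.comp a) {x : B}
    (hx : f.IsIntegralElem x) : g.IsIntegralElem (b x) := by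
  obtain ⟨p, hp, h0⟩ := hx
  refine ⟨p.map a, hp.map a, ?_⟩
  rw [Polynomial.eval₂_map, ← h, ← Polynomial.hom_eval₂, h0, map_zero]

theorem exists_ringHom_comp_eq {A C D : Type*} [CommRing A] [CommRing C] [CommRing D]
    {f : A →+* D} {g : C →+* D} (hg : Function.Injective g) (h : ∀ x, f x ∈ g.range) :
    ∃ a : A →+* C, f = g.comp a := by
  choose a ha using h
  exact ⟨{ toFun := a
           map_one' := hg (by rw [ha, map_one, map_one])
           map_mul' := fun x y => hg (by rw [ha, map_mul, map_mul, ha, ha])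
           map_zero' := hg (by rw [ha, map_zero, map_zero])
           map_add' := fun x y => hg (by rw [ha, map_add, map_add, ha, ha]) },
    RingHom.ext fun x => (ha x).symm⟩

/-! ### Gradings and the integral closure of a monoid algebra. -/

/-- The part of degree `d` with respect to the grading defined by `v`. -/
def gradedPart {K : Type*} [Field K] {n : ℕ} (v : Fin n → ℤ) (d : ℤ)
    (f : AddMonoidAlgebra K (Fin n → ℤ)) : AddMonoidAlgebra K (Fin n → ℤ) :=
  .ofCoeff (f.coeff.filter fun m => m ⬝ᵥ v = d)

/-- The expansion of a Laurent polynomial according to the grading defined by `v`. -/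
def gradedExpansion (K : Type*) [Field K] {n : ℕ} (v : Fin n → ℤ) :
    AddMonoidAlgebra K (Fin n → ℤ) →+*
      LaurentSeries (FractionRing (AddMonoidAlgebra K (Fin n → ℤ))) :=
  AddMonoidAlgebra.liftNCRingHom
    (HahnSeries.C.comp ((algebraMap (AddMonoidAlgebra K (Fin n → ℤ)) _).comp
      AddMonoidAlgebra.singleZeroRingHom))
    { toFun := fun m => HahnSeries.single (m.toAdd ⬝ᵥ v) (algebraMap _ _ (single m.toAdd (1 : K)))
      map_one' := by
        rw [toAdd_one, zero_dotProduct, ← AddMonoidAlgebra.one_def, map_one]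
        rfl
      map_mul' := fun a b => by
        rw [HahnSeries.single_mul_single, ← map_mul, AddMonoidAlgebra.single_mul_single, one_mul,
          toAdd_mul, add_dotProduct] }
    fun _ _ => Commute.all _ _

theorem gradedExpansion_single {K : Type*} [Field K] {n : ℕ} (v m : Fin n → ℤ) (c : K) :
    gradedExpansion K v (single m c) = HahnSeries.single (m ⬝ᵥ v) (algebraMap _ _ (single m c)) := by
  rw [gradedExpansion, AddMonoidAlgebra.liftNCRingHom_single]
  change HahnSeries.single (0 : ℤ)
      (algebraMap _ (FractionRing _) (single (0 : Fin n → ℤ) c : AddMonoidAlgebra K _)) *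
    HahnSeries.single (m ⬝ᵥ v) (algebraMap _ _ (single m (1 : K))) = _
  rw [HahnSeries.single_mul_single, ← map_mul, AddMonoidAlgebra.single_mul_single, zero_add,
    zero_add, mul_one]

theorem coeff_gradedExpansion {K : Type*} [Field K] {n : ℕ} (v : Fin n → ℤ)
    (f : AddMonoidAlgebra K (Fin n → ℤ)) (d : ℤ) :
    (gradedExpansion K v f).coeff d = algebraMap _ _ (gradedPart v d f) := by
  induction f using AddMonoidAlgebra.induction_linear with
  | zero =>
    have : gradedPart v d (0 : AddMonoidAlgebra K (Fin n → ℤ)) = 0 :=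
      congrArg AddMonoidAlgebra.ofCoeff (Finsupp.filter_zero _)
    rw [this, map_zero, map_zero, HahnSeries.coeff_zero]
  | add f g hf hg =>
    rw [map_add, HahnSeries.coeff_add, hf, hg, ← map_add]
    congr 1
    simp [gradedPart, Finsupp.filter_add]
  | single m c =>
    rw [gradedExpansion_single]
    by_cases h : m ⬝ᵥ v = d
    · rw [h, HahnSeries.coeff_single_same]
      congr 1
      simp only [gradedPart, AddMonoidAlgebra.coeff_single]
      rw [Finsupp.filter_single_of_pos _ (by exact h)]
      rfl
    · rw [HahnSeries.coeff_single_of_ne (Ne.symm h)]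
      simp only [gradedPart, AddMonoidAlgebra.coeff_single]
      rw [Finsupp.filter_single_of_neg _ (by exact h)]
      simp

theorem algebraMap_laurentSeries_coeff_neg {F : Type*} [Field F] (p : PowerSeries F) {d : ℤ}
    (hd : d < 0) : (algebraMap (PowerSeries F) (LaurentSeries F) p).coeff d = 0 := by
  rw [LaurentSeries.coe_algebraMap, HahnSeries.ofPowerSeries_apply]
  apply HahnSeries.embDomain_of_notMem_range
  rintro ⟨x, hx⟩
  have : (x : ℤ) = d := hx
  omega

/-- Expansion by `v`-degree sends `K[S]` into power series over a field, which are integrally closed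
in Laurent series. So an integral element has no component of negative degree. -/
theorem nonneg_of_isIntegralElem {K : Type*} [Field K] {n : ℕ} {v : Fin n → ℤ}
    {S : AddSubmonoid (Fin n → ℤ)} (hS : ∀ m ∈ S, 0 ≤ m ⬝ᵥ v)
    {f : AddMonoidAlgebra K (Fin n → ℤ)} (hf : (mapDomainRingHom K S.subtype).IsIntegralElem f)
    {m : Fin n → ℤ} (hm : m ∈ f.coeff.support) : 0 ≤ m ⬝ᵥ v := by
  let F := FractionRing (AddMonoidAlgebra K (Fin n → ℤ))
  have hrange : ∀ x, ∃ p : PowerSeries F, algebraMap (PowerSeries F) (LaurentSeries F) p =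
      gradedExpansion K v (mapDomainRingHom K S.subtype x) := by
    intro x
    induction x using AddMonoidAlgebra.induction_linear with
    | zero => exact ⟨0, by simp⟩
    | add x y hx hy =>
      obtain ⟨p, hp⟩ := hx
      obtain ⟨q, hq⟩ := hy
      exact ⟨p + q, by rw [map_add, hp, hq, map_add, map_add]⟩
    | single m c =>
      obtain ⟨d, hd⟩ := Int.eq_ofNat_of_zero_le (hS m m.2)
      refine ⟨PowerSeries.monomial d (algebraMap _ _ (single (m : Fin n → ℤ) c)), ?_⟩
      rw [mapDomainRingHom_single]
      change _ = gradedExpansion K v (single (m : Fin n → ℤ) c)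
      rw [gradedExpansion_single, hd, LaurentSeries.coe_algebraMap]
      ext e
      by_cases he : 0 ≤ e
      · obtain ⟨e, rfl⟩ := Int.eq_ofNat_of_zero_le he
        rw [HahnSeries.ofPowerSeries_apply_coeff, PowerSeries.coeff_monomial,
          HahnSeries.coeff_single]
        simp [F]
      · rw [← LaurentSeries.coe_algebraMap, algebraMap_laurentSeries_coeff_neg _ (not_le.mp he),
          HahnSeries.coeff_single_of_ne]
        omega
  have hinj : Function.Injective (algebraMap (PowerSeries F) (LaurentSeries F)) :=
    IsFractionRing.injective _ _
  obtain ⟨g, hg⟩ := exists_ringHom_comp_eq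
    (f := (gradedExpansion K v).comp (mapDomainRingHom K S.subtype)) hinj hrange
  have hint : IsIntegral (PowerSeries F) (gradedExpansion K v f) := isIntegralElem_map hg hf
  obtain ⟨p, hp⟩ := IsIntegrallyClosed.algebraMap_eq_of_integral hint
  by_contra hneg
  have h0 := coeff_gradedExpansion v f (m ⬝ᵥ v)
  rw [← hp, algebraMap_laurentSeries_coeff_neg p (not_le.mp hneg)] at h0
  have h1 : gradedPart v (m ⬝ᵥ v) f = 0 :=
    (IsFractionRing.injective (AddMonoidAlgebra K (Fin n → ℤ)) F) (by rw [← h0, map_zero])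
  have h2 : (gradedPart v (m ⬝ᵥ v) f).coeff m = f.coeff m := by
    simp [gradedPart]
  rw [h1] at h2
  exact (Finsupp.mem_support_iff.mp hm) h2.symm

/-- If `L` is the field of fractions of `K[ℤⁿ]`, the integral closure in `L` of a ring `O` of
Laurent polynomials with exponents in a saturated monoid `S` is all of `K[S]`, as soon as `K` and a
power of each monomial of `K[S]` are integral over `O`. -/
theorem isIntegral_iff_mem_range {K L R : Type*} [Field K] [Field L] [CommRing R] {n : ℕ}
    {J : AddMonoidAlgebra K (Fin n → ℤ) →+* L} (hJ : Function.Injective J)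
    (hfrac : ∀ z, ∃ a b, J b ≠ 0 ∧ z * J b = J a) {s : Set (Fin n → ℤ)}
    {S : AddSubmonoid (Fin n → ℤ)} (hS : ∀ m, m ∈ S ↔ ∀ v ∈ s, 0 ≤ m ⬝ᵥ v)
    {e : R →+* L} (he : ∀ x, e x ∈ (J.comp (mapDomainRingHom K S.subtype)).range)
    (hK : ∀ c, e.IsIntegralElem (J (single 0 c)))
    (hm : ∀ m ∈ S, ∃ N : ℕ, 0 < N ∧ e.IsIntegralElem (J (single m 1) ^ N)) (z : L) :
    e.IsIntegralElem z ↔ z ∈ (J.comp (mapDomainRingHom K S.subtype)).range := by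
  constructor
  · intro hz
    let := J.toAlgebra
    have hfr : IsFractionRing (AddMonoidAlgebra K (Fin n → ℤ)) L := by
      change IsLocalization _ _
      rw [isLocalization_iff]
      refine ⟨?_, ?_, ?_⟩
      · rintro ⟨x, hx⟩
        rw [isUnit_iff_ne_zero]
        change J x ≠ 0
        rw [map_ne_zero_iff J hJ]
        exact nonZeroDivisors.ne_zero hx
      · intro z
        obtain ⟨a, b, hb, h⟩ := hfrac z
        exact ⟨(a, ⟨b, mem_nonZeroDivisors_of_ne_zero fun h0 => hb (by rw [h0, map_zero])⟩), h⟩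
      · intro x y h
        exact ⟨1, by rw [hJ h]⟩
    -- Normality of the Laurent polynomial ring makes `z` a Laurent polynomial. The inequalities
    -- defining `S` then bound its exponents one at a time.
    have := isIntegrallyClosed_addMonoidAlgebra K n
    let ιS := mapDomainRingHom K S.subtype
    have hinj : Function.Injective (J.comp ιS) :=
      hJ.comp (mapDomainRingHom_injective Subtype.val_injective)
    obtain ⟨g, hg⟩ := exists_ringHom_comp_eq hinj he
    have h1 : (J.comp ιS).IsIntegralElem z :=
      isIntegralElem_map (a := g) (b := RingHom.id L) (by rw [RingHom.id_comp]; exact hg) hz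
    have h2 : IsIntegral (AddMonoidAlgebra K (Fin n → ℤ)) z :=
      isIntegralElem_map (a := ιS) (b := RingHom.id L) (by rw [RingHom.id_comp]; rfl) h1
    obtain ⟨f, hf⟩ := IsIntegrallyClosed.algebraMap_eq_of_integral h2
    have hf : J f = z := hf
    have h3 : ιS.IsIntegralElem f := by
      obtain ⟨p, hp, h0⟩ := h1
      refine ⟨p, hp, hJ ?_⟩
      rw [Polynomial.hom_eval₂, hf, h0, map_zero]
    obtain ⟨x, hx⟩ : f ∈ ιS.rangeS := by
      refine mem_range_mapDomainRingHom fun m hmf => ?_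
      refine ⟨⟨m, (hS m).mpr fun v hv => nonneg_of_isIntegralElem (fun m' hm' => ?_) h3 hmf⟩, rfl⟩
      exact (hS m').mp hm' v hv
    exact ⟨x, by rw [RingHom.comp_apply, ← hf]; exact congrArg J hx⟩
  · rintro ⟨x, rfl⟩
    let := e.toAlgebra
    change IsIntegral R _
    induction x using AddMonoidAlgebra.induction_linear with
    | zero => rw [map_zero]; exact isIntegral_zero
    | add x y hx hy => rw [map_add]; exact hx.add hy
    | single m c =>
      rw [RingHom.comp_apply, mapDomainRingHom_single]
      have : single (m : Fin n → ℤ) c = single 0 c * single (m : Fin n → ℤ) 1 := by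
        rw [AddMonoidAlgebra.single_mul_single, zero_add, mul_one]
      change IsIntegral R (J (single (m : Fin n → ℤ) c))
      rw [this, map_mul]
      obtain ⟨N, hN, h⟩ := hm m m.2
      exact IsIntegral.mul (hK c) (IsIntegral.of_pow hN h)

end MonoidAlgebra

/-! ### Characters and minimal primes of group algebras -/

section Characters

open AddMonoidAlgebra (single mapDomainRingHom)

theorem exists_free_quotient (A : Type*) [AddCommGroup A] [AddGroup.FG A] :
    ∃ (r : ℕ) (w : A →+ (Fin r → ℤ)) (s : (Fin r → ℤ) →+ A), (∀ m, w (s m) = m) ∧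
      (w.ker : Set A).Finite := by
  obtain ⟨r, ι, _, p, hp, e, ⟨E⟩⟩ := AddCommGroup.equiv_free_prod_directSum_zmod A
  have : ∀ i, NeZero (p i ^ e i) := fun i => ⟨pow_ne_zero _ (hp i).ne_zero⟩
  have hfin : Finite (DirectSum ι fun i => ZMod (p i ^ e i)) := by
    classical
    exact Finite.of_injective _ (DFinsupp.equivFunOnFintype (β := fun i => ZMod (p i ^ e i))).injective
  let c : (Fin r →₀ ℤ) ≃+ (Fin r → ℤ) := (Finsupp.linearEquivFunOnFinite ℤ ℤ (Fin r)).toAddEquiv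
  refine ⟨r, (c.toAddMonoidHom.comp (AddMonoidHom.fst _ _)).comp E.toAddMonoidHom,
    (E.symm.toAddMonoidHom.comp (AddMonoidHom.inl _ _)).comp c.symm.toAddMonoidHom, ?_, ?_⟩
  · intro m
    simp
  · refine (Set.finite_range fun t => E.symm (0, t)).subset ?_
    intro a ha
    refine ⟨(E a).2, ?_⟩
    have h : c (E a).1 = 0 := ha
    have h' : (E a).1 = 0 := by simpa using h
    rw [← h']
    exact E.symm_apply_apply a

variable {k : Type u} [Field k] {L : Type u} [Field L] [Algebra k L]

/-- The values of a multiplicative character on a set. -/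
def charValues {A : Type*} [AddZeroClass A] (χ : Multiplicative A →* L) (D : Set A) : Set L :=
  (fun d => χ (Multiplicative.ofAdd d)) '' D

/-- The values form a finite subgroup of the units of a field, hence a cyclic group, and `n` is its
order. A field containing a primitive `n`-th root of unity has characteristic not dividing `n`. -/
theorem exists_primitiveRoot_adjoin_eq {A : Type*} [AddCommGroup A] (T : AddSubgroup A)
    (hT : (T : Set A).Finite) (χ : Multiplicative A →* L) :
    ∃ n : ℕ, (n : k) ≠ 0 ∧ ∃ ζ : L, IsPrimitiveRoot ζ n ∧
      Algebra.adjoin k (charValues χ T) = Algebra.adjoin k {ζ} := by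
  let G : Subgroup Lˣ := (AddSubgroup.toSubgroup T).map χ.toHomUnits
  have hG : Finite G := by
    refine Set.Finite.to_subtype ?_
    exact Set.Finite.image _ hT
  have : IsCyclic G := isCyclic_of_injective_ringHom (Units.coeHom L |>.comp G.subtype)
    (Units.val_injective.comp Subtype.val_injective)
  obtain ⟨g, hg⟩ := IsCyclic.exists_generator (α := G)
  have hcard : orderOf g = Nat.card G := orderOf_eq_card_of_forall_mem_zpowers hg
  let ζ : L := ((g : Lˣ) : L)
  have hζ : IsPrimitiveRoot ζ (Nat.card G) := by
    rw [← hcard, ← Subgroup.orderOf_coe, ← orderOf_units]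
    exact IsPrimitiveRoot.orderOf _
  have hn : NeZero (Nat.card G) := ⟨Nat.card_pos.ne'⟩
  refine ⟨Nat.card G, fun h0 => ?_, ζ, hζ, ?_⟩
  · have h1 := hζ.neZero'
    apply h1.out
    rw [← map_natCast (algebraMap k L), h0, map_zero]
  · apply le_antisymm
    · refine Algebra.adjoin_le ?_
      rintro _ ⟨t, ht, rfl⟩
      have hmem : χ.toHomUnits (Multiplicative.ofAdd t) ∈ G := ⟨_, ht, rfl⟩
      obtain ⟨i, hi⟩ := (mem_powers_iff_mem_zpowers (x := g)).mpr (hg ⟨_, hmem⟩)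
      have : χ (Multiplicative.ofAdd t) = ζ ^ i := by
        have := congrArg (fun x : G => ((x : Lˣ) : L)) hi
        simp only [SubmonoidClass.coe_pow, Units.val_pow_eq_pow_val] at this
        exact this.symm
      change χ (Multiplicative.ofAdd t) ∈ _
      rw [this]
      exact pow_mem (Algebra.subset_adjoin (Set.mem_singleton ζ)) i
    · refine Algebra.adjoin_mono ?_
      rintro _ rfl
      obtain ⟨t, ht, h⟩ := g.2
      exact ⟨t.toAdd, ht, congrArg Units.val h⟩

/-- The cyclotomic polynomial splits in `L`, so its splitting field embeds. Two primitive `n`-th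
roots of unity in `L` are powers of each other, which identifies the image. -/
theorem exists_cyclotomicField_algHom {n : ℕ} (hn : (n : k) ≠ 0) {ζ : L}
    (hζ : IsPrimitiveRoot ζ n) :
    ∃ j : CyclotomicField n k →ₐ[k] L, j.range = Algebra.adjoin k {ζ} := by
  have hn0 : n ≠ 0 := by rintro rfl; simp at hn
  have : NeZero n := ⟨hn0⟩
  have : NeZero (n : k) := ⟨hn⟩
  have hs : ((Polynomial.cyclotomic n k).map (algebraMap k L)).Splits := by
    rw [Polynomial.map_cyclotomic]
    exact (Polynomial.X_pow_sub_one_splits hζ).of_dvd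
      (Polynomial.X_pow_sub_C_ne_zero (Nat.pos_of_ne_zero hn0) 1)
      (by simpa using Polynomial.cyclotomic.dvd_X_pow_sub_one n L)
  let j : CyclotomicField n k →ₐ[k] L := Polynomial.SplittingField.lift _ hs
  refine ⟨j, ?_⟩
  have htop : Algebra.adjoin k {b : CyclotomicField n k | ∃ m ∈ ({n} : Set ℕ), m ≠ 0 ∧ b ^ m = 1} =
      ⊤ := Algebra.eq_top_iff.mpr IsCyclotomicExtension.adjoin_roots
  have hz := IsCyclotomicExtension.zeta_spec n k (CyclotomicField n k)
  have hjz : IsPrimitiveRoot (j (IsCyclotomicExtension.zeta n k (CyclotomicField n k))) n :=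
    hz.map_of_injective j.injective
  rw [← Algebra.map_top, ← htop, AlgHom.map_adjoin]
  apply le_antisymm
  · refine Algebra.adjoin_le ?_
    rintro _ ⟨b, ⟨m, rfl, -, hb⟩, rfl⟩
    obtain ⟨i, -, hi⟩ := hζ.eq_pow_of_pow_eq_one (ξ := j b) (by rw [← map_pow, hb, map_one])
    rw [← hi]
    exact pow_mem (Algebra.subset_adjoin (Set.mem_singleton ζ)) i
  · refine Algebra.adjoin_le ?_
    rw [Set.singleton_subset_iff]
    obtain ⟨i, -, hi⟩ := hjz.eq_pow_of_pow_eq_one hζ.pow_eq_one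
    rw [← hi]
    refine pow_mem (Algebra.subset_adjoin (Set.mem_image_of_mem _ ?_)) i
    exact ⟨n, rfl, hn0, hz.pow_eq_one⟩

theorem adjoin_primitiveRoot_eq_bot {n : ℕ} {ζ : L} (hn : (n : k) ≠ 0) (hζ : IsPrimitiveRoot ζ n)
    (h : (Polynomial.X ^ n - 1 : Polynomial k).Splits) :
    (Algebra.ofId k L).range = Algebra.adjoin k {ζ} := by
  have hn0 : 0 < n := Nat.pos_of_ne_zero (by rintro rfl; simp at hn)
  have h0 : (Polynomial.X ^ n - 1 : Polynomial k) ≠ 0 :=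
    Polynomial.X_pow_sub_C_ne_zero hn0 1
  have hroot : ζ ∈ ((Polynomial.X ^ n - 1 : Polynomial k).map (algebraMap k L)).roots := by
    rw [Polynomial.mem_roots (Polynomial.map_ne_zero h0)]
    simp [hζ.pow_eq_one]
  rw [h.roots_map, Multiset.mem_map] at hroot
  obtain ⟨x, -, rfl⟩ := hroot
  apply le_antisymm
  · rintro _ ⟨y, rfl⟩
    exact Subalgebra.algebraMap_mem _ y
  · refine Algebra.adjoin_le ?_
    rw [Set.singleton_subset_iff]
    exact ⟨x, rfl⟩

/-! ### From a character of `A` to Laurent polynomials over `K`. -/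

variable {K : Type u} [Field K] [Algebra k K] {A : Type} [AddCommGroup A]

/-- The homomorphism from a Laurent polynomial ring over `K` given by an embedding of `K` and a
character. -/
def laurentHom {r : ℕ} (j : K →+* L) (x : Multiplicative (Fin r → ℤ) →* L) :
    AddMonoidAlgebra K (Fin r → ℤ) →+* L :=
  AddMonoidAlgebra.liftNCRingHom j x fun _ _ => Commute.all _ _

theorem laurentHom_single {r : ℕ} (j : K →+* L) (x : Multiplicative (Fin r → ℤ) →* L)
    (m : Fin r → ℤ) (c : K) : laurentHom j x (single m c) = j c * x (Multiplicative.ofAdd m) :=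
  AddMonoidAlgebra.liftNCRingHom_single ..

/-- The character of the free part of `A`. -/
def freeChar {r : ℕ} (χ : Multiplicative A →* L) (s : (Fin r → ℤ) →+ A) :
    Multiplicative (Fin r → ℤ) →* L :=
  χ.comp (AddMonoidHom.toMultiplicative s)

theorem freeChar_apply {r : ℕ} (χ : Multiplicative A →* L) (s : (Fin r → ℤ) →+ A)
    (m : Fin r → ℤ) : freeChar χ s (Multiplicative.ofAdd m) = χ (Multiplicative.ofAdd (s m)) := rfl

theorem sub_mem_ker {r : ℕ} {w : A →+ (Fin r → ℤ)} {s : (Fin r → ℤ) →+ A} (hs : ∀ m, w (s m) = m)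
    (a : A) : a - s (w a) ∈ w.ker := by
  rw [AddMonoidHom.mem_ker, map_sub, hs, sub_self]

theorem char_eq_mul_freeChar {r : ℕ} (χ : Multiplicative A →* L) (w : A →+ (Fin r → ℤ))
    (s : (Fin r → ℤ) →+ A) (a : A) : χ (Multiplicative.ofAdd a) =
      χ (Multiplicative.ofAdd (a - s (w a))) * freeChar χ s (Multiplicative.ofAdd (w a)) := by
  rw [freeChar_apply, ← map_mul, ← ofAdd_add, sub_add_cancel]

/-- The map `k[A] → L` factors as a surjection `Ψ` onto `K[ℤ^r]` followed by the map in question. As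
`K[ℤ^r]` is a domain, `ker Ψ` is a prime inside the kernel of the composite; minimality of the
latter forces equality. -/
theorem laurentHom_injective {r : ℕ} {χ : Multiplicative A →* L} {w : A →+ (Fin r → ℤ)}
    {s : (Fin r → ℤ) →+ A} (hs : ∀ m, w (s m) = m) {j : K →ₐ[k] L}
    (hj : j.range = Algebra.adjoin k (charValues χ w.ker))
    (hmin : ∀ Q : Ideal (AddMonoidAlgebra k A), Q.IsPrime →
      Q ≤ RingHom.ker (AddMonoidAlgebra.lift k L A χ) →
      RingHom.ker (AddMonoidAlgebra.lift k L A χ) ≤ Q) :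
    Function.Injective (laurentHom j.toRingHom (freeChar χ s)) := by
  have hθ : ∀ a : A, ∃ c : K, j c = χ (Multiplicative.ofAdd (a - s (w a))) := by
    intro a
    have : χ (Multiplicative.ofAdd (a - s (w a))) ∈ j.range := by
      rw [hj]
      exact Algebra.subset_adjoin ⟨_, sub_mem_ker hs a, rfl⟩
    exact this
  choose θ hθ using hθ
  let Ψ : AddMonoidAlgebra k A →ₐ[k] AddMonoidAlgebra K (Fin r → ℤ) :=
    AddMonoidAlgebra.lift k _ A
      { toFun := fun a => single (w a.toAdd) (θ a.toAdd)
        map_one' := by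
          have : θ 0 = 1 := j.injective (by simp [hθ])
          rw [toAdd_one, this, map_zero]
          rfl
        map_mul' := fun a b => by
          rw [AddMonoidAlgebra.single_mul_single, toAdd_mul, map_add]
          congr 1
          apply j.injective
          change j _ = j (_ * _)
          rw [map_mul, hθ, hθ, hθ, ← map_mul, ← ofAdd_add]
          congr 2
          simp only [map_add]
          abel }
  have hΨ : ∀ a, Ψ (single a 1) = single (w a) (θ a) := fun a => by
    rw [AddMonoidAlgebra.lift_single, one_smul]; rfl
  have hcomp : ∀ y, laurentHom j.toRingHom (freeChar χ s) (Ψ y) =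
      AddMonoidAlgebra.lift k L A χ y := by
    intro y
    induction y using AddMonoidAlgebra.induction_on with
    | of a =>
      change laurentHom j.toRingHom (freeChar χ s) (Ψ (single a 1)) =
        AddMonoidAlgebra.lift k L A χ (single a 1)
      rw [hΨ, laurentHom_single, AddMonoidAlgebra.lift_single, one_smul,
        char_eq_mul_freeChar χ w s a, ← hθ]
      rfl
    | add x y hx hy => rw [map_add, map_add, hx, hy, map_add]
    | smul c x hx =>
      rw [map_smul Ψ, map_smul (AddMonoidAlgebra.lift k L A χ), ← hx, Algebra.smul_def, Algebra.smul_def, map_mul]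
      congr 1
      change laurentHom j.toRingHom (freeChar χ s) (single 0 (algebraMap k K c)) = _
      rw [laurentHom_single, ofAdd_zero, map_one, mul_one]
      exact j.commutes c
  -- Torsion elements give all scalars, because their values generate `K`; the section `s` gives all
  -- monomials.
  have hsurj : Function.Surjective Ψ := by
    rw [← AlgHom.range_eq_top, Algebra.eq_top_iff]
    let i : K →ₐ[k] AddMonoidAlgebra K (Fin r → ℤ) :=
      IsScalarTower.toAlgHom k K (AddMonoidAlgebra K (Fin r → ℤ))
    have hK : ∀ c : K, single 0 c ∈ Ψ.range := by
      have h1 : j.range ≤ (Ψ.range.comap i).map j := by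
        rw [hj]
        refine Algebra.adjoin_le ?_
        rintro _ ⟨t, ht, rfl⟩
        have ht0 : w t = 0 := ht
        have h2 : j (θ t) = χ (Multiplicative.ofAdd t) := by
          rw [hθ, ht0, map_zero, sub_zero]
        refine ⟨θ t, ⟨single t 1, ?_⟩, h2⟩
        change Ψ (single t 1) = _
        rw [hΨ, ht0]
        rfl
      intro c
      obtain ⟨c', hc', h⟩ := h1 ⟨c, rfl⟩
      rw [← j.injective h]
      exact hc'
    intro y
    induction y using AddMonoidAlgebra.induction_linear with
    | zero => exact zero_mem _
    | add x y hx hy => exact add_mem hx hy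
    | single m c =>
      have h1 : θ (s m) = 1 := j.injective (by simp [hθ, hs])
      have h2 : single m c = single 0 c * Ψ (single (s m) 1) := by
        rw [hΨ, h1, hs, AddMonoidAlgebra.single_mul_single, zero_add, mul_one]
      rw [h2]
      exact mul_mem (hK c) ⟨_, rfl⟩
  rw [injective_iff_map_eq_zero]
  intro z hz
  obtain ⟨y, rfl⟩ := hsurj z
  rw [hcomp] at hz
  have hp : (RingHom.ker Ψ).IsPrime := RingHom.ker_isPrime _
  exact hmin (RingHom.ker Ψ) hp (fun y hy => by
    rw [RingHom.mem_ker] at hy ⊢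
    rw [← hcomp, hy, map_zero]) hz

/-- The image of `e` lies in `K[S]`, with `S` the saturation of `w(D)`. Conversely `K` is generated
by roots of unity, and every monomial of `K[S]` has a power in the image of `e`. -/
theorem isIntegral_iff_mem_range_laurentHom {r : ℕ} {χ : Multiplicative A →* L}
    {w : A →+ (Fin r → ℤ)} {s : (Fin r → ℤ) →+ A} (hs : ∀ m, w (s m) = m)
    (hw : (w.ker : Set A).Finite) {j : K →ₐ[k] L}
    (hj : j.range = Algebra.adjoin k (charValues χ w.ker))
    (hJ : Function.Injective (laurentHom j.toRingHom (freeChar χ s)))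
    {R : Type*} [CommRing R] {e : R →+* L} {D : AddSubmonoid A} (hD : D.FG)
    (he : ∀ z, z ∈ e.range ↔ z ∈ Algebra.adjoin k (charValues χ D))
    (hfrac : ∀ z, ∃ a b, e b ≠ 0 ∧ z * e b = e a) (z : L) :
    e.IsIntegralElem z ↔ z ∈ ((laurentHom j.toRingHom (freeChar χ s)).comp
      (mapDomainRingHom K (dualMonoid (dualCone (D.map w))).subtype)).range := by
  have hQ : (D.map w).FG := hD.map w
  obtain ⟨S, hS, -⟩ := exists_dualCone_eq_hull hQ
  have hχ : ∀ d ∈ D, χ (Multiplicative.ofAdd d) ∈ e.range := fun d hd =>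
    (he _).mpr (Algebra.subset_adjoin ⟨d, hd, rfl⟩)
  have hk : ∀ c, algebraMap k L c ∈ e.range := fun c =>
    (he _).mpr (Subalgebra.algebraMap_mem _ c)
  have hrange : ∀ x, e x ∈ ((laurentHom j.toRingHom (freeChar χ s)).comp
      (mapDomainRingHom K (dualMonoid (dualCone (D.map w))).subtype)).range := by
    intro x
    have hx : e x ∈ Algebra.adjoin k (charValues χ D) := (he _).mp ⟨x, rfl⟩
    generalize e x = y at hx ⊢
    induction hx using Algebra.adjoin_induction with
    | mem z hz =>
      obtain ⟨d, hd, rfl⟩ := hz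
      have h1 : χ (Multiplicative.ofAdd (d - s (w d))) ∈ j.range := by
        rw [hj]; exact Algebra.subset_adjoin ⟨_, sub_mem_ker hs d, rfl⟩
      obtain ⟨c, hc⟩ := h1
      refine ⟨single ⟨w d, le_dualMonoid_dualCone _ ⟨d, hd, rfl⟩⟩ c, ?_⟩
      rw [RingHom.comp_apply, mapDomainRingHom_single]
      change laurentHom j.toRingHom (freeChar χ s) (single (w d) c) = χ (Multiplicative.ofAdd d)
      rw [laurentHom_single, char_eq_mul_freeChar χ w s d, ← hc]
    | algebraMap c =>
      refine ⟨single 0 (algebraMap k K c), ?_⟩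
      rw [RingHom.comp_apply, mapDomainRingHom_single]
      change laurentHom j.toRingHom (freeChar χ s) (single 0 _) = _
      rw [laurentHom_single, ofAdd_zero, map_one, mul_one]
      exact j.commutes c
    | add x y _ _ hx hy => exact add_mem hx hy
    | mul x y _ _ hx hy => exact mul_mem hx hy
  have hint : ∀ z ∈ e.range, e.IsIntegralElem z := by
    rintro _ ⟨x, rfl⟩
    exact e.isIntegralElem_map
  refine isIntegral_iff_mem_range (s := (S : Set (Fin r → ℤ))) hJ ?_ ?_ hrange ?_ ?_ z
  · intro z
    obtain ⟨a, b, hb, h⟩ := hfrac z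
    obtain ⟨a', ha'⟩ := hrange a
    obtain ⟨b', hb'⟩ := hrange b
    rw [RingHom.comp_apply] at ha' hb'
    exact ⟨_, _, by rwa [hb'], by rw [ha', hb', h]⟩
  · intro m
    rw [hS, mem_dualMonoid_hull]
  · intro c
    rw [laurentHom_single, ofAdd_zero, map_one, mul_one]
    have hc : j c ∈ Algebra.adjoin k (charValues χ w.ker) := by rw [← hj]; exact ⟨c, rfl⟩
    let _ : Algebra R L := e.toAlgebra
    change IsIntegral R (j c)
    generalize j c = y at hc ⊢
    induction hc using Algebra.adjoin_induction with
    | mem z hz =>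
      obtain ⟨t, ht, rfl⟩ := hz
      have : Finite w.ker := hw
      obtain ⟨N, hN, h⟩ := (isOfFinAddOrder_of_finite (⟨t, ht⟩ : w.ker)).exists_nsmul_eq_zero
      refine IsIntegral.of_pow hN ?_
      have h' : N • t = 0 := congrArg Subtype.val h
      rw [← map_pow, ← ofAdd_nsmul, h', ofAdd_zero, map_one]
      exact isIntegral_one
    | algebraMap c => exact hint _ (hk c)
    | add x y _ _ hx hy => exact hx.add hy
    | mul x y _ _ hx hy => exact hx.mul hy
  · intro m hm
    -- `N` brings `m` into `w(D)`, as the image of some `d`; `M` then kills the torsion part of `d`.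
    -- So the `N * M`-th power of the monomial is `χ(d)^M`.
    obtain ⟨N, hN, d, hd, hdm⟩ := (mem_dualMonoid_dualCone hQ).mp hm
    have : Finite w.ker := hw
    obtain ⟨M, hM, h⟩ := (isOfFinAddOrder_of_finite
      (⟨_, sub_mem_ker hs d⟩ : w.ker)).exists_nsmul_eq_zero
    have h' : M • (d - s (w d)) = 0 := congrArg Subtype.val h
    refine ⟨N * M, Nat.mul_pos hN hM, hint _ ?_⟩
    have e1 : laurentHom j.toRingHom (freeChar χ s) (single m 1) ^ (N * M) =
        χ (Multiplicative.ofAdd d) ^ M := by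
      rw [laurentHom_single, map_one, one_mul, pow_mul, ← map_pow, ← ofAdd_nsmul, ← hdm,
        char_eq_mul_freeChar χ w s d, mul_pow, ← map_pow χ, ← ofAdd_nsmul, h', ofAdd_zero, map_one,
        one_mul]
    rw [e1]
    exact pow_mem (hχ d hd) M

end Characters

/-! ### Charts of the normalization of a component -/

section NormalizationCharts

/-- Two rings embedded in `L` with the same image are isomorphic over `L`, so `Spec D` can replace
`U`. -/
theorem exists_openImmersion_of_range_eq {W : Scheme.{u}} {U : W.Opens} (hU : IsAffineOpen U)
    {L D : CommRingCat.{u}} {Θ : Γ(W, U) ⟶ L} (hΘ : Function.Injective Θ.hom) {δ : D ⟶ L}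
    (hδ : Function.Injective δ.hom) (h : ∀ z, z ∈ δ.hom.range ↔ z ∈ Θ.hom.range) :
    ∃ c : Spec D ⟶ W, IsOpenImmersion c ∧ Set.range c = U ∧
      Spec.map δ ≫ c = Spec.map Θ ≫ hU.fromSpec := by
  obtain ⟨a, ha⟩ := exists_ringHom_comp_eq (f := Θ.hom) hδ fun x => (h _).mpr ⟨x, rfl⟩
  obtain ⟨b, hb⟩ := exists_ringHom_comp_eq (f := δ.hom) hΘ fun x => (h _).mp ⟨x, rfl⟩
  have hab : a.comp b = RingHom.id _ := RingHom.ext fun x => hδ (by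
    rw [RingHom.comp_apply, ← RingHom.comp_apply, ← ha, ← RingHom.comp_apply, ← hb]; rfl)
  have hba : b.comp a = RingHom.id _ := RingHom.ext fun x => hΘ (by
    rw [RingHom.comp_apply, ← RingHom.comp_apply, ← hb, ← RingHom.comp_apply, ← ha]; rfl)
  let E : Γ(W, U) ≅ D :=
    { hom := CommRingCat.ofHom a
      inv := CommRingCat.ofHom b
      hom_inv_id := by ext1; exact hba
      inv_hom_id := by ext1; exact hab }
  have : IsIso E.hom := E.isIso_hom
  have : IsIso (Spec.map E.hom) := inferInstance
  refine ⟨Spec.map E.hom ≫ hU.fromSpec, inferInstance, ?_, ?_⟩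
  · have hs : Function.Surjective (Spec.map E.hom) := (Spec.map E.hom).homeomorph.surjective
    rw [Scheme.Hom.comp_base, TopCat.coe_comp, Set.range_comp, hs.range_eq, Set.image_univ,
      hU.range_fromSpec]
  · rw [← Spec.map_comp_assoc]
    congr 2
    ext1
    exact ha.symm

variable (Z : Scheme.{u}) [IsIntegral Z]

instance : IsIntegralHom (normalizationMap Z) :=
  inferInstanceAs (IsIntegralHom (genericPointIncl Z).fromNormalization)

/-- The inclusion of the generic point of the normalization. -/
def toNormalizationMap : Spec Z.functionField ⟶ normalization Z :=
  (genericPointIncl Z).toNormalization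

theorem toNormalizationMap_comp : toNormalizationMap Z ≫ normalizationMap Z = genericPointIncl Z :=
  (genericPointIncl Z).toNormalization_fromNormalization

theorem SpecMap_germToFunctionField {U : Z.Opens} [Nonempty U] (hU : IsAffineOpen U) :
    Spec.map (Z.germToFunctionField U) ≫ hU.fromSpec = genericPointIncl Z :=
  hU.fromSpecStalk_eq_fromSpecStalk _

/-- Over an affine open `U` the normalization is the spectrum of the integral closure of the
sections in the function field, so it is determined by a subring of that field. -/
theorem exists_normalization_chart {U : Z.Opens} [Nonempty U] (hU : IsAffineOpen U)
    {D : CommRingCat.{u}} {δ : D ⟶ Z.functionField} (hδ : Function.Injective δ.hom)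
    (h : ∀ z, (Z.germToFunctionField U).hom.IsIntegralElem z ↔ z ∈ δ.hom.range) :
    ∃ c : Spec D ⟶ normalization Z, IsOpenImmersion c ∧
      Set.range c = normalizationMap Z ⁻¹' (U : Set Z) ∧
      Spec.map δ ≫ c = toNormalizationMap Z := by
  let g := genericPointIncl Z
  let V := g ⁻¹ᵁ U
  -- The generic point lies in every non-empty open set. `κ` then identifies the sections over `V`
  -- with the function field itself.
  have hV : V = ⊤ := by
    rw [← top_le_iff]
    rintro x -
    change g x ∈ (U : Set Z)
    rw [← hU.range_fromSpec]
    exact ⟨Spec.map (Z.germToFunctionField U) x, by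
      rw [← Scheme.Hom.comp_apply, SpecMap_germToFunctionField]⟩
  have hVa : IsAffineOpen V := by rw [hV]; exact isAffineOpen_top _
  let κ : Γ(Spec Z.functionField, V) ⟶ Z.functionField :=
    (Spec Z.functionField).presheaf.map (eqToHom hV.symm).op ≫ (Scheme.ΓSpecIso _).hom
  have hκi : Function.Injective κ.hom := (ConcreteCategory.bijective_of_isIso κ).1
  have hκ : Spec.map κ ≫ hVa.fromSpec = 𝟙 _ := by
    rw [Spec.map_comp, Category.assoc, hVa.map_fromSpec (isAffineOpen_top _),
      IsAffineOpen.fromSpec_top, Scheme.isoSpec_Spec_inv, ← Spec.map_comp, Iso.inv_hom_id,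
      Spec.map_id]
  let W := normalizationMap Z ⁻¹ᵁ U
  have hW : IsAffineOpen W := hU.preimage _
  have hVW : V ≤ toNormalizationMap Z ⁻¹ᵁ W := by
    rw [← Scheme.Hom.comp_preimage, toNormalizationMap_comp]
  let Θ := (toNormalizationMap Z).appLE W V hVW ≫ κ
  have hΘ : Spec.map Θ ≫ hW.fromSpec = toNormalizationMap Z := by
    rw [Spec.map_comp, Category.assoc, IsAffineOpen.SpecMap_appLE_fromSpec _ hW hVa, ← Category.assoc,
      hκ, Category.id_comp]
  have hθ : g.app U ≫ κ = Z.germToFunctionField U := by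
    rw [← Spec.map_inj, ← cancel_mono hU.fromSpec, SpecMap_germToFunctionField, Spec.map_comp,
      Scheme.Hom.app_eq_appLE, Category.assoc, IsAffineOpen.SpecMap_appLE_fromSpec _ hU hVa,
      ← Category.assoc, hκ, Category.id_comp]
  let _ := (g.app U).hom.toAlgebra
  have hval : (g.normalizationObjIso hU).hom ≫
      CommRingCat.ofHom (integralClosure Γ(Z, U) Γ(Spec Z.functionField, V)).val.toRingHom =
        (toNormalizationMap Z).appLE W V hVW :=
    g.normalizationObjIso_hom_val hU
  have happ : ∀ x, Θ.hom x = κ.hom ((g.normalizationObjIso hU).hom.hom x).1 := by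
    intro x
    change κ.hom (((toNormalizationMap Z).appLE W V hVW).hom x) = _
    rw [← hval]
    rfl
  have hinj : Function.Injective Θ.hom := by
    intro x y hxy
    rw [happ, happ] at hxy
    exact (ConcreteCategory.bijective_of_isIso (g.normalizationObjIso hU).hom).1
      (Subtype.ext (hκi hxy))
  obtain ⟨c, hc, hc', hc''⟩ := exists_openImmersion_of_range_eq hW hinj hδ fun z => by
    rw [← h]
    constructor
    · intro hz
      obtain ⟨y, rfl⟩ := (ConcreteCategory.bijective_of_isIso κ).2 z
      have hy : IsIntegral Γ(Z, U) y := by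
        obtain ⟨p, hp, h0⟩ := hz
        refine ⟨p, hp, hκi ?_⟩
        rw [← hθ] at h0
        rw [Polynomial.hom_eval₂, map_zero]
        exact h0
      obtain ⟨x, hx⟩ := (ConcreteCategory.bijective_of_isIso (g.normalizationObjIso hU).hom).2 ⟨y, hy⟩
      exact ⟨x, (happ x).trans (congrArg (fun a => κ.hom a.1) hx)⟩
    · rintro ⟨x, rfl⟩
      rw [happ, ← hθ]
      exact isIntegralElem_map (a := RingHom.id _) (b := κ.hom) (f := (g.app U).hom) rfl
        ((g.normalizationObjIso hU).hom.hom x).2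
  exact ⟨c, hc, hc', hc''.trans hΘ⟩

/-! ### From affine charts of the ambient scheme to its components. -/

variable (F : Scheme.{u}) (C : irreducibleComponents F)

/-- The generic point of a component. -/
def genericMap : Spec (component F C).functionField ⟶ F :=
  genericPointIncl (component F C) ≫ componentι F C

/-- The affine open subset of a component cut out by an affine chart. -/
def componentOpen {R : CommRingCat.{u}} (u : Spec R ⟶ F) [IsOpenImmersion u] :
    (component F C).Opens :=
  componentι F C ⁻¹ᵁ u.opensRange

theorem isAffineOpen_componentOpen {R : CommRingCat.{u}} (u : Spec R ⟶ F) [IsOpenImmersion u] :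
    IsAffineOpen (componentOpen F C u) :=
  (isAffineOpen_opensRange u).preimage _

theorem nonempty_componentOpen {R : CommRingCat.{u}} (u : Spec R ⟶ F) [IsOpenImmersion u]
    {e : R ⟶ (component F C).functionField} (he : Spec.map e ≫ u = genericMap F C) :
    Nonempty (componentOpen F C u) := by
  obtain ⟨x⟩ : Nonempty (Spec (component F C).functionField) := inferInstance
  refine ⟨⟨genericPointIncl (component F C) x, ?_⟩⟩
  change componentι F C (genericPointIncl (component F C) x) ∈ Set.range u
  rw [← Scheme.Hom.comp_apply]
  change genericMap F C x ∈ _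
  rw [← he]
  exact ⟨_, (Scheme.Hom.comp_apply ..).symm⟩

/-- The part of the component in the chart is the base change of a closed immersion, hence a closed
subscheme of `Spec R`. -/
theorem exists_surjective_componentOpen {R : CommRingCat.{u}} (u : Spec R ⟶ F) [IsOpenImmersion u]
    {e : R ⟶ (component F C).functionField} (he : Spec.map e ≫ u = genericMap F C)
    [Nonempty (componentOpen F C u)] :
    ∃ q : R ⟶ Γ(component F C, componentOpen F C u), Function.Surjective q.hom ∧
      q ≫ (component F C).germToFunctionField (componentOpen F C u) = e := by
  have hU := isAffineOpen_componentOpen F C u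
  have hle : Set.range (hU.fromSpec ≫ componentι F C) ⊆ Set.range u := by
    rintro _ ⟨x, rfl⟩
    have : hU.fromSpec x ∈ (componentOpen F C u : Set _) := by
      rw [← hU.range_fromSpec]; exact ⟨x, rfl⟩
    rw [Scheme.Hom.comp_apply]
    exact this
  let l := IsOpenImmersion.lift u (hU.fromSpec ≫ componentι F C) hle
  have hl : l ≫ u = hU.fromSpec ≫ componentι F C := IsOpenImmersion.lift_fac ..
  have hpb : IsPullback l hU.fromSpec u (componentι F C) :=
    IsOpenImmersion.isPullback l hU.fromSpec u (componentι F C) hl.symm (by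
      apply TopologicalSpace.Opens.ext
      rw [Scheme.Hom.coe_opensRange, hU.range_fromSpec]
      rfl)
  have hcl : IsClosedImmersion l :=
    MorphismProperty.of_isPullback (P := @IsClosedImmersion) hpb.flip inferInstance
  obtain ⟨q, hq⟩ := Spec.map_surjective l
  refine ⟨q, ?_, ?_⟩
  · rw [← hq] at hcl
    have := (IsClosedImmersion.isAffine_surjective_of_isAffine (Spec.map q)).2
    intro y
    obtain ⟨x, hx⟩ := this ((Scheme.ΓSpecIso _).inv.hom y)
    refine ⟨(Scheme.ΓSpecIso _).hom.hom x, ?_⟩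
    have hn := congrArg (fun f => f.hom x) (Scheme.ΓSpecIso_naturality q)
    simp only [CommRingCat.hom_comp, RingHom.comp_apply] at hn
    rw [← hn, hx]
    exact congrArg (fun f => f.hom y) (Scheme.ΓSpecIso _).inv_hom_id
  · rw [← Spec.map_inj, ← cancel_mono u, he, Spec.map_comp, Category.assoc, hq, hl, ← Category.assoc,
      SpecMap_germToFunctionField]
    rfl

theorem exists_mul_eq_of_chart {R : CommRingCat.{u}} (u : Spec R ⟶ F) [IsOpenImmersion u]
    {e : R ⟶ (component F C).functionField} (he : Spec.map e ≫ u = genericMap F C)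
    (z : (component F C).functionField) : ∃ a b, e.hom b ≠ 0 ∧ z * e.hom b = e.hom a := by
  have hne := nonempty_componentOpen F C u he
  obtain ⟨q, hq, rfl⟩ := exists_surjective_componentOpen F C u he
  have := functionField_isFractionRing_of_isAffineOpen (component F C) (componentOpen F C u)
    (isAffineOpen_componentOpen F C u)
  obtain ⟨⟨a, b⟩, hab⟩ := IsLocalization.surj
    (nonZeroDivisors Γ(component F C, componentOpen F C u)) z
  obtain ⟨a, rfl⟩ := hq a
  obtain ⟨b', hb'⟩ := hq b.1
  refine ⟨a, b', ?_, ?_⟩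
  · have h1 := IsLocalization.map_units (component F C).functionField b
    rw [← hb'] at h1
    exact h1.ne_zero
  · rw [← hb'] at hab
    exact hab

theorem exists_component_chart {R : CommRingCat.{u}} (u : Spec R ⟶ F) [IsOpenImmersion u]
    {e : R ⟶ (component F C).functionField} (he : Spec.map e ≫ u = genericMap F C)
    {D : CommRingCat.{u}} {δ : D ⟶ (component F C).functionField}
    (hδ : Function.Injective δ.hom) (h : ∀ z, e.hom.IsIntegralElem z ↔ z ∈ δ.hom.range) :
    ∃ c : Spec D ⟶ normalization (component F C), IsOpenImmersion c ∧
      Set.range c = (normalizationMap (component F C) ≫ componentι F C) ⁻¹' Set.range u ∧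
      Spec.map δ ≫ c = toNormalizationMap (component F C) := by
  have hne := nonempty_componentOpen F C u he
  obtain ⟨q, hq, hqe⟩ := exists_surjective_componentOpen F C u he
  obtain ⟨c, hc, hc', hc''⟩ := exists_normalization_chart (component F C)
    (isAffineOpen_componentOpen F C u) hδ (fun z => by
      rw [← h, ← hqe]
      constructor
      · rintro ⟨p, hp, h0⟩
        -- Integrality over the quotient of `R` is integrality over `R`: monic polynomials lift to
        -- monic polynomials.
        obtain ⟨p', rfl, -, hp'⟩ := Polynomial.lifts_and_natDegree_eq_and_monic
          ((Polynomial.lifts_iff_coeff_lifts p).mpr fun n => hq (p.coeff n)) hp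
        refine ⟨p', hp', ?_⟩
        rw [Polynomial.eval₂_map] at h0
        exact h0
      · rintro ⟨p, hp, h0⟩
        refine ⟨p.map q.hom, hp.map _, ?_⟩
        rw [Polynomial.eval₂_map]
        exact h0)
  refine ⟨c, hc, ?_, hc''⟩
  rw [hc', Scheme.Hom.comp_base, TopCat.coe_comp, Set.preimage_comp]
  rfl

end NormalizationCharts

/-! ### Recognizing a toric normalization -/

section Recognition

theorem isDominant_SpecMap_of_injective {D L : CommRingCat.{u}} (δ : D ⟶ L)
    (hδ : Function.Injective δ.hom) : IsDominant (Spec.map δ) := by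
  refine isDominant_of_of_appTop_injective ?_
  intro x y hxy
  have hn := Scheme.ΓSpecIso_naturality δ
  have h1 : (Scheme.ΓSpecIso D).hom.hom x = (Scheme.ΓSpecIso D).hom.hom y := by
    apply hδ
    have hx := congrArg (fun f => f.hom x) hn
    have hy := congrArg (fun f => f.hom y) hn
    simp only [CommRingCat.hom_comp, RingHom.comp_apply] at hx hy
    rw [← hx, ← hy]
    exact congrArg _ hxy
  exact (ConcreteCategory.bijective_of_isIso (Scheme.ΓSpecIso D).hom).1 h1

/-- `Spec L` is dense in the integral scheme `Spec D` and the target is separated. All gluing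
identities are checked at the generic point in this way. -/
theorem Spec_hom_ext_of_injective {D L : CommRingCat.{u}} [IsDomain L]
    (δ : D ⟶ L) (hδ : Function.Injective δ.hom) {W : Scheme.{u}} [W.IsSeparated]
    {a b : Spec D ⟶ W} (h : Spec.map δ ≫ a = Spec.map δ ≫ b) : a = b := by
  have := isDominant_SpecMap_of_injective δ hδ
  have : IsDomain D := hδ.isDomain δ.hom
  exact ext_of_isDominant (Spec.map δ) h

variable {k : Type u} [Field k] {F : Scheme.{u}}

/-- `K` is integral over `k`, so the base change of `C` to `K` is integral over `C`. The universal
property of normalization extends the generic map to this base change. -/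
theorem exists_normalization_structure (s : F ⟶ Spec (.of k)) [IsSeparated s]
    (C : irreducibleComponents F) {K : Type u} [Field K] [Algebra k K] [Algebra.IsIntegral k K]
    (j : K →+* (component F C).functionField)
    (hj : genericMap F C ≫ s = Spec.map (CommRingCat.ofHom (j.comp (algebraMap k K)))) :
    ∃ str : normalization (component F C) ⟶ Spec (.of K), IsSeparated str ∧
      str ≫ Spec.map (CommRingCat.ofHom (algebraMap k K)) =
        normalizationMap (component F C) ≫ componentι F C ≫ s ∧
      toNormalizationMap (component F C) ≫ str = Spec.map (CommRingCat.ofHom j) := by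
  let q : Spec (.of K) ⟶ Spec (.of k) := Spec.map (CommRingCat.ofHom (algebraMap k K))
  have hq : IsIntegralHom q := by
    rw [IsIntegralHom.SpecMap_iff]
    exact algebraMap_isIntegral_iff.mpr inferInstance
  let f₁ : Spec (component F C).functionField ⟶ pullback (componentι F C ≫ s) q :=
    pullback.lift (genericPointIncl (component F C)) (Spec.map (CommRingCat.ofHom j)) (by
      rw [← Category.assoc]
      exact hj.trans (Spec.map_comp (CommRingCat.ofHom (algebraMap k K)) (CommRingCat.ofHom j)))
  have H : genericPointIncl (component F C) = f₁ ≫ pullback.fst (componentι F C ≫ s) q :=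
    (pullback.lift_fst ..).symm
  let d : normalization (component F C) ⟶ pullback (componentι F C ≫ s) q :=
    (genericPointIncl (component F C)).normalizationDesc f₁ _ H
  have hd : d ≫ pullback.fst (componentι F C ≫ s) q = normalizationMap (component F C) :=
    Scheme.Hom.normalizationDesc_comp ..
  have hd' : toNormalizationMap (component F C) ≫ d = f₁ :=
    Scheme.Hom.toNormalization_normalizationDesc ..
  have hs : (d ≫ pullback.snd (componentι F C ≫ s) q) ≫ q =
      normalizationMap (component F C) ≫ componentι F C ≫ s := by
    rw [Category.assoc, ← pullback.condition, ← hd, Category.assoc]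
  refine ⟨d ≫ pullback.snd _ _, ?_, hs, ?_⟩
  · have : IsSeparated ((d ≫ pullback.snd (componentι F C ≫ s) q) ≫ q) := by
      rw [hs]; infer_instance
    exact IsSeparated.of_comp _ q
  · rw [← Category.assoc, hd']
    exact pullback.lift_snd ..

/-- The gluing criterion: charts of `F` through the generic point whose integral closures in `L` are
the rings `K[S]` give toric charts of the normalization, with all embeddings taken inside `L`. -/
theorem isToricOver_of_charts (s : F ⟶ Spec (.of k)) [IsSeparated s]
    (C : irreducibleComponents F) {K : Type u} [Field K] [Algebra k K] [Algebra.IsIntegral k K]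
    (j : K →+* (component F C).functionField)
    (hj : genericMap F C ≫ s = Spec.map (CommRingCat.ofHom (j.comp (algebraMap k K))))
    {r : ℕ} (x : Multiplicative (Fin r → ℤ) →* (component F C).functionField)
    (hJ : Function.Injective (laurentHom j x))
    {I : Type*} [Finite I] [Nonempty I] (R : I → CommRingCat.{u}) (u : ∀ i, Spec (R i) ⟶ F)
    [∀ i, IsOpenImmersion (u i)] (e : ∀ i, R i ⟶ (component F C).functionField)
    (he : ∀ i, Spec.map (e i) ≫ u i = genericMap F C)
    (Q : I → AddSubmonoid (Fin r → ℤ)) (hfg : ∀ i, (Q i).FG)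
    (hgen : ∀ i, AddSubgroup.closure (Q i : Set (Fin r → ℤ)) = ⊤)
    (hint : ∀ i z, (e i).hom.IsIntegralElem z ↔ z ∈ ((laurentHom j x).comp
      (AddMonoidAlgebra.mapDomainRingHom K (dualMonoid (dualCone (Q i))).subtype)).range)
    (hface : ∀ i, ∀ a ∈ Q i, ∃ l, Q l = Q i ⊔ AddSubmonoid.closure {-a})
    (hinter : ∀ i j, ∃ l, Set.range (u l) = Set.range (u i) ∩ Set.range (u j) ∧ Q l = Q i ⊔ Q j)
    (hsep : ∀ i j, ∃ a ∈ Q i, Q i ⊔ Q j = Q i ⊔ AddSubmonoid.closure {-a})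
    (hcover : ∀ p ∈ C.1, ∃ i, p ∈ Set.range (u i)) :
    IsToricOver K (normalizationMap (component F C) ≫ componentι F C ≫ s) := by
  obtain ⟨str, hstr, hstr_comp, hstr_gen⟩ := exists_normalization_structure s C j hj
  have hXs : (normalization (component F C)).IsSeparated := by
    have h1 : IsSeparated (terminal.from (normalization (component F C))) := by
      rw [← terminal.comp_from str]
      infer_instance
    exact ⟨h1⟩
  let Δ : Fan r := fanOfMonoids (Set.range Q) (Set.finite_range Q) (Set.range_nonempty Q)
    (by rintro _ ⟨i, rfl⟩; exact hfg i) (by rintro _ ⟨i, rfl⟩; exact hgen i)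
    (by rintro _ ⟨i, rfl⟩ a ha; exact hface i a ha)
    (by rintro _ ⟨i, rfl⟩ _ ⟨j, rfl⟩; exact hsep i j)
  have hΔ : ∀ i, dualCone (Q i) ∈ Δ.cones := fun i => ⟨_, ⟨i, rfl⟩, rfl⟩
  have hΔ' : ∀ σ ∈ Δ.cones, ∃ i, dualCone (Q i) = σ := by
    rintro _ ⟨_, ⟨i, rfl⟩, rfl⟩; exact ⟨i, rfl⟩
  let δ (σ : PointedCone ℝ (Fin r → ℝ)) :
      CommRingCat.of (AddMonoidAlgebra K (dualMonoid σ)) ⟶ (component F C).functionField :=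
    CommRingCat.ofHom ((laurentHom j x).comp
      (AddMonoidAlgebra.mapDomainRingHom K (dualMonoid σ).subtype))
  have hδ : ∀ σ, Function.Injective (δ σ).hom := fun σ =>
    hJ.comp (mapDomainRingHom_injective Subtype.val_injective)
  have hex : ∀ σ : Δ.cones, ∃ c : specMonoid K (dualMonoid σ.1) ⟶ normalization (component F C),
      IsOpenImmersion c ∧ Spec.map (δ σ.1) ≫ c = toNormalizationMap (component F C) ∧
      ∀ i, dualCone (Q i) = σ.1 → Set.range c =
        (normalizationMap (component F C) ≫ componentι F C) ⁻¹' Set.range (u i) := by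
    rintro ⟨σ, hσ⟩
    obtain ⟨i, rfl⟩ := hΔ' σ hσ
    obtain ⟨c, hc, hc', hc''⟩ := exists_component_chart F C (u i) (he i) (hδ (dualCone (Q i)))
      (hint i)
    -- Different indices may give the same cone. Their charts agree at the generic point, hence
    -- coincide, so the chart depends on the cone only.
    refine ⟨c, hc, hc'', fun l hl => ?_⟩
    obtain ⟨d, -, hd', hd''⟩ := exists_component_chart F C (u l) (he l) (hδ (dualCone (Q i)))
      (fun z => by rw [hint l z, hl]; rfl)
    rw [← hd', Spec_hom_ext_of_injective _ (hδ (dualCone (Q i))) (hc''.trans hd''.symm)]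
  choose c hc hcgen hcrange using hex
  have hinc : ∀ {σ τ : PointedCone ℝ (Fin r → ℝ)} (h : τ ≤ σ),
      CommRingCat.ofHom (AddMonoidAlgebra.mapDomainRingHom K
        (AddSubmonoid.inclusion (dualMonoid_anti h))) ≫ δ τ = δ σ := by
    intro σ τ h
    ext1
    refine RingHom.ext fun p => ?_
    change laurentHom j x (AddMonoidAlgebra.mapDomainRingHom K (dualMonoid τ).subtype
      (AddMonoidAlgebra.mapDomainRingHom K (AddSubmonoid.inclusion (dualMonoid_anti h)) p)) =
      laurentHom j x (AddMonoidAlgebra.mapDomainRingHom K (dualMonoid σ).subtype p)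
    congr 1
    induction p using AddMonoidAlgebra.induction_linear with
    | zero => simp only [map_zero]
    | add p q hp hq => simp only [map_add, hp, hq]
    | single m c => simp only [mapDomainRingHom_single]; rfl
  let V : ToricVariety K :=
    { X := normalization (component F C)
      str := str
      isSeparated := hstr
      rank := r
      fan := Δ
      chart := c
      chart_isOpenImmersion := hc
      chart_str := by
        intro σ
        apply Spec_hom_ext_of_injective (δ σ.1) (hδ σ.1)
        rw [← Category.assoc, hcgen, hstr_gen, specMonoidStr, ← Spec.map_comp]
        congr 1
        ext1
        refine RingHom.ext fun a => ?_
        change j a = laurentHom j x (AddMonoidAlgebra.mapDomainRingHom K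
          (dualMonoid σ.1).subtype (AddMonoidAlgebra.single 0 a))
        rw [mapDomainRingHom_single, map_zero, laurentHom_single, ofAdd_zero, map_one, mul_one]
      chart_face := by
        intro σ τ h
        apply Spec_hom_ext_of_injective (δ τ.1) (hδ τ.1)
        rw [hcgen, specMonoidMap, ← Category.assoc, ← Spec.map_comp, hinc h, hcgen]
      chart_inter := by
        rintro ⟨σ, hσ⟩ ⟨τ, hτ⟩
        obtain ⟨a, rfl⟩ := hΔ' σ hσ
        obtain ⟨b, rfl⟩ := hΔ' τ hτ
        obtain ⟨l, hl, hl'⟩ := hinter a b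
        rw [hcrange _ a rfl, hcrange _ b rfl, hcrange _ l (by rw [hl', dualCone_sup]), hl,
          Set.preimage_inter]
      chart_cover := by
        refine Set.eq_univ_of_forall fun p => Set.mem_iUnion.mpr ?_
        obtain ⟨i, hi⟩ := hcover ((normalizationMap (component F C) ≫ componentι F C) p) (by
          rw [← range_componentι F C, Scheme.Hom.comp_apply]
          exact ⟨_, rfl⟩)
        exact ⟨⟨_, hΔ i⟩, by rw [hcrange _ i rfl]; exact hi⟩ }
  exact ⟨V, Iso.refl _, by rw [Iso.refl_hom, Category.id_comp]; exact hstr_comp.symm⟩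

end Recognition

/-! ### Field-valued points of toric varieties -/

section ToricPoints

open AddMonoidAlgebra

variable {k : Type u} [Field k] (V : ToricVariety k)

instance (σ : V.fan.cones) : IsOpenImmersion (V.chart σ) := V.chart_isOpenImmersion σ

instance : V.X.IsSeparated := by
  have := V.isSeparated
  have h1 : IsSeparated (terminal.from V.X) := by
    rw [← terminal.comp_from V.str]
    infer_instance
  exact ⟨h1⟩

/-- The chart of the face where `a` vanishes is the principal open subset of `U_σ` on which the
monomial of `a` is invertible. -/
theorem exists_face_chart (σ : V.fan.cones) {a : Fin V.rank → ℤ} (ha : a ∈ dualMonoid σ.1) :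
    ∃ τ : V.fan.cones, τ.1 ≤ σ.1 ∧
      dualMonoid τ.1 = dualMonoid σ.1 ⊔ AddSubmonoid.closure {-a} ∧
      ∀ q : specMonoid k (dualMonoid σ.1), V.chart σ q ∈ Set.range (V.chart τ) ↔
        single (⟨a, ha⟩ : dualMonoid σ.1) (1 : k) ∉ q.asIdeal := by
  obtain ⟨τ, hτ, hτσ, hd⟩ := V.fan.exists_face σ.2 ha
  refine ⟨⟨τ, hτ⟩, hτσ, hd, fun q => ?_⟩
  let ι := AddSubmonoid.inclusion (dualMonoid_anti hτσ)
  let a' : dualMonoid σ.1 := ⟨a, ha⟩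
  let _ := (mapDomainRingHom k ι).toAlgebra
  have hnega : -a ∈ dualMonoid τ := by
    rw [hd]
    exact AddSubmonoid.mem_sup_right (AddSubmonoid.subset_closure (Set.mem_singleton _))
  have hloc : IsLocalization.Away (single a' (1 : k)) (AddMonoidAlgebra k (dualMonoid τ)) := by
    refine isLocalization_mapDomainRingHom (ι := ι) (AddSubmonoid.inclusion_injective _) _ ?_ ?_
    · rintro _ ⟨N, rfl⟩
      refine ⟨N • a', by simp [single_pow], ?_⟩
      rw [map_nsmul]
      refine IsAddUnit.nsmul N ⟨⟨ι a', ⟨-a, hnega⟩, ?_, ?_⟩, rfl⟩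
      · exact Subtype.ext (add_neg_cancel a)
      · exact Subtype.ext (neg_add_cancel a)
    · rintro ⟨g, hg⟩
      rw [hd] at hg
      obtain ⟨m, hm, z, hz, rfl⟩ := AddSubmonoid.mem_sup.mp hg
      obtain ⟨N, rfl⟩ := AddSubmonoid.mem_closure_singleton.mp hz
      refine ⟨N • a', ⟨m, hm⟩, ⟨N, by simp [single_pow]⟩, Subtype.ext ?_⟩
      change m + N • -a + N • a = m
      simp
  have hrange := PrimeSpectrum.localization_away_comap_range
    (AddMonoidAlgebra k (dualMonoid τ)) (single a' (1 : k))
  have h1 : single a' (1 : k) ∉ q.asIdeal ↔ q ∈ Set.range (specMonoidMap k ι) := by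
    exact (Set.ext_iff.mp hrange q).symm
  rw [h1, ← V.chart_face σ ⟨τ, hτ⟩ hτσ, Scheme.Hom.comp_base, TopCat.coe_comp, Set.range_comp]
  exact (V.chart σ).injective.mem_set_image

variable {V} {L : Type u} [Field L]

/-- The chart `U_σ` contains the field-valued point `x`. -/
def IsChartAt (x : Spec (.of L) ⟶ V.X) (σ : V.fan.cones) : Prop :=
  Set.range x ⊆ Set.range (V.chart σ)

theorem isChartAt_iff {x : Spec (.of L) ⟶ V.X} {σ : V.fan.cones} (p : Spec (.of L)) :
    IsChartAt x σ ↔ x p ∈ Set.range (V.chart σ) := by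
  refine ⟨fun h => h ⟨p, rfl⟩, ?_⟩
  rintro h _ ⟨q, rfl⟩
  rwa [Subsingleton.elim q p]

theorem isChartAt_inf {x : Spec (.of L) ⟶ V.X} {σ τ : V.fan.cones} (hσ : IsChartAt x σ)
    (hτ : IsChartAt x τ) : IsChartAt x ⟨σ.1 ⊓ τ.1, V.fan.inf_mem σ τ⟩ := by
  intro p hp
  rw [← V.chart_inter]
  exact ⟨hσ hp, hτ hp⟩

/-- The cones whose charts contain `x` are finite in number and closed under intersection; the least
one belongs to the torus orbit of `x`. -/
theorem exists_minimal_isChartAt (x : Spec (.of L) ⟶ V.X) :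
    ∃ σ, IsChartAt x σ ∧ ∀ τ, IsChartAt x τ → σ.1 ≤ τ.1 := by
  obtain ⟨p⟩ : Nonempty (Spec (.of L)) := inferInstance
  have : Finite V.fan.cones := V.fan.finite
  have hne : {σ | IsChartAt x σ}.Nonempty := by
    have h := Set.mem_univ (x p)
    rw [← V.chart_cover] at h
    obtain ⟨σ, hσ⟩ := Set.mem_iUnion.mp h
    exact ⟨σ, (isChartAt_iff p).mpr hσ⟩
  obtain ⟨σ, hσ, hmin⟩ := Set.Finite.exists_minimalFor (fun σ : V.fan.cones => σ.1)
    {σ | IsChartAt x σ} (Set.toFinite _) hne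
  exact ⟨σ, hσ, fun τ hτ => (hmin (isChartAt_inf hσ hτ) inf_le_left).trans inf_le_right⟩

variable [Algebra k L]

/-- The morphism `Spec L ⟶ U_σ` given by an evaluation homomorphism `k[S_σ] → L`, followed by the
inclusion of the chart, is `x`. -/
def IsEval (x : Spec (.of L) ⟶ V.X) (σ : V.fan.cones)
    (ε : AddMonoidAlgebra k (dualMonoid σ.1) →ₐ[k] L) : Prop :=
  Spec.map (CommRingCat.ofHom ε.toRingHom) ≫ V.chart σ = x

theorem exists_isEval {x : Spec (.of L) ⟶ V.X}
    (hx : x ≫ V.str = Spec.map (CommRingCat.ofHom (algebraMap k L))) {σ : V.fan.cones}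
    (hσ : IsChartAt x σ) : ∃ ε, IsEval x σ ε := by
  obtain ⟨e, he⟩ := Spec.map_surjective (IsOpenImmersion.lift (V.chart σ) x hσ)
  have hfac : Spec.map e ≫ V.chart σ = x := by
    rw [he]
    exact IsOpenImmersion.lift_fac ..
  have hcomm : CommRingCat.ofHom (algebraMap k (AddMonoidAlgebra k (dualMonoid σ.1))) ≫ e =
      CommRingCat.ofHom (algebraMap k L) := by
    rw [← Spec.map_inj, Spec.map_comp, ← hx, ← hfac, Category.assoc, V.chart_str]
    rfl
  exact ⟨{ e.hom with commutes' := fun c => congrArg (fun f => f.hom c) hcomm }, hfac⟩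

theorem IsEval.isChartAt {x : Spec (.of L) ⟶ V.X} {σ : V.fan.cones} {ε} (h : IsEval x σ ε) :
    IsChartAt x σ := by
  rintro _ ⟨p, rfl⟩
  rw [← h, Scheme.Hom.comp_apply]
  exact ⟨_, rfl⟩

theorem IsEval.comp_inclusion {x : Spec (.of L) ⟶ V.X} {σ τ : V.fan.cones} {ε ε'}
    (h : IsEval x σ ε) (h' : IsEval x τ ε') (hle : τ.1 ≤ σ.1) (m : dualMonoid σ.1) (c : k) :
    ε (single m c) = ε' (single (AddSubmonoid.inclusion (dualMonoid_anti hle) m) c) := by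
  have h1 : CommRingCat.ofHom ε.toRingHom = CommRingCat.ofHom (mapDomainRingHom k
      (AddSubmonoid.inclusion (dualMonoid_anti hle))) ≫ CommRingCat.ofHom ε'.toRingHom := by
    rw [← Spec.map_inj, ← cancel_mono (V.chart σ), Spec.map_comp, Category.assoc]
    have h2 := V.chart_face σ τ hle
    rw [specMonoidMap] at h2
    rw [h2]
    exact h.trans h'.symm
  have h3 := congrArg (fun f => f.hom (single m c)) h1
  refine h3.trans ?_
  change ε' (mapDomainRingHom k _ (single m c)) = _
  rw [mapDomainRingHom_single]

theorem IsEval.isChartAt_iff_ne_zero {x : Spec (.of L) ⟶ V.X} {σ τ : V.fan.cones} {ε}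
    (h : IsEval x σ ε) {a : Fin V.rank → ℤ} (ha : a ∈ dualMonoid σ.1)
    (hτ : ∀ q : specMonoid k (dualMonoid σ.1), V.chart σ q ∈ Set.range (V.chart τ) ↔
        single (⟨a, ha⟩ : dualMonoid σ.1) (1 : k) ∉ q.asIdeal) :
    IsChartAt x τ ↔ ε (single ⟨a, ha⟩ 1) ≠ 0 := by
  obtain ⟨p⟩ : Nonempty (Spec (.of L)) := inferInstance
  rw [isChartAt_iff p, ← h, Scheme.Hom.comp_apply, hτ]
  have hp : p.asIdeal = ⊥ := by
    rw [Subsingleton.elim p (⊥ : PrimeSpectrum L)]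
    rfl
  change ¬ (ε.toRingHom (single ⟨a, ha⟩ 1) ∈ p.asIdeal) ↔ _
  rw [hp]
  rfl

variable (V L) in
/-- The group of characters that are regular and non-zero at a field-valued point of a toric
variety, together with their values. -/
structure PointChar (x : Spec (.of L) ⟶ V.X) where
  grp : AddSubgroup (Fin V.rank → ℤ)
  char : Multiplicative grp →* L
  minCone : V.fan.cones
  isChartAt_minCone : IsChartAt x minCone
  grp_le : ∀ m ∈ grp, m ∈ dualMonoid minCone.1
  minCone_le : ∀ σ, IsChartAt x σ → minCone.1 ≤ σ.1
  eval_of_mem : ∀ σ ε, IsEval x σ ε → ∀ (m : dualMonoid σ.1) (hm : m.1 ∈ grp),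
    ε (single m 1) = char (Multiplicative.ofAdd ⟨m.1, hm⟩)
  eval_of_notMem : ∀ σ ε, IsEval x σ ε → ∀ m : dualMonoid σ.1, m.1 ∉ grp → ε (single m 1) = 0

theorem nonempty_pointChar {x : Spec (.of L) ⟶ V.X}
    (hx : x ≫ V.str = Spec.map (CommRingCat.ofHom (algebraMap k L))) :
    Nonempty (PointChar V L x) := by
  obtain ⟨σ, hσ, hmin⟩ := exists_minimal_isChartAt x
  obtain ⟨ε, hε⟩ := exists_isEval hx hσ
  have hmul : ∀ m m' : dualMonoid σ.1,
      ε (single (m + m') 1) = ε (single m 1) * ε (single m' 1) := by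
    intro m m'
    rw [← map_mul, single_mul_single, one_mul]
  have hzero : ε (single 0 1) = 1 := map_one ε
  -- If the monomial of `m` does not vanish at `x`, then `x` lies in the face chart where it is
  -- invertible. By minimality of `σ` it is already invertible on `U_σ`.
  have hneg : ∀ m (hm : m ∈ dualMonoid σ.1), ε (single ⟨m, hm⟩ 1) ≠ 0 → -m ∈ dualMonoid σ.1 := by
    intro m hm h0
    obtain ⟨τ, hle, hd, hq⟩ := exists_face_chart V σ hm
    have hτ : IsChartAt x τ := (hε.isChartAt_iff_ne_zero hm hq).mpr h0
    refine dualMonoid_anti (hmin τ hτ) ?_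
    rw [hd]
    exact AddSubmonoid.mem_sup_right (AddSubmonoid.subset_closure (Set.mem_singleton _))
  let G : AddSubgroup (Fin V.rank → ℤ) :=
    { carrier := {m | ∃ hm : m ∈ dualMonoid σ.1, ε (single ⟨m, hm⟩ 1) ≠ 0}
      zero_mem' := ⟨zero_mem _, by erw [hzero]; exact one_ne_zero⟩
      add_mem' := by
        rintro a b ⟨ha, ha'⟩ ⟨hb, hb'⟩
        refine ⟨add_mem ha hb, ?_⟩
        have := hmul ⟨a, ha⟩ ⟨b, hb⟩
        exact this ▸ mul_ne_zero ha' hb'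
      neg_mem' := by
        rintro a ⟨ha, ha'⟩
        refine ⟨hneg a ha ha', fun h0 => ?_⟩
        have h1 := hmul ⟨a, ha⟩ ⟨-a, hneg a ha ha'⟩
        rw [h0, mul_zero] at h1
        have h2 : (⟨a, ha⟩ + ⟨-a, hneg a ha ha'⟩ : dualMonoid σ.1) = 0 :=
          Subtype.ext (add_neg_cancel a)
        rw [h2, hzero] at h1
        exact one_ne_zero h1 }
  refine ⟨{
    grp := G
    char :=
      { toFun := fun m => ε (single ⟨m.toAdd.1, m.toAdd.2.1⟩ 1)
        map_one' := hzero
        map_mul' := fun m m' => hmul ⟨m.toAdd.1, m.toAdd.2.1⟩ ⟨m'.toAdd.1, m'.toAdd.2.1⟩ }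
    minCone := σ
    isChartAt_minCone := hσ
    grp_le := fun m hm => hm.1
    minCone_le := hmin
    eval_of_mem := fun τ ε' hε' m hm => hε'.comp_inclusion hε (hmin τ hε'.isChartAt) m 1
    eval_of_notMem := ?_ }⟩
  intro τ ε' hε' m hm
  rw [hε'.comp_inclusion hε (hmin τ hε'.isChartAt) m 1]
  by_contra h0
  exact hm ⟨dualMonoid_anti (hmin τ hε'.isChartAt) m.2, h0⟩

namespace PointChar

variable {x : Spec (.of L) ⟶ V.X} (P : PointChar V L x)

theorem char_ne_zero (m : Multiplicative P.grp) : P.char m ≠ 0 :=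
  ((Group.isUnit m).map P.char).ne_zero

/-- The monoid of characters in the chart `U_σ` that do not vanish at `x`. -/
def monoid (σ : V.fan.cones) : AddSubmonoid P.grp :=
  (dualMonoid σ.1).comap P.grp.subtype

theorem monoid_minCone : P.monoid P.minCone = ⊤ :=
  top_le_iff.mp fun m _ => P.grp_le m.1 m.2

theorem mem_grp_of_add_mem {σ : V.fan.cones} {ε} (hε : IsEval x σ ε) {m m' : Fin V.rank → ℤ}
    (hm : m ∈ dualMonoid σ.1) (hm' : m' ∈ dualMonoid σ.1) (h : m + m' ∈ P.grp) : m ∈ P.grp := by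
  by_contra h0
  have h1 := P.eval_of_mem σ ε hε (⟨m, hm⟩ + ⟨m', hm'⟩) h
  have h2 := P.eval_of_notMem σ ε hε ⟨m, hm⟩ h0
  rw [← one_mul (1 : k), ← single_mul_single, map_mul, h2, zero_mul] at h1
  exact P.char_ne_zero _ h1.symm

end PointChar

/-- A sum of generators lies in the face only if every summand does, so the generators lying in `F`
generate it. -/
theorem fg_of_face {M : Type*} [AddCommMonoid M] {S F : AddSubmonoid M} (hS : S.FG) (hFS : F ≤ S)
    (hF : ∀ a ∈ S, ∀ b ∈ S, a + b ∈ F → a ∈ F) : F.FG := by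
  obtain ⟨s, rfl⟩ := hS
  classical
  refine ⟨s.filter (· ∈ F), le_antisymm ?_ ?_⟩
  · rw [AddSubmonoid.closure_le]
    intro a ha
    exact (Finset.mem_filter.mp ha).2
  · have key : ∀ a ∈ AddSubmonoid.closure (s : Set M), a ∈ F →
        a ∈ AddSubmonoid.closure ((s.filter (· ∈ F) : Finset M) : Set M) := by
      intro a ha
      induction ha using AddSubmonoid.closure_induction with
      | mem a ha => exact fun h => AddSubmonoid.subset_closure (Finset.mem_filter.mpr ⟨ha, h⟩)
      | zero => exact fun _ => zero_mem _
      | add a b ha hb iha ihb =>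
        exact fun h => add_mem (iha (hF a ha b hb h)) (ihb (hF b hb a ha (by rwa [add_comm])))
    exact fun a ha => key a (hFS ha) ha

theorem fg_comap_subtype_of_face {M : Type*} [AddCommGroup M] {S : AddSubmonoid M}
    {G : AddSubgroup M} (hS : S.FG) (hG : ∀ a ∈ S, ∀ b ∈ S, a + b ∈ G → a ∈ G) :
    (S.comap G.subtype).FG := by
  refine AddSubmonoid.FG.map_injective G.subtype Subtype.val_injective
    (fg_of_face hS ?_ fun a ha b hb h => ?_)
  · rintro _ ⟨m, hm, rfl⟩
    exact hm
  · obtain ⟨m, -, hm⟩ := h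
    exact ⟨⟨a, hG a ha b hb (hm ▸ m.2)⟩, ha, rfl⟩

theorem comap_subtype_sup_neg {M : Type*} [AddCommGroup M] {S : AddSubmonoid M} {G : AddSubgroup M}
    (a : G) : (S ⊔ AddSubmonoid.closure {-a.1}).comap G.subtype =
      S.comap G.subtype ⊔ AddSubmonoid.closure {-a} := by
  refine le_antisymm ?_ (sup_le (AddSubmonoid.monotone_comap le_sup_left) ?_)
  · rintro m hm
    obtain ⟨s, hs, z, hz, h⟩ := AddSubmonoid.mem_sup.mp hm
    obtain ⟨N, rfl⟩ := AddSubmonoid.mem_closure_singleton.mp hz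
    have h1 : s = (m + N • a).1 := by
      change s + N • -a.1 = m.1 at h
      change s = m.1 + N • a.1
      rw [← h]
      simp
    refine AddSubmonoid.mem_sup.mpr ⟨m + N • a, ?_, N • -a,
      AddSubmonoid.mem_closure_singleton.mpr ⟨N, rfl⟩, by simp⟩
    change (m + N • a).1 ∈ S
    exact h1 ▸ hs
  · rw [AddSubmonoid.closure_le, Set.singleton_subset_iff]
    exact AddSubmonoid.mem_sup_right (AddSubmonoid.subset_closure (Set.mem_singleton _))

/-! ### The monoids of non-vanishing characters on the charts through a point. -/

namespace PointChar

variable {x : Spec (.of L) ⟶ V.X} (P : PointChar V L x)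
  (hx : x ≫ V.str = Spec.map (CommRingCat.ofHom (algebraMap k L)))

include hx

theorem fg_monoid {σ : V.fan.cones} (hσ : IsChartAt x σ) : (P.monoid σ).FG := by
  obtain ⟨ε, hε⟩ := exists_isEval hx hσ
  exact fg_comap_subtype_of_face (V.fan.fg_dualMonoid σ.2) fun a ha b hb h =>
    P.mem_grp_of_add_mem hε ha hb h

theorem exists_face {σ : V.fan.cones} (hσ : IsChartAt x σ) {a : P.grp} (ha : a ∈ P.monoid σ) :
    ∃ τ, IsChartAt x τ ∧ τ.1 ≤ σ.1 ∧ P.monoid τ = P.monoid σ ⊔ AddSubmonoid.closure {-a} := by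
  obtain ⟨ε, hε⟩ := exists_isEval hx hσ
  obtain ⟨τ, hle, hd, hq⟩ := exists_face_chart V σ ha
  refine ⟨τ, (hε.isChartAt_iff_ne_zero ha hq).mpr ?_, hle, ?_⟩
  · rw [P.eval_of_mem σ ε hε _ a.2]
    exact P.char_ne_zero _
  · rw [monoid, hd]
    exact comap_subtype_sup_neg a

theorem mem_grp_of_neg_mem {σ : V.fan.cones} (hσ : IsChartAt x σ) {a : Fin V.rank → ℤ}
    (ha : a ∈ dualMonoid σ.1) (ha' : -a ∈ dualMonoid σ.1) : a ∈ P.grp := by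
  obtain ⟨ε, hε⟩ := exists_isEval hx hσ
  exact P.mem_grp_of_add_mem hε ha ha' (by rw [add_neg_cancel]; exact zero_mem _)

theorem exists_separating {σ τ : V.fan.cones} (hσ : IsChartAt x σ) (hτ : IsChartAt x τ) :
    ∃ a ∈ P.monoid σ, -a ∈ P.monoid τ ∧ P.monoid ⟨σ.1 ⊓ τ.1, V.fan.inf_mem σ τ⟩ =
      P.monoid σ ⊔ AddSubmonoid.closure {-a} := by
  obtain ⟨a, ha, ha', hd⟩ := V.fan.exists_separating σ.2 τ.2
  have haG : a ∈ P.grp := P.mem_grp_of_neg_mem hx (isChartAt_inf hσ hτ)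
    (dualMonoid_anti inf_le_left ha) (dualMonoid_anti inf_le_right ha')
  refine ⟨⟨a, haG⟩, ha, ha', ?_⟩
  rw [monoid, hd]
  exact comap_subtype_sup_neg ⟨a, haG⟩

/-- On the minimal chart the monoid is the whole group, and it is reached from that of `σ` by
inverting a single element. -/
theorem closure_monoid {σ : V.fan.cones} (hσ : IsChartAt x σ) :
    AddSubgroup.closure (P.monoid σ : Set P.grp) = ⊤ := by
  rw [← top_le_iff]
  rintro m -
  obtain ⟨a, ha, -, hd⟩ := P.exists_separating hx hσ P.isChartAt_minCone
  have h1 : P.monoid ⟨σ.1 ⊓ P.minCone.1, V.fan.inf_mem σ P.minCone⟩ = ⊤ := by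
    rw [← top_le_iff, ← P.monoid_minCone]
    exact AddSubmonoid.monotone_comap (dualMonoid_anti inf_le_right)
  have hm : m ∈ P.monoid σ ⊔ AddSubmonoid.closure {-a} := by
    rw [← hd, h1]
    exact AddSubmonoid.mem_top m
  obtain ⟨s, hs, z, hz, rfl⟩ := AddSubmonoid.mem_sup.mp hm
  obtain ⟨N, rfl⟩ := AddSubmonoid.mem_closure_singleton.mp hz
  exact add_mem (AddSubgroup.subset_closure hs)
    (nsmul_mem (neg_mem (AddSubgroup.subset_closure ha)) N)

theorem monoid_inf {σ τ : V.fan.cones} (hσ : IsChartAt x σ) (hτ : IsChartAt x τ) :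
    P.monoid ⟨σ.1 ⊓ τ.1, V.fan.inf_mem σ τ⟩ = P.monoid σ ⊔ P.monoid τ := by
  refine le_antisymm ?_ (sup_le ?_ ?_)
  · obtain ⟨a, ha, ha', hd⟩ := P.exists_separating hx hσ hτ
    rw [hd]
    refine sup_le_sup_left ?_ _
    rwa [AddSubmonoid.closure_le, Set.singleton_subset_iff]
  · exact AddSubmonoid.monotone_comap (dualMonoid_anti inf_le_left)
  · exact AddSubmonoid.monotone_comap (dualMonoid_anti inf_le_right)

end PointChar

end ToricPoints

/-! ### Toric morphisms in charts -/

section ToricMorphisms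

open AddMonoidAlgebra

section FaceHom

variable (k : Type*) [Field k] {M A : Type*} [AddCommGroup M] [AddCommGroup A]
  (S : AddSubmonoid M) (G : AddSubgroup M) (hG : ∀ a ∈ S, ∀ b ∈ S, a + b ∈ G → a ∈ G)
  (α : G →+ A)

open Classical in
/-- The homomorphism `k[S] → k[A]` that is given by `α` on the face `S ∩ G` and kills the other
monomials. -/
def faceHom : AddMonoidAlgebra k S →ₐ[k] AddMonoidAlgebra k A :=
  AddMonoidAlgebra.lift k _ S
    { toFun := fun m => if h : m.toAdd.1 ∈ G then single (α ⟨m.toAdd.1, h⟩) 1 else 0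
      map_one' := by
        rw [dif_pos (show ((1 : Multiplicative S).toAdd : S).1 ∈ G from zero_mem G)]
        exact congrArg (fun a => single a (1 : k)) (map_zero α)
      map_mul' := by
        intro a b
        have h0 : ((a * b).toAdd : S).1 = a.toAdd.1 + b.toAdd.1 := rfl
        by_cases ha : a.toAdd.1 ∈ G
        · by_cases hb : b.toAdd.1 ∈ G
          · rw [dif_pos ha, dif_pos hb, dif_pos (h0 ▸ add_mem ha hb), single_mul_single, one_mul,
              ← map_add]
            rfl
          · rw [dif_neg hb, mul_zero, dif_neg]
            exact fun h => hb (hG _ b.toAdd.2 _ a.toAdd.2 (by rw [add_comm]; exact h))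
        · rw [dif_neg ha, zero_mul, dif_neg]
          exact fun h => ha (hG _ a.toAdd.2 _ b.toAdd.2 h) }

theorem faceHom_single_of_mem (m : S) (hm : m.1 ∈ G) (c : k) :
    faceHom k S G hG α (single m c) = single (α ⟨m.1, hm⟩) c := by
  classical
  rw [faceHom, lift_single]
  change c • (if h : m.1 ∈ G then single (α ⟨m.1, h⟩) 1 else 0) = _
  rw [dif_pos hm, smul_single, smul_eq_mul, mul_one]

theorem faceHom_single_of_notMem (m : S) (hm : m.1 ∉ G) (c : k) :
    faceHom k S G hG α (single m c) = 0 := by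
  classical
  rw [faceHom, lift_single]
  change c • (if h : m.1 ∈ G then single (α ⟨m.1, h⟩) 1 else 0) = _
  rw [dif_neg hm, smul_zero]

variable {k S G α}

theorem exists_mem_support_of_faceHom_ne_zero {f : AddMonoidAlgebra k S}
    (hf : faceHom k S G hG α f ≠ 0) : ∃ m ∈ f.coeff.support, m.1 ∈ G := by
  classical
  by_contra! h
  refine hf ?_
  rw [faceHom, lift_apply]
  refine Finset.sum_eq_zero fun m hm => ?_
  change f.coeff m • (if h : m.1 ∈ G then single (α ⟨m.1, h⟩) 1 else 0) = _
  rw [dif_neg (h m hm), smul_zero]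

end FaceHom

/-- The units of a submonoid of a group. -/
def unitGroup {M : Type*} [AddCommGroup M] (S : AddSubmonoid M) : AddSubgroup M where
  carrier := {m | m ∈ S ∧ -m ∈ S}
  zero_mem' := ⟨zero_mem _, by rw [neg_zero]; exact zero_mem _⟩
  add_mem' := fun ha hb => ⟨add_mem ha.1 hb.1, by rw [neg_add]; exact add_mem ha.2 hb.2⟩
  neg_mem' := fun ha => ⟨ha.2, by rw [neg_neg]; exact ha.1⟩

theorem mem_unitGroup_of_add_mem {M : Type*} [AddCommGroup M] {S : AddSubmonoid M} (a : M)
    (ha : a ∈ S) (b : M) (hb : b ∈ S) (h : a + b ∈ unitGroup S) : a ∈ unitGroup S := by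
  refine ⟨ha, ?_⟩
  have h1 := add_mem h.2 hb
  rwa [neg_add, neg_add_cancel_right] at h1

/-- If `x^m s` is supported in `S` and the support of `s` contains a unit of `S`, then `m ∈ S`. -/
theorem mem_of_single_mul {k M : Type*} [Field k] [AddCommGroup M] {S : AddSubmonoid M} {m : M}
    {s t : AddMonoidAlgebra k S}
    (h : single m 1 * mapDomainRingHom k S.subtype s = mapDomainRingHom k S.subtype t) {v : S}
    (hv : v ∈ s.coeff.support) (hv' : v.1 ∈ unitGroup S) : m ∈ S := by
  have h1 : (mapDomainRingHom k S.subtype t).coeff (m + v.1) ≠ 0 := by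
    rw [← h, AddMonoidAlgebra.coeff_single_mul_apply, one_mul, neg_add_cancel_left]
    have h2 : (mapDomainRingHom k S.subtype s).coeff v.1 = s.coeff v :=
      Finsupp.mapDomain_apply Subtype.val_injective _ _
    rw [h2]
    exact Finsupp.mem_support_iff.mp hv
  have h2 : m + v.1 ∈ Set.range S.subtype := by
    by_contra h0
    exact h1 (Finsupp.mapDomain_of_notMem_range _ _ h0)
  obtain ⟨w, hw⟩ := h2
  have h3 := add_mem w.2 hv'.2
  rwa [show w.1 = m + v.1 from hw, add_neg_cancel_right] at h3

/-- The homomorphism `P → Q` of submonoids induced by a homomorphism `φ` that maps `P` to `Q`. -/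
def restrictHom {M N : Type*} [AddCommGroup M] [AddCommGroup N] (φ : N →+ M) {P : AddSubmonoid N}
    {Q : AddSubmonoid M} (h : P ≤ Q.comap φ) : P →+ Q :=
  (φ.comp P.subtype).codRestrict Q fun m => h m.2

theorem mapDomainRingHom_comp_apply {k P Q N : Type*} [Semiring k] [AddMonoid P] [AddMonoid Q]
    [AddMonoid N] {a : P →+ Q} {b : Q →+ N} {c : P →+ N} (h : ∀ p, b (a p) = c p)
    (f : AddMonoidAlgebra k P) :
    mapDomainRingHom k b (mapDomainRingHom k a f) = mapDomainRingHom k c f := by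
  induction f using AddMonoidAlgebra.induction_linear with
  | zero => simp only [map_zero]
  | add p q hp hq => simp only [map_add, hp, hq]
  | single m r => simp only [mapDomainRingHom_single, h]

theorem specMonoidMap_comp {k : Type u} [Field k] {P Q N : Type} [AddCommMonoid P]
    [AddCommMonoid Q] [AddCommMonoid N] {a : P →+ Q} {b : Q →+ N} {c : P →+ N}
    (h : ∀ p, b (a p) = c p) : specMonoidMap k b ≫ specMonoidMap k a = specMonoidMap k c := by
  rw [specMonoidMap, specMonoidMap, ← Spec.map_comp]
  congr 1
  ext1
  exact RingHom.ext fun f => mapDomainRingHom_comp_apply h f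

/-! ### Toric morphisms map charts into charts. -/

variable {k : Type u} [Field k] {V W : ToricVariety k}

theorem subtype_comp_chart (σ : V.fan.cones) :
    specMonoidMap k (dualMonoid σ.1).subtype ≫ V.chart σ = V.torusIncl := by
  rw [ToricVariety.torusIncl, ← V.chart_face σ ⟨⊥, V.fan.bot_mem⟩ bot_le, ← Category.assoc]
  congr 1
  exact (specMonoidMap_comp fun _ => rfl).symm

/-- Both sides agree on the dense torus. -/
theorem chart_comp_hom (f : V.X ⟶ W.X) {φ : (Fin W.rank → ℤ) →+ (Fin V.rank → ℤ)}
    (hφ : V.torusIncl ≫ f = specMonoidMap k φ ≫ W.torusIncl) {σ : V.fan.cones} {ρ : W.fan.cones}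
    (h : dualMonoid ρ.1 ≤ (dualMonoid σ.1).comap φ) :
    V.chart σ ≫ f = specMonoidMap k (restrictHom φ h) ≫ W.chart ρ := by
  refine Spec_hom_ext_of_injective (L := .of (AddMonoidAlgebra k (Fin V.rank → ℤ)))
    (CommRingCat.ofHom (mapDomainRingHom k (dualMonoid σ.1).subtype))
    (mapDomainRingHom_injective Subtype.val_injective) ?_
  change specMonoidMap k (dualMonoid σ.1).subtype ≫ _ = specMonoidMap k (dualMonoid σ.1).subtype ≫ _
  have h1 : specMonoidMap k φ ≫ specMonoidMap k (dualMonoid ρ.1).subtype =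
      specMonoidMap k (dualMonoid σ.1).subtype ≫ specMonoidMap k (restrictHom φ h) := by
    rw [specMonoidMap_comp (c := φ.comp (dualMonoid ρ.1).subtype) fun _ => rfl]
    exact (specMonoidMap_comp fun _ => rfl).symm
  rw [← Category.assoc, subtype_comp_chart, hφ, ← subtype_comp_chart ρ, reassoc_of% h1]

/-- Every point of the local scheme at `𝔭` specializes to `𝔭`, so an open chart that contains the
image of `𝔭` contains the image of the whole local scheme. -/
theorem exists_chart_specialization (f : V.X ⟶ W.X) (σ : V.fan.cones) {𝔭 : Ideal
    (AddMonoidAlgebra k (dualMonoid σ.1))} [h𝔭 : 𝔭.IsPrime] : ∃ (ρ : W.fan.cones)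
    (a : AddMonoidAlgebra k (dualMonoid ρ.1) →+* Localization.AtPrime 𝔭),
    Spec.map (CommRingCat.ofHom a) ≫ W.chart ρ =
      Spec.map (CommRingCat.ofHom (algebraMap _ (Localization.AtPrime 𝔭))) ≫ V.chart σ ≫ f := by
  let p : specMonoid k (dualMonoid σ.1) := ⟨𝔭, h𝔭⟩
  let l : Spec (.of (Localization.AtPrime 𝔭)) ⟶ specMonoid k (dualMonoid σ.1) :=
    Spec.map (CommRingCat.ofHom (algebraMap _ (Localization.AtPrime 𝔭)))
  obtain ⟨ρ, hρ⟩ : ∃ ρ, (V.chart σ ≫ f) p ∈ Set.range (W.chart ρ) := by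
    have h := Set.mem_univ ((V.chart σ ≫ f) p)
    rw [← W.chart_cover] at h
    exact Set.mem_iUnion.mp h
  have hle : Set.range (l ≫ V.chart σ ≫ f) ⊆ Set.range (W.chart ρ) := by
    rintro _ ⟨q, rfl⟩
    rw [Scheme.Hom.comp_apply]
    have hq : l q ∈ {q : PrimeSpectrum (AddMonoidAlgebra k (dualMonoid σ.1)) |
        Disjoint (𝔭.primeCompl : Set (AddMonoidAlgebra k (dualMonoid σ.1)))
          (q.asIdeal : Set (AddMonoidAlgebra k (dualMonoid σ.1)))} := by
      rw [← PrimeSpectrum.localization_comap_range (Localization.AtPrime 𝔭) 𝔭.primeCompl]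
      exact ⟨q, rfl⟩
    have hqp : (l q).asIdeal ≤ 𝔭 := by
      intro z hz
      by_contra h0
      exact Set.disjoint_left.mp hq h0 hz
    have hs : (l q) ⤳ p := (PrimeSpectrum.le_iff_specializes (l q) p).mp hqp
    exact (hs.map (V.chart σ ≫ f).continuous).mem_open (W.chart ρ).opensRange.isOpen hρ
  obtain ⟨a, ha⟩ := Spec.map_surjective (IsOpenImmersion.lift (W.chart ρ) _ hle)
  refine ⟨ρ, a.hom, ?_⟩
  have : Spec.map a ≫ W.chart ρ = l ≫ V.chart σ ≫ f := by rw [ha, IsOpenImmersion.lift_fac]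
  exact this

/-- A chart of the target containing the image of the generic point of the closed orbit of `U_σ`
receives all of `U_σ`. Functions on it pull back to the local ring at that point, and a monomial in
this local ring is already regular on `U_σ`. -/
theorem exists_dualMonoid_le_comap (f : V.X ⟶ W.X) {φ : (Fin W.rank → ℤ) →+ (Fin V.rank → ℤ)}
    (hφ : V.torusIncl ≫ f = specMonoidMap k φ ≫ W.torusIncl) (σ : V.fan.cones) :
    ∃ ρ : W.fan.cones, dualMonoid ρ.1 ≤ (dualMonoid σ.1).comap φ := by
  let S := dualMonoid σ.1
  let ev := faceHom k S (unitGroup S) mem_unitGroup_of_add_mem (unitGroup S).subtype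
  -- The prime spanned by the non-invertible monomials of `k[S]`, i.e. the generic point of the
  -- closed orbit.
  let 𝔭 : Ideal (AddMonoidAlgebra k S) := RingHom.ker ev
  have h𝔭 : 𝔭.IsPrime := RingHom.ker_isPrime ev
  obtain ⟨ρ, a, ha⟩ := exists_chart_specialization f σ (𝔭 := 𝔭)
  let Ω := FractionRing (AddMonoidAlgebra k (Fin V.rank → ℤ))
  let j : AddMonoidAlgebra k (Fin V.rank → ℤ) →+* Ω := algebraMap _ _
  have hj : Function.Injective j := IsFractionRing.injective _ _
  have hS : Function.Injective (mapDomainRingHom k S.subtype) :=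
    mapDomainRingHom_injective Subtype.val_injective
  have hjS : Function.Injective (j.comp (mapDomainRingHom k S.subtype)) := hj.comp hS
  have hunit : ∀ y : 𝔭.primeCompl, IsUnit ((j.comp (mapDomainRingHom k S.subtype)) y) := by
    intro y
    rw [isUnit_iff_ne_zero, map_ne_zero_iff _ hjS]
    exact fun h0 => y.2 (h0 ▸ zero_mem 𝔭)
  let g : Localization.AtPrime 𝔭 →+* Ω := IsLocalization.lift hunit
  have hg : ∀ z, g (algebraMap _ _ z) = j (mapDomainRingHom k S.subtype z) :=
    IsLocalization.lift_eq hunit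
  have key : CommRingCat.ofHom (g.comp a) = CommRingCat.ofHom
      (j.comp ((mapDomainRingHom k φ).comp (mapDomainRingHom k (dualMonoid ρ.1).subtype))) := by
    rw [← Spec.map_inj, ← cancel_mono (W.chart ρ)]
    have h1 : Spec.map (CommRingCat.ofHom (g.comp a)) ≫ W.chart ρ =
        Spec.map (CommRingCat.ofHom j) ≫ V.torusIncl ≫ f := by
      have h2 : Spec.map (CommRingCat.ofHom g) ≫
          Spec.map (CommRingCat.ofHom (algebraMap _ (Localization.AtPrime 𝔭))) =
            Spec.map (CommRingCat.ofHom j) ≫ specMonoidMap k S.subtype := by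
        rw [specMonoidMap, ← Spec.map_comp, ← Spec.map_comp]
        congr 1
        ext1
        exact RingHom.ext hg
      rw [CommRingCat.ofHom_comp, Spec.map_comp, Category.assoc, ha, reassoc_of% h2,
        ← subtype_comp_chart σ, Category.assoc]
    rw [h1, hφ, ← subtype_comp_chart ρ, specMonoidMap, specMonoidMap, ← Category.assoc,
      ← Category.assoc, ← Spec.map_comp, ← Spec.map_comp]
    rfl
  have hmem : dualMonoid ρ.1 ≤ S.comap φ := by
    intro m hm
    -- The monomial of `φ m` equals `t / s` with `s ∉ 𝔭`, so `s` has an invertible monomial in its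
    -- support. Comparing supports gives `φ m ∈ S`.
    obtain ⟨⟨t, s⟩, hts⟩ := IsLocalization.surj 𝔭.primeCompl (a (single ⟨m, hm⟩ 1))
    have h1 := congrArg g hts
    have h2 : g (a (single ⟨m, hm⟩ 1)) = j (single (φ m) 1) := by
      refine (congrArg (fun f => f.hom (single (⟨m, hm⟩ : dualMonoid ρ.1) (1 : k))) key).trans ?_
      change j (mapDomainRingHom k φ (mapDomainRingHom k _ _)) = _
      rw [mapDomainRingHom_single, mapDomainRingHom_single]
      rfl
    rw [map_mul, h2, hg, hg, ← map_mul] at h1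
    have hs : ev s.1 ≠ 0 := s.2
    obtain ⟨v, hv, hv'⟩ := exists_mem_support_of_faceHom_ne_zero _ hs
    have h3 : φ m ∈ S := mem_of_single_mul (hj h1) hv hv'
    exact h3
  exact ⟨ρ, hmem⟩

end ToricMorphisms

/-! ### Charts of fiber products -/

section FiberProductCharts

open AddMonoidAlgebra

theorem exists_isPushout_of_ringHom {A B C : CommRingCat.{u}} (a : A ⟶ B) (b : A ⟶ C) :
    ∃ (R : CommRingCat.{u}) (i₁ : B ⟶ R) (i₂ : C ⟶ R), IsPushout a b i₁ i₂ ∧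
      ∀ S : Subring R, i₁.hom.range ≤ S → i₂.hom.range ≤ S → S = ⊤ := by
  let _ := a.hom.toAlgebra
  let _ := b.hom.toAlgebra
  refine ⟨_, _, _, CommRingCat.isPushout_tensorProduct A B C, fun S h₁ h₂ => ?_⟩
  rw [← top_le_iff]
  rintro z -
  change TensorProduct A B C at z
  induction z using TensorProduct.induction_on with
  | zero => exact zero_mem S
  | add x y hx hy => exact add_mem hx hy
  | tmul x y =>
    have h : (x ⊗ₜ[A] y : TensorProduct A B C) = (x ⊗ₜ 1) * (1 ⊗ₜ y) := by
      rw [Algebra.TensorProduct.tmul_mul_tmul, mul_one, one_mul]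
    exact h ▸ mul_mem (h₁ ⟨x, rfl⟩) (h₂ ⟨y, rfl⟩)

theorem exists_pullback_chart {X Y B : Scheme.{u}} (f : X ⟶ B) (g : Y ⟶ B)
    {S T P : CommRingCat.{u}} (c : Spec S ⟶ X) (d : Spec T ⟶ Y) (b : Spec P ⟶ B)
    [IsOpenImmersion c] [IsOpenImmersion d] [IsOpenImmersion b] (p : P ⟶ S) (q : P ⟶ T)
    (hp : c ≫ f = Spec.map p ≫ b) (hq : d ≫ g = Spec.map q ≫ b) :
    ∃ (R : CommRingCat.{u}) (i₁ : S ⟶ R) (i₂ : T ⟶ R) (u : Spec R ⟶ pullback f g),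
      IsPushout p q i₁ i₂ ∧ (∀ A : Subring R, i₁.hom.range ≤ A → i₂.hom.range ≤ A → A = ⊤) ∧
      IsOpenImmersion u ∧ u ≫ pullback.fst f g = Spec.map i₁ ≫ c ∧
      u ≫ pullback.snd f g = Spec.map i₂ ≫ d ∧
      Set.range u = pullback.fst f g ⁻¹' Set.range c ∩ pullback.snd f g ⁻¹' Set.range d := by
  obtain ⟨R, i₁, i₂, hpo, hgen⟩ := exists_isPushout_of_ringHom p q
  have hpb := isPullback_SpecMap_of_isPushout _ _ _ _ hpo
  let m := pullback.map (Spec.map p) (Spec.map q) f g c d b hp.symm hq.symm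
  refine ⟨R, i₁, i₂, hpb.isoPullback.hom ≫ m, hpo, hgen, inferInstance, ?_, ?_, ?_⟩
  · rw [Category.assoc, pullback.lift_fst, hpb.isoPullback_hom_fst_assoc]
  · rw [Category.assoc, pullback.lift_snd, hpb.isoPullback_hom_snd_assoc]
  · have hs : Function.Surjective hpb.isoPullback.hom :=
      hpb.isoPullback.hom.homeomorph.surjective
    rw [Scheme.Hom.comp_base, TopCat.coe_comp, Set.range_comp, hs.range_eq, Set.image_univ]
    exact Scheme.Pullback.range_map ..

theorem closure_genericMap (F : Scheme.{u}) (C : irreducibleComponents F)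
    (p : Spec (component F C).functionField) : closure {genericMap F C p} = C.1 := by
  have h1 : genericPointIncl (component F C) p = genericPoint (component F C) := by
    rw [show p = IsLocalRing.closedPoint (component F C).functionField from
      Subsingleton.elim (α := PrimeSpectrum (component F C).functionField) _ _]
    exact Scheme.fromSpecStalk_closedPoint
  have h2 := (componentι F C).isClosedEmbedding.isClosedMap.closure_image_eq_of_continuous
    (componentι F C).continuous {genericPoint (component F C)}
  rw [genericMap, Scheme.Hom.comp_apply, h1, ← Set.image_singleton, h2,
    (genericPoint_spec (component F C)).def, Set.image_univ, range_componentι]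

/-- A smaller prime is a point specializing to the generic point of `C`. Its closure is irreducible
and contains `C`, so it equals `C`, and the two points coincide. -/
theorem ker_le_of_le_ker (F : Scheme.{u}) (C : irreducibleComponents F) {R : CommRingCat.{u}}
    (u : Spec R ⟶ F) [IsOpenImmersion u] {e : R ⟶ (component F C).functionField}
    (he : Spec.map e ≫ u = genericMap F C) {P : Ideal R} (hP : P.IsPrime)
    (hle : P ≤ RingHom.ker e.hom) : RingHom.ker e.hom ≤ P := by
  let o : Spec (component F C).functionField := (⊥ : PrimeSpectrum (component F C).functionField)
  have ho : (Spec.map e o).asIdeal = RingHom.ker e.hom := rfl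
  let p : Spec R := ⟨P, hP⟩
  have hs : p ⤳ Spec.map e o := (PrimeSpectrum.le_iff_specializes p (Spec.map e o)).mp hle
  have hu : u (Spec.map e o) = genericMap F C o := by rw [← he, Scheme.Hom.comp_apply]
  have hs' : u p ⤳ genericMap F C o := hu ▸ hs.map u.continuous
  have hC := closure_genericMap F C o
  have h1 : C.1 ⊆ closure {u p} := hC ▸ specializes_iff_closure_subset.mp hs'
  have h2 : closure {u p} ⊆ C.1 := C.2.2 isIrreducible_singleton.closure h1
  have h3 : genericMap F C o ⤳ u p := by
    rw [specializes_iff_mem_closure, hC]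
    exact h2 (subset_closure (Set.mem_singleton _))
  have h4 : p = Spec.map e o := u.injective ((hs'.antisymm h3).eq.trans hu.symm)
  rw [← ho, ← h4]

end FiberProductCharts

/-! ### The character group of a component of a fiber product -/

section CharacterGroup

open AddMonoidAlgebra

theorem prod_sup_sup {M N : Type*} [AddCommMonoid M] [AddCommMonoid N] (P P' : AddSubmonoid M)
    (Q Q' : AddSubmonoid N) : (P ⊔ P').prod (Q ⊔ Q') = P.prod Q ⊔ P'.prod Q' := by
  refine le_antisymm (AddSubmonoid.prod_le_iff.mpr ⟨?_, ?_⟩) (sup_le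
    (AddSubmonoid.prod_mono le_sup_left le_sup_left)
    (AddSubmonoid.prod_mono le_sup_right le_sup_right))
  · rw [AddSubmonoid.map_sup, AddSubmonoid.map_inl, AddSubmonoid.map_inl]
    exact sup_le_sup (AddSubmonoid.prod_mono le_rfl bot_le) (AddSubmonoid.prod_mono le_rfl bot_le)
  · rw [AddSubmonoid.map_sup, AddSubmonoid.map_inr, AddSubmonoid.map_inr]
    exact sup_le_sup (AddSubmonoid.prod_mono bot_le le_rfl) (AddSubmonoid.prod_mono bot_le le_rfl)

/-- Inverting `(a, b)` inverts both factors: `(-a, 0) = (0, b) - (a, b)`, and symmetrically. So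
faces of products come from single elements. -/
theorem prod_sup_neg {M N : Type*} [AddCommGroup M] [AddCommGroup N] {P : AddSubmonoid M}
    {Q : AddSubmonoid N} {a : M} {b : N} (ha : a ∈ P) (hb : b ∈ Q) :
    (P ⊔ AddSubmonoid.closure {-a}).prod (Q ⊔ AddSubmonoid.closure {-b}) =
      P.prod Q ⊔ AddSubmonoid.closure {-(a, b)} := by
  have hab : -(a, b) ∈ P.prod Q ⊔ AddSubmonoid.closure {-(a, b)} :=
    AddSubmonoid.mem_sup_right (AddSubmonoid.subset_closure (Set.mem_singleton _))
  rw [prod_sup_sup]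
  refine le_antisymm (sup_le le_sup_left (AddSubmonoid.prod_le_iff.mpr ⟨?_, ?_⟩))
    (sup_le_sup_left ?_ _)
  · rw [AddMonoidHom.map_mclosure, AddSubmonoid.closure_le, Set.image_singleton,
      Set.singleton_subset_iff]
    have h : (AddMonoidHom.inl M N) (-a) = (0, b) + -(a, b) := by ext <;> simp
    rw [h]
    exact add_mem (AddSubmonoid.mem_sup_left ⟨zero_mem P, hb⟩) hab
  · rw [AddMonoidHom.map_mclosure, AddSubmonoid.closure_le, Set.image_singleton,
      Set.singleton_subset_iff]
    have h : (AddMonoidHom.inr M N) (-b) = (a, 0) + -(a, b) := by ext <;> simp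
    rw [h]
    exact add_mem (AddSubmonoid.mem_sup_left ⟨ha, zero_mem Q⟩) hab
  · rw [AddSubmonoid.closure_le, Set.singleton_subset_iff]
    exact ⟨AddSubmonoid.subset_closure (Set.mem_singleton _),
      AddSubmonoid.subset_closure (Set.mem_singleton _)⟩

theorem closure_map_prod_eq_top {M N A : Type*} [AddCommGroup M] [AddCommGroup N] [AddCommGroup A]
    {P : AddSubmonoid M} {Q : AddSubmonoid N} (hP : AddSubgroup.closure (P : Set M) = ⊤)
    (hQ : AddSubgroup.closure (Q : Set N) = ⊤) {q : M × N →+ A} (hq : Function.Surjective q) :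
    AddSubgroup.closure ((P.prod Q).map q : Set A) = ⊤ := by
  rw [AddSubmonoid.coe_map, ← AddMonoidHom.map_closure, AddSubmonoid.coe_prod,
    AddSubgroup.closure_prod (zero_mem P) (zero_mem Q), hP, hQ, AddSubgroup.top_prod_top,
    AddSubgroup.map_top_of_surjective _ hq]

theorem exists_quotient_char {G G' L : Type*} [AddCommGroup G] [AddCommGroup G'] [CommMonoid L]
    (χ : Multiplicative G →* L) (χ' : Multiplicative G' →* L) (Z : Set (G × G'))
    (hZ : ∀ z ∈ Z, χ (Multiplicative.ofAdd z.1) * χ' (Multiplicative.ofAdd z.2) = 1) :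
    ∃ η : Multiplicative ((G × G') ⧸ AddSubgroup.closure Z) →* L, ∀ z : G × G',
      η (Multiplicative.ofAdd (QuotientAddGroup.mk' _ z)) =
        χ (Multiplicative.ofAdd z.1) * χ' (Multiplicative.ofAdd z.2) := by
  let h : G × G' →+ Additive L :=
    { toFun := fun z => Additive.ofMul
        (χ (Multiplicative.ofAdd z.1) * χ' (Multiplicative.ofAdd z.2))
      map_zero' := by
        change χ 1 * χ' 1 = 1
        rw [map_one, map_one, one_mul]
      map_add' := by
        intro a b
        change χ (Multiplicative.ofAdd a.1 * Multiplicative.ofAdd b.1) *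
          χ' (Multiplicative.ofAdd a.2 * Multiplicative.ofAdd b.2) =
            (χ (Multiplicative.ofAdd a.1) * χ' (Multiplicative.ofAdd a.2)) *
              (χ (Multiplicative.ofAdd b.1) * χ' (Multiplicative.ofAdd b.2))
        rw [map_mul, map_mul, mul_mul_mul_comm] }
  have hk : AddSubgroup.closure Z ≤ h.ker := (AddSubgroup.closure_le _).mpr hZ
  let l : (G × G') ⧸ AddSubgroup.closure Z →+ Additive L := QuotientAddGroup.lift _ h hk
  exact ⟨⟨⟨fun a => (l a.toAdd).toMul, congrArg Additive.toMul (map_zero l)⟩,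
    fun a b => congrArg Additive.toMul (map_add l a.toAdd b.toAdd)⟩, fun z => rfl⟩

variable {k : Type u} [Field k] {L : Type u} [Field L] [Algebra k L]
  {M N : Type} [AddCommGroup M] [AddCommGroup N]

/-- The algebra homomorphism `ε : k[S] → L` is the character `χ` on the face `S ∩ G` of `S` and
zero on the other monomials. -/
structure IsFaceEval {S : AddSubmonoid M} {G : AddSubgroup M} (χ : Multiplicative G →* L)
    (ε : AddMonoidAlgebra k S →ₐ[k] L) : Prop where
  of_mem (m : S) (hm : m.1 ∈ G) : ε (single m 1) = χ (Multiplicative.ofAdd ⟨m.1, hm⟩)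
  of_notMem (m : S) (hm : m.1 ∉ G) : ε (single m 1) = 0

section

variable {S : AddSubmonoid M} {G : AddSubgroup M} {χ : Multiplicative G →* L}
  {ε : AddMonoidAlgebra k S →ₐ[k] L} {S' : AddSubmonoid N} {G' : AddSubgroup N}
  {χ' : Multiplicative G' →* L} {ε' : AddMonoidAlgebra k S' →ₐ[k] L}

theorem single_eq_smul {P : Type*} [AddMonoid P] (m : P) (c : k) :
    (single m c : AddMonoidAlgebra k P) = c • single m 1 := by
  rw [smul_single, smul_eq_mul, mul_one]

theorem IsFaceEval.mem_grp_iff (hε : IsFaceEval χ ε) (m : S) : m.1 ∈ G ↔ ε (single m 1) ≠ 0 := by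
  refine ⟨fun h => ?_, fun h => ?_⟩
  · rw [hε.of_mem m h]
    exact ((Group.isUnit _).map χ).ne_zero
  · by_contra h0
    exact h (hε.of_notMem m h0)

theorem IsFaceEval.face (hε : IsFaceEval χ ε) (a : M) (ha : a ∈ S) (b : M) (hb : b ∈ S)
    (h : a + b ∈ G) : a ∈ G := by
  have h1 := (hε.mem_grp_iff (⟨a, ha⟩ + ⟨b, hb⟩)).mp h
  rw [← one_mul (1 : k), ← single_mul_single, map_mul] at h1
  exact (hε.mem_grp_iff ⟨a, ha⟩).mpr (left_ne_zero_of_mul h1)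

theorem IsFaceEval.mem_of_forall (hε : IsFaceEval χ ε) {B : Subalgebra k L}
    (h : ∀ m : G, m.1 ∈ S → χ (Multiplicative.ofAdd m) ∈ B) (f : AddMonoidAlgebra k S) :
    ε f ∈ B := by
  induction f using AddMonoidAlgebra.induction_linear with
  | zero => rw [map_zero]; exact zero_mem B
  | add f g hf hg => rw [map_add]; exact add_mem hf hg
  | single m c =>
    rw [single_eq_smul, map_smul]
    refine B.smul_mem ?_ c
    by_cases hm : m.1 ∈ G
    · rw [hε.of_mem m hm]
      exact h ⟨m.1, hm⟩ m.2
    · rw [hε.of_notMem m hm]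
      exact zero_mem B

variable {A : Type} [AddCommGroup A] {q : G × G' →+ A} {η : Multiplicative A →* L}
  (hη : ∀ z : G × G', η (Multiplicative.ofAdd (q z)) =
    χ (Multiplicative.ofAdd z.1) * χ' (Multiplicative.ofAdd z.2))

include hη

/-- The chart ring is generated by the two factors, whose monomials map either to zero or to values
of the characters. -/
theorem mem_range_iff_mem_adjoin_charValues (hε : IsFaceEval χ ε) (hε' : IsFaceEval χ' ε')
    {R : Type*} [CommRing R] {i₁ : AddMonoidAlgebra k S →+* R} {i₂ : AddMonoidAlgebra k S' →+* R}
    (hgen : ∀ B : Subring R, i₁.range ≤ B → i₂.range ≤ B → B = ⊤) {e : R →+* L}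
    (h₁ : ∀ f, e (i₁ f) = ε f) (h₂ : ∀ f, e (i₂ f) = ε' f) (z : L) :
    z ∈ e.range ↔ z ∈ Algebra.adjoin k
      (charValues η (((S.comap G.subtype).prod (S'.comap G'.subtype)).map q)) := by
  set D := ((S.comap G.subtype).prod (S'.comap G'.subtype)).map q
  have hmem : ∀ a : G, a.1 ∈ S → ∀ b : G', b.1 ∈ S' →
      χ (Multiplicative.ofAdd a) * χ' (Multiplicative.ofAdd b) ∈
        Algebra.adjoin k (charValues η D) := fun a ha b hb =>
    Algebra.subset_adjoin ⟨q (a, b), ⟨(a, b), ⟨ha, hb⟩, rfl⟩, hη (a, b)⟩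
  have hχ : χ (Multiplicative.ofAdd 0) = 1 := map_one χ
  have hχ' : χ' (Multiplicative.ofAdd 0) = 1 := map_one χ'
  constructor
  · rintro ⟨r, rfl⟩
    have htop := hgen ((Algebra.adjoin k (charValues η D)).toSubring.comap e) (by
      rintro _ ⟨f, rfl⟩
      change e (i₁ f) ∈ Algebra.adjoin k (charValues η D)
      rw [h₁]
      exact hε.mem_of_forall (fun m hm => by
        simpa only [hχ', mul_one] using hmem m hm 0 (zero_mem S')) f) (by
      rintro _ ⟨f, rfl⟩
      change e (i₂ f) ∈ Algebra.adjoin k (charValues η D)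
      rw [h₂]
      exact hε'.mem_of_forall (fun m hm => by
        simpa only [hχ, one_mul] using hmem 0 (zero_mem S) m hm) f)
    exact (htop ▸ Subring.mem_top r :
      r ∈ (Algebra.adjoin k (charValues η D)).toSubring.comap e)
  · intro hz
    induction hz using Algebra.adjoin_induction with
    | mem z hz =>
      obtain ⟨_, ⟨⟨a, b⟩, ⟨ha, hb⟩, rfl⟩, rfl⟩ := hz
      refine ⟨i₁ (single ⟨a.1, ha⟩ 1) * i₂ (single ⟨b.1, hb⟩ 1), ?_⟩
      rw [map_mul, h₁, h₂, hε.of_mem _ a.2, hε'.of_mem _ b.2]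
      exact (hη (a, b)).symm
    | algebraMap c => exact ⟨i₁ (algebraMap k _ c), by rw [h₁, AlgHom.commutes]⟩
    | add x y _ _ hx hy => exact add_mem hx hy
    | mul x y _ _ hx hy => exact mul_mem hx hy

omit hη in
theorem lift_faceHom_eq (hε : IsFaceEval χ ε) {α : G →+ A}
    (hα : ∀ m, η (Multiplicative.ofAdd (α m)) = χ (Multiplicative.ofAdd m))
    (f : AddMonoidAlgebra k S) :
    AddMonoidAlgebra.lift k L A η (faceHom k S G hε.face α f) = ε f := by
  induction f using AddMonoidAlgebra.induction_linear with
  | zero => simp only [map_zero]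
  | add f g hf hg => simp only [map_add, hf, hg]
  | single m c =>
    by_cases hm : m.1 ∈ G
    · rw [faceHom_single_of_mem _ _ _ _ _ m hm, lift_single, hα, single_eq_smul m, map_smul,
        hε.of_mem m hm]
    · rw [faceHom_single_of_notMem _ _ _ _ _ m hm, map_zero, single_eq_smul, map_smul,
        hε.of_notMem m hm, smul_zero]

/-- On each factor keep the monomials that survive at the point and kill the others. The two maps
agree on `k[P]` and hence define a map from the pushout; it is onto because `G` and `G'` lie in the
monoids. -/
theorem exists_surjective_groupAlgebra (hε : IsFaceEval χ ε) (hε' : IsFaceEval χ' ε')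
    (hS : ∀ m ∈ G, m ∈ S) (hS' : ∀ m ∈ G', m ∈ S') (hq : Function.Surjective q)
    {B : Type} [AddCommGroup B] {P : AddSubmonoid B} {φ : B →+ M} {ψ : B →+ N}
    (hφ : P ≤ S.comap φ) (hψ : P ≤ S'.comap ψ)
    (hq0 : ∀ b ∈ P, ∀ (h : φ b ∈ G) (h' : ψ b ∈ G'), q (⟨φ b, h⟩, 0) = q (0, ⟨ψ b, h'⟩))
    {R : CommRingCat.{u}} {i₁ : .of (AddMonoidAlgebra k S) ⟶ R}
    {i₂ : .of (AddMonoidAlgebra k S') ⟶ R}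
    (hpo : IsPushout (CommRingCat.ofHom (mapDomainRingHom k (restrictHom φ hφ)))
      (CommRingCat.ofHom (mapDomainRingHom k (restrictHom ψ hψ))) i₁ i₂)
    {e : R ⟶ .of L} (h₁ : ∀ f, e.hom (i₁.hom f) = ε f) (h₂ : ∀ f, e.hom (i₂.hom f) = ε' f) :
    ∃ π : R →+* AddMonoidAlgebra k A, Function.Surjective π ∧
      ∀ r, AddMonoidAlgebra.lift k L A η (π r) = e.hom r := by
  let α : G →+ A := q.comp (AddMonoidHom.inl G G')
  let α' : G' →+ A := q.comp (AddMonoidHom.inr G G')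
  have hα : ∀ m, η (Multiplicative.ofAdd (α m)) = χ (Multiplicative.ofAdd m) := by
    intro m
    refine (hη (m, 0)).trans ?_
    rw [ofAdd_zero, map_one, mul_one]
  have hα' : ∀ m, η (Multiplicative.ofAdd (α' m)) = χ' (Multiplicative.ofAdd m) := by
    intro m
    refine (hη (0, m)).trans ?_
    rw [ofAdd_zero, map_one, one_mul]
  have hcomm : ∀ f : AddMonoidAlgebra k P, i₁.hom (mapDomainRingHom k (restrictHom φ hφ) f) =
      i₂.hom (mapDomainRingHom k (restrictHom ψ hψ) f) := fun f =>
    congrArg (fun g => g.hom f) hpo.w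
  have hw : CommRingCat.ofHom (mapDomainRingHom k (restrictHom φ hφ)) ≫
      CommRingCat.ofHom (faceHom k S G hε.face α).toRingHom =
        CommRingCat.ofHom (mapDomainRingHom k (restrictHom ψ hψ)) ≫
          CommRingCat.ofHom (faceHom k S' G' hε'.face α').toRingHom := by
    ext1
    refine RingHom.ext fun f => ?_
    change faceHom k S G hε.face α (mapDomainRingHom k (restrictHom φ hφ) f) =
      faceHom k S' G' hε'.face α' (mapDomainRingHom k (restrictHom ψ hψ) f)
    induction f using AddMonoidAlgebra.induction_linear with
    | zero => simp only [map_zero]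
    | add f g hf hg => simp only [map_add, hf, hg]
    | single b c =>
      rw [mapDomainRingHom_single, mapDomainRingHom_single]
      -- A function from the base has the same value at the point through both factors, so it is
      -- killed on one side exactly when it is killed on the other.
      have hb : (restrictHom φ hφ b).1 ∈ G ↔ (restrictHom ψ hψ b).1 ∈ G' := by
        rw [hε.mem_grp_iff, hε'.mem_grp_iff, ← h₁, ← h₂, ← mapDomainRingHom_single, hcomm,
          mapDomainRingHom_single]
      by_cases h : (restrictHom φ hφ b).1 ∈ G
      · rw [faceHom_single_of_mem _ _ _ _ _ _ h, faceHom_single_of_mem _ _ _ _ _ _ (hb.mp h)]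
        exact congrArg (fun a => single a c) (hq0 b.1 b.2 h (hb.mp h))
      · rw [faceHom_single_of_notMem _ _ _ _ _ _ h,
          faceHom_single_of_notMem _ _ _ _ _ _ (mt hb.mpr h)]
  let π : R ⟶ .of (AddMonoidAlgebra k A) := hpo.desc _ _ hw
  have hπ₁ : ∀ f, π.hom (i₁.hom f) = faceHom k S G hε.face α f := fun f =>
    congrArg (fun g => g.hom f) (hpo.inl_desc _ _ hw)
  have hπ₂ : ∀ f, π.hom (i₂.hom f) = faceHom k S' G' hε'.face α' f := fun f =>
    congrArg (fun g => g.hom f) (hpo.inr_desc _ _ hw)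
  refine ⟨π.hom, ?_, ?_⟩
  · rw [← RingHom.range_eq_top, ← top_le_iff]
    rintro f -
    induction f using AddMonoidAlgebra.induction_linear with
    | zero => exact zero_mem _
    | add f g hf hg => exact add_mem hf hg
    | single a c =>
      obtain ⟨⟨m, m'⟩, rfl⟩ := hq a
      refine ⟨i₁.hom (single ⟨m.1, hS _ m.2⟩ c) * i₂.hom (single ⟨m'.1, hS' _ m'.2⟩ 1), ?_⟩
      rw [map_mul, hπ₁, hπ₂, faceHom_single_of_mem k S G hε.face α ⟨m.1, hS _ m.2⟩ m.2,
        faceHom_single_of_mem k S' G' hε'.face α' ⟨m'.1, hS' _ m'.2⟩ m'.2, single_mul_single,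
        mul_one]
      congr 1
      change q (m, 0) + q (0, m') = q (m, m')
      rw [← map_add, Prod.mk_add_mk, add_zero, zero_add]
  · have h3 : π ≫ CommRingCat.ofHom (AddMonoidAlgebra.lift k L A η).toRingHom = e := by
      apply hpo.hom_ext
      · ext1
        refine RingHom.ext fun f => ?_
        change AddMonoidAlgebra.lift k L A η (π.hom (i₁.hom f)) = e.hom (i₁.hom f)
        rw [hπ₁, h₁, lift_faceHom_eq hε hα]
      · ext1
        refine RingHom.ext fun f => ?_
        change AddMonoidAlgebra.lift k L A η (π.hom (i₂.hom f)) = e.hom (i₂.hom f)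
        rw [hπ₂, h₂, lift_faceHom_eq hε' hα']
    exact fun r => congrArg (fun g => g.hom r) h3

end

end CharacterGroup

/-! ### Components of fiber products of toric varieties -/

section ComponentsOfFiberProducts

open AddMonoidAlgebra

variable {k : Type u} [Field k]

/-- `U_ρ'` is the locus in `U_ρ` where the monomial of some `a` is invertible. Replace `σ` by its
face where `φ a` vanishes: the monomial of `φ a` is non-zero at `q`, being the pullback of a unit on
`U_ρ'`. -/
theorem exists_shrink {V W : ToricVariety k} (f : V.X ⟶ W.X)
    {φ : (Fin W.rank → ℤ) →+ (Fin V.rank → ℤ)}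
    (hφ : V.torusIncl ≫ f = specMonoidMap k φ ≫ W.torusIncl) {σ : V.fan.cones}
    {ρ ρ' : W.fan.cones} (hle : ρ'.1 ≤ ρ.1) (h : dualMonoid ρ.1 ≤ (dualMonoid σ.1).comap φ)
    (q : specMonoid k (dualMonoid σ.1)) (hq : f (V.chart σ q) ∈ Set.range (W.chart ρ')) :
    ∃ σ' : V.fan.cones, V.chart σ q ∈ Set.range (V.chart σ') ∧
      dualMonoid ρ'.1 ≤ (dualMonoid σ'.1).comap φ := by
  obtain ⟨a, ha, ha', hd⟩ := W.fan.exists_separating ρ.2 ρ'.2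
  rw [inf_eq_right.mpr hle] at hd
  obtain ⟨σ', -, hd', hσ'⟩ := exists_face_chart V σ (h ha)
  refine ⟨σ', (hσ' q).mpr fun h0 => ?_, ?_⟩
  · obtain ⟨q', hq'⟩ := hq
    have h1 : specMonoidMap k (restrictHom φ h) q =
        specMonoidMap k (AddSubmonoid.inclusion (dualMonoid_anti hle)) q' := by
      apply (W.chart ρ).injective
      rw [← Scheme.Hom.comp_apply, ← Scheme.Hom.comp_apply, W.chart_face ρ ρ' hle, hq',
        ← chart_comp_hom f hφ h, Scheme.Hom.comp_apply]
    have h2 : single (⟨a, ha⟩ : dualMonoid ρ.1) (1 : k) ∈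
        (specMonoidMap k (restrictHom φ h) q).asIdeal := by
      change mapDomainRingHom k _ _ ∈ q.asIdeal
      rw [mapDomainRingHom_single]
      exact h0
    rw [h1] at h2
    change mapDomainRingHom k _ _ ∈ q'.asIdeal at h2
    rw [mapDomainRingHom_single] at h2
    refine q'.isPrime.ne_top ((Ideal.eq_top_iff_one _).mpr ?_)
    have h3 := q'.asIdeal.mul_mem_left (single (⟨-a, ha'⟩ : dualMonoid ρ'.1) (1 : k)) h2
    rw [single_mul_single, one_mul] at h3
    have h4 : (⟨-a, ha'⟩ + AddSubmonoid.inclusion (dualMonoid_anti hle) ⟨a, ha⟩ :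
        dualMonoid ρ'.1) = 0 := Subtype.ext (neg_add_cancel a)
    rw [h4] at h3
    exact h3
  · rw [hd, hd']
    refine sup_le (h.trans (AddSubmonoid.monotone_comap le_sup_left)) ?_
    rw [AddSubmonoid.closure_le, Set.singleton_subset_iff]
    change φ (-a) ∈ dualMonoid σ.1 ⊔ AddSubmonoid.closure {-φ a}
    rw [map_neg]
    exact AddSubmonoid.mem_sup_right (AddSubmonoid.subset_closure (Set.mem_singleton _))

variable {X Y B : ToricVariety k} (f : X.Hom B) (g : Y.Hom B)
  {φ : (Fin B.rank → ℤ) →+ (Fin X.rank → ℤ)} {ψ : (Fin B.rank → ℤ) →+ (Fin Y.rank → ℤ)}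

/-- The first projection of the fiber product. -/
def fiberProductFst : fiberProduct f g ⟶ X.X := pullback.fst f.hom g.hom

/-- The second projection of the fiber product. -/
def fiberProductSnd : fiberProduct f g ⟶ Y.X := pullback.snd f.hom g.hom

theorem fiberProduct_condition : fiberProductFst f g ≫ f.hom = fiberProductSnd f g ≫ g.hom :=
  pullback.condition

/-- Some chart of the base contains the images of the charts `U_σ` and `U_τ`. -/
def Compatible (φ : (Fin B.rank → ℤ) →+ (Fin X.rank → ℤ))
    (ψ : (Fin B.rank → ℤ) →+ (Fin Y.rank → ℤ)) (σ : X.fan.cones) (τ : Y.fan.cones) : Prop :=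
  ∃ ρ : B.fan.cones, dualMonoid ρ.1 ≤ (dualMonoid σ.1).comap φ ∧
    dualMonoid ρ.1 ≤ (dualMonoid τ.1).comap ψ

theorem Compatible.mono {σ σ' : X.fan.cones} {τ τ' : Y.fan.cones} (h : Compatible φ ψ σ τ)
    (hσ : σ'.1 ≤ σ.1) (hτ : τ'.1 ≤ τ.1) : Compatible φ ψ σ' τ' := by
  obtain ⟨ρ, h1, h2⟩ := h
  exact ⟨ρ, h1.trans (AddSubmonoid.monotone_comap (dualMonoid_anti hσ)),
    h2.trans (AddSubmonoid.monotone_comap (dualMonoid_anti hτ))⟩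

/-- Charts around the two projections map into charts of `ρ₁` and `ρ₂`. The common image lies in the
chart of `ρ₁ ⊓ ρ₂`, and both source charts are shrunk to map there. -/
theorem exists_compatible (hφ : X.torusIncl ≫ f.hom = specMonoidMap k φ ≫ B.torusIncl)
    (hψ : Y.torusIncl ≫ g.hom = specMonoidMap k ψ ≫ B.torusIncl) (p : fiberProduct f g) :
    ∃ σ τ, Compatible φ ψ σ τ ∧ fiberProductFst f g p ∈ Set.range (X.chart σ) ∧
      fiberProductSnd f g p ∈ Set.range (Y.chart τ) := by
  have hX := Set.mem_univ (fiberProductFst f g p)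
  rw [← X.chart_cover] at hX
  obtain ⟨σ, q, hq⟩ := Set.mem_iUnion.mp hX
  have hY := Set.mem_univ (fiberProductSnd f g p)
  rw [← Y.chart_cover] at hY
  obtain ⟨τ, q', hq'⟩ := Set.mem_iUnion.mp hY
  obtain ⟨ρ₁, h₁⟩ := exists_dualMonoid_le_comap f.hom hφ σ
  obtain ⟨ρ₂, h₂⟩ := exists_dualMonoid_le_comap g.hom hψ τ
  have heq : f.hom (X.chart σ q) = g.hom (Y.chart τ q') := by
    rw [hq, hq', ← Scheme.Hom.comp_apply, ← Scheme.Hom.comp_apply, fiberProduct_condition]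
  let ρ : B.fan.cones := ⟨ρ₁.1 ⊓ ρ₂.1, B.fan.inf_mem ρ₁ ρ₂⟩
  have hb : f.hom (X.chart σ q) ∈ Set.range (B.chart ρ) := by
    rw [← B.chart_inter]
    constructor
    · rw [← Scheme.Hom.comp_apply, chart_comp_hom f.hom hφ h₁, Scheme.Hom.comp_apply]
      exact ⟨_, rfl⟩
    · rw [heq, ← Scheme.Hom.comp_apply, chart_comp_hom g.hom hψ h₂, Scheme.Hom.comp_apply]
      exact ⟨_, rfl⟩
  obtain ⟨σ', hσ', hσ''⟩ := exists_shrink f.hom hφ (ρ' := ρ) inf_le_left h₁ q hb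
  obtain ⟨τ', hτ', hτ''⟩ := exists_shrink g.hom hψ (ρ' := ρ) inf_le_right h₂ q' (heq ▸ hb)
  exact ⟨σ', τ', ⟨ρ, hσ'', hτ''⟩, hq ▸ hσ', hq' ▸ hτ'⟩

variable {f g} {L : Type u} [Field L] [Algebra k L] {γ : Spec (.of L) ⟶ fiberProduct f g}

theorem exists_fiberProduct_chart (hφ : X.torusIncl ≫ f.hom = specMonoidMap k φ ≫ B.torusIncl)
    (hψ : Y.torusIncl ≫ g.hom = specMonoidMap k ψ ≫ B.torusIncl)
    (hx : (γ ≫ fiberProductFst f g) ≫ X.str = Spec.map (CommRingCat.ofHom (algebraMap k L)))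
    (hy : (γ ≫ fiberProductSnd f g) ≫ Y.str = Spec.map (CommRingCat.ofHom (algebraMap k L)))
    {σ : X.fan.cones} {τ : Y.fan.cones} {ρ : B.fan.cones}
    (hσ : IsChartAt (γ ≫ fiberProductFst f g) σ)
    (hτ : IsChartAt (γ ≫ fiberProductSnd f g) τ)
    (h₁ : dualMonoid ρ.1 ≤ (dualMonoid σ.1).comap φ)
    (h₂ : dualMonoid ρ.1 ≤ (dualMonoid τ.1).comap ψ) :
    ∃ (R : CommRingCat.{u}) (i₁ : .of (AddMonoidAlgebra k (dualMonoid σ.1)) ⟶ R)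
      (i₂ : .of (AddMonoidAlgebra k (dualMonoid τ.1)) ⟶ R) (u : Spec R ⟶ fiberProduct f g)
      (e : R ⟶ .of L) (ε : AddMonoidAlgebra k (dualMonoid σ.1) →ₐ[k] L)
      (ε' : AddMonoidAlgebra k (dualMonoid τ.1) →ₐ[k] L),
      IsPushout (CommRingCat.ofHom (mapDomainRingHom k (restrictHom φ h₁)))
        (CommRingCat.ofHom (mapDomainRingHom k (restrictHom ψ h₂))) i₁ i₂ ∧
      (∀ A : Subring R, i₁.hom.range ≤ A → i₂.hom.range ≤ A → A = ⊤) ∧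
      IsOpenImmersion u ∧
      Set.range u = fiberProductFst f g ⁻¹' Set.range (X.chart σ) ∩
        fiberProductSnd f g ⁻¹' Set.range (Y.chart τ) ∧
      Spec.map e ≫ u = γ ∧
      IsEval (γ ≫ fiberProductFst f g) σ ε ∧ IsEval (γ ≫ fiberProductSnd f g) τ ε' ∧
      (∀ a, e.hom (i₁.hom a) = ε a) ∧ ∀ a, e.hom (i₂.hom a) = ε' a := by
  have key : ∃ (R : CommRingCat.{u})
      (i₁ : .of (AddMonoidAlgebra k (dualMonoid σ.1)) ⟶ R)
      (i₂ : .of (AddMonoidAlgebra k (dualMonoid τ.1)) ⟶ R) (u : Spec R ⟶ fiberProduct f g),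
      IsPushout (CommRingCat.ofHom (mapDomainRingHom k (restrictHom φ h₁)))
        (CommRingCat.ofHom (mapDomainRingHom k (restrictHom ψ h₂))) i₁ i₂ ∧
      (∀ A : Subring R, i₁.hom.range ≤ A → i₂.hom.range ≤ A → A = ⊤) ∧ IsOpenImmersion u ∧
      u ≫ fiberProductFst f g = Spec.map i₁ ≫ X.chart σ ∧
      u ≫ fiberProductSnd f g = Spec.map i₂ ≫ Y.chart τ ∧
      Set.range u = fiberProductFst f g ⁻¹' Set.range (X.chart σ) ∩
        fiberProductSnd f g ⁻¹' Set.range (Y.chart τ) :=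
    exists_pullback_chart f.hom g.hom (X.chart σ) (Y.chart τ) (B.chart ρ) _ _
      (chart_comp_hom f.hom hφ h₁) (chart_comp_hom g.hom hψ h₂)
  obtain ⟨R, i₁, i₂, u, hpo, hgen, hu, hu₁, hu₂, hrange⟩ := key
  have hle : Set.range γ ⊆ Set.range u := by
    rintro _ ⟨p, rfl⟩
    rw [hrange]
    constructor
    · exact hσ ⟨p, Scheme.Hom.comp_apply ..⟩
    · exact hτ ⟨p, Scheme.Hom.comp_apply ..⟩
  obtain ⟨e, he⟩ := Spec.map_surjective (IsOpenImmersion.lift u γ hle)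
  have hfac : Spec.map e ≫ u = γ := by rw [he]; exact IsOpenImmersion.lift_fac ..
  obtain ⟨ε, hε⟩ := exists_isEval hx hσ
  obtain ⟨ε', hε'⟩ := exists_isEval hy hτ
  have he₁ : i₁ ≫ e = CommRingCat.ofHom ε.toRingHom := by
    rw [← Spec.map_inj, ← cancel_mono (X.chart σ), Spec.map_comp, Category.assoc, ← hu₁,
      ← Category.assoc, hfac]
    exact hε.symm
  have he₂ : i₂ ≫ e = CommRingCat.ofHom ε'.toRingHom := by
    rw [← Spec.map_inj, ← cancel_mono (Y.chart τ), Spec.map_comp, Category.assoc, ← hu₂,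
      ← Category.assoc, hfac]
    exact hε'.symm
  exact ⟨R, i₁, i₂, u, e, ε, ε', hpo, hgen, hu, hrange, hfac, hε, hε',
    fun a => congrArg (fun h => h.hom a) he₁, fun a => congrArg (fun h => h.hom a) he₂⟩

theorem PointChar.isFaceEval {V : ToricVariety k} {x : Spec (.of L) ⟶ V.X} (P : PointChar V L x)
    {σ : V.fan.cones} {ε} (hε : IsEval x σ ε) : IsFaceEval P.char ε :=
  ⟨P.eval_of_mem σ ε hε, P.eval_of_notMem σ ε hε⟩

end ComponentsOfFiberProducts

/-! ### The normalization of a component -/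

section NormalizedComponents

open AddMonoidAlgebra

variable {k : Type u} [Field k] {X Y B : ToricVariety k} {f : X.Hom B} {g : Y.Hom B}

/-- Both halves of the theorem at once: the field `K` enters only through an embedding into the
function field with image `k[ζ]`. -/
theorem exists_isToricOver (C : irreducibleComponents (fiberProduct f g))
    [Algebra k (component (fiberProduct f g) C).functionField]
    (hL : genericMap (fiberProduct f g) C ≫ fiberProductStr f g = Spec.map (CommRingCat.ofHom
      (algebraMap k (component (fiberProduct f g) C).functionField))) :
    ∃ n : ℕ, (n : k) ≠ 0 ∧ ∃ ζ : (component (fiberProduct f g) C).functionField,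
      IsPrimitiveRoot ζ n ∧ ∀ (K : Type u) [Field K] [Algebra k K] [Algebra.IsIntegral k K]
        (j : K →ₐ[k] (component (fiberProduct f g) C).functionField),
        j.range = Algebra.adjoin k {ζ} → IsToricOver K (normalizedComponentStr f g C) := by
  obtain ⟨φ, hφ⟩ := f.exists_torusHom
  obtain ⟨ψ, hψ⟩ := g.exists_torusHom
  let L : Type u := (component (fiberProduct f g) C).functionField
  let γ : Spec (.of L) ⟶ fiberProduct f g := genericMap (fiberProduct f g) C
  have hx : (γ ≫ fiberProductFst f g) ≫ X.str = Spec.map (CommRingCat.ofHom (algebraMap k L)) := by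
    rw [Category.assoc]
    exact hL
  have hy : (γ ≫ fiberProductSnd f g) ≫ Y.str =
      Spec.map (CommRingCat.ofHom (algebraMap k L)) := by
    rw [Category.assoc, ← g.hom_str, ← Category.assoc (fiberProductSnd f g),
      ← fiberProduct_condition, Category.assoc, f.hom_str, ← Category.assoc, hx]
  obtain ⟨P⟩ := nonempty_pointChar hx
  obtain ⟨P'⟩ := nonempty_pointChar hy
  obtain ⟨p⟩ : Nonempty (Spec (.of L)) := inferInstance
  have h0 : Compatible φ ψ P.minCone P'.minCone := by
    obtain ⟨σ, τ, hc, hσ, hτ⟩ := exists_compatible f g hφ hψ (γ p)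
    refine hc.mono (P.minCone_le σ ((isChartAt_iff p).mpr ?_))
      (P'.minCone_le τ ((isChartAt_iff p).mpr ?_))
    · rw [Scheme.Hom.comp_apply]; exact hσ
    · rw [Scheme.Hom.comp_apply]; exact hτ
  have h0' := h0
  obtain ⟨ρ, hρ, hρ'⟩ := h0'
  obtain ⟨R₀, i₁, i₂, u₀, e₀, ε, ε', hpo, -, hu₀, -, he₀, hε, hε', he₁, he₂⟩ :=
    exists_fiberProduct_chart hφ hψ hx hy P.isChartAt_minCone P'.isChartAt_minCone hρ hρ'
  -- The relations imposed by the base: a function from `B` that is non-zero at the generic point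
  -- has the same value through `X` and `Y`.
  let Z : Set (P.grp × P'.grp) := {z | ∃ b ∈ dualMonoid ρ.1, z.1.1 = φ b ∧ z.2.1 = -ψ b}
  have hZ : ∀ z ∈ Z, P.char (Multiplicative.ofAdd z.1) * P'.char (Multiplicative.ofAdd z.2) = 1 := by
    rintro ⟨⟨a, ha⟩, ⟨c, hc⟩⟩ ⟨b, hb, rfl, rfl⟩
    have hc' : ψ b ∈ P'.grp := neg_mem_iff.mp hc
    have h1 : ε (single ⟨φ b, hρ hb⟩ 1) = ε' (single ⟨ψ b, hρ' hb⟩ 1) := by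
      have h2 := congrArg (fun h => e₀.hom (h.hom (single ⟨b, hb⟩ 1))) hpo.w
      change e₀.hom (i₁.hom (mapDomainRingHom k _ _)) =
        e₀.hom (i₂.hom (mapDomainRingHom k _ _)) at h2
      rw [he₁, he₂, mapDomainRingHom_single, mapDomainRingHom_single] at h2
      exact h2
    rw [(P.isFaceEval hε).of_mem _ ha, (P'.isFaceEval hε').of_mem _ hc'] at h1
    refine (congrArg (· * P'.char (Multiplicative.ofAdd ⟨-ψ b, hc⟩)) h1).trans ?_
    rw [← map_mul, ← ofAdd_add]
    exact (congrArg (fun m => P'.char (Multiplicative.ofAdd m))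
      (Subtype.ext (add_neg_cancel (ψ b)) : (⟨ψ b, hc'⟩ + ⟨-ψ b, hc⟩ : P'.grp) = 0)).trans
      (map_one P'.char)
  obtain ⟨η, hη⟩ := exists_quotient_char P.char P'.char Z hZ
  let A := (P.grp × P'.grp) ⧸ AddSubgroup.closure Z
  let q : P.grp × P'.grp →+ A := QuotientAddGroup.mk' (AddSubgroup.closure Z)
  have hq : Function.Surjective q := QuotientAddGroup.mk'_surjective _
  have hA : AddGroup.FG A := by
    rw [AddGroup.fg_iff_addMonoid_fg]
    refine ⟨?_⟩
    have h1 := ((P.fg_monoid hx P.isChartAt_minCone).prod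
      (P'.fg_monoid hy P'.isChartAt_minCone)).map q
    rwa [P.monoid_minCone, P'.monoid_minCone, AddSubmonoid.top_prod_top,
      ← AddMonoidHom.mrange_eq_map, AddMonoidHom.mrange_eq_top.mpr hq] at h1
  obtain ⟨r, w, s, hs, hw⟩ := exists_free_quotient A
  obtain ⟨n, hn, ζ, hζ, hadj⟩ := exists_primitiveRoot_adjoin_eq (k := k) w.ker hw η
  refine ⟨n, hn, ζ, hζ, fun K _ _ _ j hj => ?_⟩
  rw [← hadj] at hj
  have hmin : ∀ Q : Ideal (AddMonoidAlgebra k A), Q.IsPrime →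
      Q ≤ RingHom.ker (AddMonoidAlgebra.lift k L A η) →
      RingHom.ker (AddMonoidAlgebra.lift k L A η) ≤ Q := by
    intro Q hQ hle
    have hq0 : ∀ b ∈ dualMonoid ρ.1, ∀ (h : φ b ∈ P.grp) (h' : ψ b ∈ P'.grp),
        q (⟨φ b, h⟩, 0) = q (0, ⟨ψ b, h'⟩) := by
      intro b hb h h'
      rw [← sub_eq_zero, ← map_sub]
      refine (QuotientAddGroup.eq_zero_iff _).mpr (AddSubgroup.subset_closure ⟨b, hb, ?_, ?_⟩)
      · exact sub_zero (φ b)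
      · exact zero_sub (ψ b)
    obtain ⟨π, hπ, hπe⟩ := exists_surjective_groupAlgebra hη (P.isFaceEval hε)
      (P'.isFaceEval hε') P.grp_le P'.grp_le hq hρ hρ' hq0 hpo he₁ he₂
    -- Minimality holds in the chart ring of `F` and descends along the surjection `π` onto `k[A]`.
    have h1 := ker_le_of_le_ker (fiberProduct f g) C u₀ he₀ (P := Q.comap π) inferInstance (by
      intro z hz
      change e₀.hom z = 0
      rw [← hπe]
      exact hle hz)
    intro a ha
    obtain ⟨z, rfl⟩ := hπ a
    refine h1 (?_ : e₀.hom z = 0)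
    rw [← hπe]
    exact ha
  have hJ := laurentHom_injective hs hj hmin
  -- The charts of `F` through the generic point of `C`. Compatibility makes each of them the
  -- spectrum of a pushout; the submonoids `D i` all live in the one group `A`.
  let I := {i : X.fan.cones × Y.fan.cones // IsChartAt (γ ≫ fiberProductFst f g) i.1 ∧
    IsChartAt (γ ≫ fiberProductSnd f g) i.2 ∧ Compatible φ ψ i.1 i.2}
  have : Finite X.fan.cones := X.fan.finite
  have : Finite Y.fan.cones := Y.fan.finite
  have : Finite I := inferInstance
  have : Nonempty I := ⟨⟨(P.minCone, P'.minCone), P.isChartAt_minCone, P'.isChartAt_minCone, h0⟩⟩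
  let D (i : I) : AddSubmonoid A := ((P.monoid i.1.1).prod (P'.monoid i.1.2)).map q
  have hch : ∀ i : I, ∃ (R : CommRingCat.{u}) (u : Spec R ⟶ fiberProduct f g) (e : R ⟶ .of L),
      IsOpenImmersion u ∧ Set.range u = fiberProductFst f g ⁻¹' Set.range (X.chart i.1.1) ∩
        fiberProductSnd f g ⁻¹' Set.range (Y.chart i.1.2) ∧ Spec.map e ≫ u = γ ∧
      ∀ z, z ∈ e.hom.range ↔ z ∈ Algebra.adjoin k (charValues η (D i)) := by
    rintro ⟨⟨σ, τ⟩, hσ, hτ, ρ, h₁, h₂⟩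
    obtain ⟨R, i₁, i₂, u, e, ε, ε', -, hgen, hu, hr, he, hε, hε', he₁, he₂⟩ :=
      exists_fiberProduct_chart hφ hψ hx hy hσ hτ h₁ h₂
    exact ⟨R, u, e, hu, hr, he, mem_range_iff_mem_adjoin_charValues (q := q) hη
      (P.isFaceEval hε) (P'.isFaceEval hε') hgen he₁ he₂⟩
  choose R u e hu hr he hrange using hch
  have hDfg : ∀ i, (D i).FG := fun i =>
    ((P.fg_monoid hx i.2.1).prod (P'.fg_monoid hy i.2.2.1)).map q
  refine isToricOver_of_charts (fiberProductStr f g) C j.toRingHom ?_ (freeChar η s) hJ R u e he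
    (fun i => (D i).map w) (fun i => (hDfg i).map w) ?_ ?_ ?_ ?_ ?_ ?_
  · refine hL.trans ?_
    congr 2
    exact j.comp_algebraMap.symm
  · intro i
    rw [AddSubmonoid.coe_map, ← AddMonoidHom.map_closure,
      closure_map_prod_eq_top (P.closure_monoid hx i.2.1) (P'.closure_monoid hy i.2.2.1) hq,
      AddSubgroup.map_top_of_surjective _ fun m => ⟨s m, hs m⟩]
  · intro i z
    exact isIntegral_iff_mem_range_laurentHom hs hw hj hJ (hDfg i) (hrange i)
      (exists_mul_eq_of_chart _ C (u i) (he i)) z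
  · rintro ⟨⟨σ, τ⟩, hσ, hτ, hc⟩ _ ⟨_, ⟨⟨a, b⟩, ⟨ha, hb⟩, rfl⟩, rfl⟩
    obtain ⟨σ', hσ', hle, hd⟩ := P.exists_face hx hσ ha
    obtain ⟨τ', hτ', hle', hd'⟩ := P'.exists_face hy hτ hb
    refine ⟨⟨(σ', τ'), hσ', hτ', hc.mono hle hle'⟩, ?_⟩
    change ((((P.monoid σ').prod (P'.monoid τ')).map q).map w) = _
    rw [hd, hd', prod_sup_neg ha hb, AddSubmonoid.map_sup, AddSubmonoid.map_sup]
    congr 1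
    rw [AddMonoidHom.map_mclosure, AddMonoidHom.map_mclosure, Set.image_singleton,
      Set.image_singleton, map_neg, map_neg]
  · rintro ⟨⟨σ, τ⟩, hσ, hτ, hc⟩ ⟨⟨σ', τ'⟩, hσ', hτ', hc'⟩
    refine ⟨⟨(⟨σ.1 ⊓ σ'.1, X.fan.inf_mem σ σ'⟩, ⟨τ.1 ⊓ τ'.1, Y.fan.inf_mem τ τ'⟩),
      isChartAt_inf hσ hσ', isChartAt_inf hτ hτ', hc.mono inf_le_left inf_le_left⟩, ?_, ?_⟩
    · rw [hr, hr, hr, ← X.chart_inter, ← Y.chart_inter, Set.preimage_inter, Set.preimage_inter,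
        Set.inter_inter_inter_comm]
    · change (((P.monoid _).prod (P'.monoid _)).map q).map w = _
      rw [P.monoid_inf hx hσ hσ', P'.monoid_inf hy hτ hτ', prod_sup_sup, AddSubmonoid.map_sup,
        AddSubmonoid.map_sup]
  · rintro ⟨⟨σ, τ⟩, hσ, hτ, hc⟩ ⟨⟨σ', τ'⟩, hσ', hτ', hc'⟩
    obtain ⟨a, ha, -, hd⟩ := P.exists_separating hx hσ hσ'
    obtain ⟨b, hb, -, hd'⟩ := P'.exists_separating hy hτ hτ'
    -- Separating elements for `X` and for `Y` combine to one for the pair, carried to `ℤ^r` by the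
    -- quotient map and `w`.
    refine ⟨w (q (a, b)), ⟨_, ⟨(a, b), ⟨ha, hb⟩, rfl⟩, rfl⟩, ?_⟩
    change (((P.monoid σ).prod (P'.monoid τ)).map q).map w ⊔
      (((P.monoid σ').prod (P'.monoid τ')).map q).map w = _
    rw [← AddSubmonoid.map_sup, ← AddSubmonoid.map_sup, ← prod_sup_sup,
      ← P.monoid_inf hx hσ hσ', ← P'.monoid_inf hy hτ hτ', hd, hd', prod_sup_neg ha hb,
      AddSubmonoid.map_sup, AddSubmonoid.map_sup]
    congr 1
    rw [AddMonoidHom.map_mclosure, AddMonoidHom.map_mclosure, Set.image_singleton,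
      Set.image_singleton, map_neg, map_neg]
  · intro p' hp'
    obtain ⟨σ, τ, hc, hσ, hτ⟩ := exists_compatible f g hφ hψ p'
    -- The generic point specializes to every point of `C`, so charts around `p'` contain it and
    -- occur in the index set.
    have hs : γ p ⤳ p' := by
      rw [specializes_iff_mem_closure]
      exact (closure_genericMap (fiberProduct f g) C p).symm ▸ hp'
    refine ⟨⟨(σ, τ), (isChartAt_iff p).mpr ?_, (isChartAt_iff p).mpr ?_, hc⟩, ?_⟩
    · rw [Scheme.Hom.comp_apply]
      exact (hs.map (fiberProductFst f g).continuous).mem_open (X.chart σ).opensRange.isOpen hσ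
    · rw [Scheme.Hom.comp_apply]
      exact (hs.map (fiberProductSnd f g).continuous).mem_open (Y.chart τ).opensRange.isOpen hτ
    · rw [hr]
      exact ⟨hσ, hτ⟩

end NormalizedComponents

end Toric

end

theorem mainTheorem6 {k : Type u} [Field k] {X Y B : Toric.ToricVariety k}
    (f : X.Hom B) (g : Y.Hom B) (C : irreducibleComponents (Toric.fiberProduct f g)) :
    (∃ n : ℕ, (n : k) ≠ 0 ∧
      Toric.IsToricOver (CyclotomicField n k) (Toric.normalizedComponentStr f g C)) ∧
    ((∀ n : ℕ, (n : k) ≠ 0 → (Polynomial.X ^ n - 1 : Polynomial k).Splits) →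
      Toric.IsToricOver k (Toric.normalizedComponentStr f g C)) := by
  let F := Toric.fiberProduct f g
  -- The `k`-algebra structure of the function field is read off from the structure morphism of `F`.
  obtain ⟨a, ha⟩ := Spec.map_surjective (Toric.genericMap F C ≫ Toric.fiberProductStr f g)
  let _ : Algebra k (Toric.component F C).functionField := a.hom.toAlgebra
  obtain ⟨n, hn, ζ, hζ, h⟩ := Toric.exists_isToricOver C ha.symm
  refine ⟨⟨n, hn, ?_⟩, fun hsplits => ?_⟩
  · obtain ⟨j, hj⟩ := Toric.exists_cyclotomicField_algHom hn hζ
    have : NeZero (n : k) := ⟨hn⟩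
    have : NeZero n := NeZero.of_neZero_natCast k
    have : Algebra.IsIntegral k (CyclotomicField n k) := IsCyclotomicExtension.integral {n} k _
    exact h _ j hj
  -- Here `ζ` is the image of an element of `k`, so the field `K` may be taken to be `k` itself.
  · exact h k (Algebra.ofId k _) (Toric.adjoin_primitiveRoot_eq_bot hn hζ (hsplits n hn))
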